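/- **Setting.** Let $1\le r\le n\le m$. All matrix spaces carry the trace inner product and the Frobenius norm $\|\cdot\|_F$; $W_i$ is the $i$-th column of $W$; $\sigma_1(X)\ge\sigma_2(X)\ge\cdots$ are the singular values of $X$, with $\sigma_i(X)=0$ for $i>\min$ of the two dimensions; $\Sigma_\kappa(X)=\mathrm{Diag}(\sigma_1(X),\dots,\sigma_\kappa(X))$; $\mathbb O^{l\times r}$ is the set of $l\times r$ matrices with orthonormal columns, $\mathbb O^l=\mathbb O^{l\times l}$; and for $X\in\mathbb R^{n\times m}$, $\mathbb O^{n,m}(X)$ is the set of $(U,V)\in\mathbb O^n\times\mathbb O^m$ with $X=U[\Sigma_n(X)\ \ 0]V^\top$. Let $f:\mathbb R^{n\times m}\to\mathbb R$ be bounded below and differentiable with $L_f$-Lipschitz gradient, $\lambda,\mu>0$, and let $\theta:\mathbb R\to(-\infty,\infty]$ be lower semicontinuous with $\theta(0)=0$, $\theta>0$ on $(0,\infty)$, $\theta=\infty$ on $(-\infty,0)$, and $\theta$ finite and differentiable on $(0,\infty)$. Put $\vartheta(W)=\sum_{i}\theta(\|W_i\|)$, $$\Phi(U,V)=f(UV^\top)+\lambda[\vartheta(U)+\vartheta(V)]+\tfrac\mu2(\|U\|_F^2+\|V\|_F^2)\quad\text{on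 }\mathbb R^{n\times r}\times\mathbb R^{m\times r},$$ and let $\widehat\Phi(U,V,U',V')$ be $\Phi(U,V)$ with $f(UV^\top)$ replaced by $f(X')+\langle\nabla f(X'),UV^\top-X'\rangle+\frac{L_f}{2}\|UV^\top-X'\|_F^2$, $X'=U'V'^\top$. Let $\partial$ be the limiting subdifferential; the distance to the empty set is $+\infty$. A function $h$ has the KL property at $\bar x\in\mathrm{dom}\,\partial h$ if there are $\eta\in(0,\infty]$, a neighbourhood $\mathcal N$ of $\bar x$ and a continuous concave $\varphi:[0,\eta)\to[0,\infty)$ with $\varphi(0)=0$, $\varphi\in C^1(0,\eta)$, $\varphi'>0$ on $(0,\eta)$, such that $\varphi'(h(x)-h(\bar x))\,\mathrm{dist}(0,\partial h(x))\ge1$ for all $x\in\mathcal N$ with $h(\bar x)<h(x)<h(\bar x)+\eta$. **Algorithm.** Fix $\varrho\in(0,1)$ and $\underline{\gamma_1},\underline{\gamma_2},\gamma_{1,0},\gamma_{2,0}>0$; start from any $\widehat P^0\in\mathbb O^{n\times r}$, $\overline P^0\in\mathbb O^{m\times r}$, $\overline Q^0=\overline D^0=I_r$, $(\overline U^0,\overline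 V^0)=(\widehat P^0,\overline P^0)$, $\overline X^0=\overline U^0(\overline V^0)^\top$. For $k=0,1,\dots$: 1. $U^{k+1}\in\arg\min_U\{\widehat\Phi(U,\overline V^k,\overline U^k,\overline V^k)+\frac{\gamma_{1,k}}2\|U-\overline U^k\|_F^2\}$; 2. take a thin SVD $U^{k+1}\overline D^k=\widehat P^{k+1}(\widehat D^{k+1})^2(\widehat Q^{k+1})^\top$ ($\widehat P^{k+1}\in\mathbb O^{n\times r}$, $\widehat Q^{k+1}\in\mathbb O^r$, $(\widehat D^{k+1})^2=\Sigma_r(U^{k+1}\overline D^k)$, $\widehat D^{k+1}\ge0$ diagonal) and set $\widehat U^{k+1}=\widehat P^{k+1}\widehat D^{k+1}$, $\widehat V^{k+1}=\overline P^k\widehat Q^{k+1}\widehat D^{k+1}$, $\widehat X^{k+1}=\widehat U^{k+1}(\widehat V^{k+1})^\top$; 3. $V^{k+1}\in\arg\min_V\{\widehat\Phi(\widehat U^{k+1},V,\widehat U^{k+1},\widehat V^{k+1})+\frac{\gamma_{2,k}}2\|V-\widehat V^{k+1}\|_F^2\}$; 4. take a thin SVD $V^{k+1}\widehat D^{k+1}=\overline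 P^{k+1}(\overline D^{k+1})^2(\overline Q^{k+1})^\top$ in the same sense ($\overline P^{k+1}\in\mathbb O^{m\times r}$, $\overline Q^{k+1}\in\mathbb O^r$) and set $\overline U^{k+1}=\widehat P^{k+1}\overline Q^{k+1}\overline D^{k+1}$, $\overline V^{k+1}=\overline P^{k+1}\overline D^{k+1}$, $\overline X^{k+1}=\overline U^{k+1}(\overline V^{k+1})^\top$; 5. $\gamma_{i,k+1}=\max(\underline{\gamma_i},\varrho\gamma_{i,k})$, $i=1,2$. **Assumptions.** (A1) For every $X\in\mathbb R^{n\times m}$ with $\mathrm{rank}(X)\le r$ and every $(P,Q)\in\mathbb O^{n,m}(X)$, with $P_1,Q_1$ the first $r$ columns of $P,Q$, $\vartheta(P_1\Sigma_r(X)^{1/2})+\vartheta(Q_1\Sigma_r(X)^{1/2})=\inf\{\vartheta(U)+\vartheta(V):U\in\mathbb R^{n\times r},\,V\in\mathbb R^{m\times r},\,X=UV^\top\}$. (A2) Let $\widehat\beta$ be a constant with $L_f(\overline D^k_{ii})^2+\mu+\gamma_{1,k}\le\widehat\beta$ and $L_f(\widehat D^{k+1}_{ii})^2+\mu+\gamma_{2,k}\le\widehat\beta$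 for all $k\ge0$, $i\le r$. For each $\gamma$ with $\lambda/\widehat\beta\le\gamma\le\lambda/(\mu+\min(\underline{\gamma_1},\underline{\gamma_2}))$ there is $c_p>0$ such that for all $t\ge0$ every nonzero element of $\arg\min_{x\in\mathbb R}\{\frac1{2\gamma}(t-x)^2+\theta(x)\}$ is at least $c_p$. (A3) $\theta'$ is strictly continuous (locally Lipschitz) on $(0,\infty)$. **Statement.** Assume (A1)–(A3), and let $(\widehat U^*,\widehat V^*,\overline U^*,\overline V^*,\widehat X^*,\overline X^*)$ be an accumulation point of the sequence $(\widehat U^k,\widehat V^k,\overline U^k,\overline V^k,\widehat X^k,\overline X^k)$ such that $\overline X^*$ has rank $\bar r\ge1$ and pairwise distinct nonzero singular values. Let $\delta=\frac12\min_{1\le i<j\le\bar r+1}[\sigma_i(\overline X^*)-\sigma_j(\overline X^*)]$. (i) Let $X,X'\in\mathbb R^{n\times m}$ have rank $\bar r$ and satisfy $\|X-\overline X^*\|_F\le\delta$, $\|X'-\overline X^*\|_F\le\delta$, and let $(U,V)\in\mathbb O^{n,m}(X)$, $(U',V')\in\mathbb O^{n,m}(X')$. Then for each $i\in\{1,\dots,\bar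 r\}$ there is a sign $\varepsilon_i\in\{1,-1\}$ with $$\max\big(\|U_i-\varepsilon_iU'_i\|,\ \|V_i-\varepsilon_iV'_i\|\big)\le\tfrac2\delta\|X-X'\|_F.$$ (ii) If moreover $\Phi$ has the KL property at $(\overline U^*,\overline V^*)$, then there are $c_s>0$ and $\bar k\in\mathbb N$ such that for all $k\ge\bar k$: $\|\overline X^k-\overline X^*\|_F<\delta$, $\mathrm{rank}(\overline X^k)=\bar r$, and $$\mathrm{dist}\big(0,\partial\Phi(\overline U^{k+1},\overline V^{k+1})\big)\le c_s\big(\|\overline X^{k+1}-\overline X^k\|_F+\|\widehat X^{k+1}-\overline X^k\|_F\big)+c_s\big(\|U^{k+1}-\overline U^k\|_F+\|V^{k+1}-\widehat V^{k+1}\|_F\big).$$ -/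

import Mathlib

open Matrix Filter Topology Set
open scoped ENNReal NNReal

/- Matrices carry the Frobenius norm. -/
attribute [local instance] Matrix.frobeniusNormedAddCommGroup Matrix.frobeniusNormedSpace

namespace PAMA

noncomputable section

/-! ### Subdifferentials and the Kurdyka-Lojasiewicz property -/

section Variational

variable {E : Type*} [NormedAddCommGroup E] [InnerProductSpace ℝ E]

/-- The regular (Fréchet) subdifferential of `h` at `x` (empty where `h x` is infinite). The
inequality `liminf (h x' - h x - ⟪v, x' - x⟫) / ‖x' - x‖ ≥ 0` is written in its `ε`-form. -/
def regularSubdifferential (h : E → EReal) (x : E) : Set E :=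
  {v | h x ≠ ⊤ ∧ h x ≠ ⊥ ∧ ∀ ε : ℝ, 0 < ε → ∀ᶠ x' in 𝓝 x,
    h x + ((inner ℝ v (x' - x) - ε * ‖x' - x‖ : ℝ) : EReal) ≤ h x'}

/-- The basic (limiting, Mordukhovich) subdifferential of `h` at `x`. -/
def subdifferential (h : E → EReal) (x : E) : Set E :=
  {v | h x ≠ ⊤ ∧ h x ≠ ⊥ ∧ ∃ (xs vs : ℕ → E),
    Tendsto xs atTop (𝓝 x) ∧ Tendsto (fun k => h (xs k)) atTop (𝓝 (h x)) ∧
    Tendsto vs atTop (𝓝 v) ∧ ∀ k, vs k ∈ regularSubdifferential h (xs k)}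

/-- The KL property of `h` at a point `xbar` of `dom ∂h`. The distance to the (possibly empty)
set `∂h(x)` is taken in `[0, ∞]`. -/
def HasKLProperty (h : E → EReal) (xbar : E) : Prop :=
  (subdifferential h xbar).Nonempty ∧
  ∃ (η : EReal) (φ : ℝ → ℝ) (N : Set E),
    0 < η ∧ N ∈ 𝓝 xbar ∧
    ContinuousOn φ {s : ℝ | 0 ≤ s ∧ (s : EReal) < η} ∧
    ConcaveOn ℝ {s : ℝ | 0 ≤ s ∧ (s : EReal) < η} φ ∧
    (∀ s : ℝ, 0 ≤ s → (s : EReal) < η → 0 ≤ φ s) ∧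
    φ 0 = 0 ∧
    ContDiffOn ℝ 1 φ {s : ℝ | 0 < s ∧ (s : EReal) < η} ∧
    (∀ s : ℝ, 0 < s → (s : EReal) < η → 0 < deriv φ s) ∧
    ∀ x ∈ N, h xbar < h x → h x < h xbar + η →
      1 ≤ ENNReal.ofReal (deriv φ ((h x - h xbar).toReal)) *
        Metric.infEDist 0 (subdifferential h x)

end Variational

/-! ### Matrices -/

/-- The Euclidean norm of the `i`-th column of `W`. -/
def colNorm {l r : ℕ} (W : Matrix (Fin l) (Fin r) ℝ) (i : Fin r) : ℝ :=
  ‖WithLp.toLp 2 (fun a => W a i)‖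

/-- The singular values of `X` in nonincreasing order, indexed from `0` and continued by zeros. -/
def sigma {n m : ℕ} (X : Matrix (Fin n) (Fin m) ℝ) (i : ℕ) : ℝ :=
  (Matrix.toEuclideanLin X).singularValues i

/-- `Diag(σ₁(X)^{1/2}, …, σ_κ(X)^{1/2})`. -/
def sqrtSigma {n m : ℕ} (κ : ℕ) (X : Matrix (Fin n) (Fin m) ℝ) : Matrix (Fin κ) (Fin κ) ℝ :=
  Matrix.diagonal fun i => √(sigma X i)

/-- The matrix `P` has orthonormal columns. -/
def OrthonormalCols {l r : ℕ} (P : Matrix (Fin l) (Fin r) ℝ) : Prop := Pᵀ * P = 1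

/-- The set of pairs `(U, V)` of orthogonal matrices with `X = U [Diag(σ(X)) 0] Vᵀ`. -/
def svdPairs {n m : ℕ} (X : Matrix (Fin n) (Fin m) ℝ) :
    Set (Matrix (Fin n) (Fin n) ℝ × Matrix (Fin m) (Fin m) ℝ) :=
  {p | p.1 ∈ Matrix.orthogonalGroup (Fin n) ℝ ∧ p.2 ∈ Matrix.orthogonalGroup (Fin m) ℝ ∧
    X = p.1 * (Matrix.of fun (i : Fin n) (j : Fin m) => if (i : ℕ) = j then sigma X i else 0) *
      p.2ᵀ}

/-- The gradient of `f` at `X` for the trace inner product. -/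
def matGrad {n m : ℕ} (f : Matrix (Fin n) (Fin m) ℝ → ℝ) (X : Matrix (Fin n) (Fin m) ℝ) :
    Matrix (Fin n) (Fin m) ℝ :=
  Matrix.of fun i j => fderiv ℝ f X (Matrix.single i j 1)

/-! ### The model -/

/-- Conditions on the sparsity-promoting function `θ : ℝ → (-∞, ∞]`. -/
structure IsPenalty (θ : ℝ → EReal) : Prop where
  lsc : LowerSemicontinuous θ
  zero : θ 0 = 0
  pos : ∀ t, 0 < t → 0 < θ t
  top_of_neg : ∀ t, t < 0 → θ t = ⊤
  finite : ∀ t, 0 < t → θ t ≠ ⊤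
  differentiable : ∀ t, 0 < t → DifferentiableAt ℝ (fun s => (θ s).toReal) t

/-- `θ'`, to be used on the positive half-line. -/
def penaltyDeriv (θ : ℝ → EReal) : ℝ → ℝ := deriv fun s => (θ s).toReal

/-- `ϑ(W) = ∑ θ(‖W_i‖)`. -/
def colPenalty (θ : ℝ → EReal) {l r : ℕ} (W : Matrix (Fin l) (Fin r) ℝ) : EReal :=
  ∑ i, θ (colNorm W i)

/-- The proximal mapping of `h : ℝ → (-∞, ∞]` with parameter `γ`. -/
def prox (γ : ℝ) (h : ℝ → EReal) (z : ℝ) : Set ℝ :=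
  {x | ∀ y, ((1 / (2 * γ) * (z - x) ^ 2 : ℝ) : EReal) + h x ≤
    ((1 / (2 * γ) * (z - y) ^ 2 : ℝ) : EReal) + h y}

/-- The objective function `Φ_{λ,μ}`. -/
def objective {n m r : ℕ} (f : Matrix (Fin n) (Fin m) ℝ → ℝ) (θ : ℝ → EReal) (lam mu : ℝ)
    (U : Matrix (Fin n) (Fin r) ℝ) (V : Matrix (Fin m) (Fin r) ℝ) : EReal :=
  ((f (U * Vᵀ) : ℝ) : EReal) + (lam : EReal) * (colPenalty θ U + colPenalty θ V) +
    ((mu / 2 * (‖U‖ ^ 2 + ‖V‖ ^ 2) : ℝ) : EReal)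

/-- The quadratic majorization `F̂(U, V, U', V')` of `f (U Vᵀ)`. -/
def majorF {n m r : ℕ} (f : Matrix (Fin n) (Fin m) ℝ → ℝ) (Lf : ℝ)
    (U : Matrix (Fin n) (Fin r) ℝ) (V : Matrix (Fin m) (Fin r) ℝ)
    (U' : Matrix (Fin n) (Fin r) ℝ) (V' : Matrix (Fin m) (Fin r) ℝ) : ℝ :=
  f (U' * V'ᵀ) + ((matGrad f (U' * V'ᵀ))ᵀ * (U * Vᵀ - U' * V'ᵀ)).trace +
    Lf / 2 * ‖U * Vᵀ - U' * V'ᵀ‖ ^ 2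

/-- The majorization `Φ̂_{λ,μ}(U, V, U', V')` of the objective. -/
def majorObjective {n m r : ℕ} (f : Matrix (Fin n) (Fin m) ℝ → ℝ) (θ : ℝ → EReal)
    (Lf lam mu : ℝ) (U : Matrix (Fin n) (Fin r) ℝ) (V : Matrix (Fin m) (Fin r) ℝ)
    (U' : Matrix (Fin n) (Fin r) ℝ) (V' : Matrix (Fin m) (Fin r) ℝ) : EReal :=
  ((majorF f Lf U V U' V' : ℝ) : EReal) + (lam : EReal) * (colPenalty θ U + colPenalty θ V) +
    ((mu / 2 * (‖U‖ ^ 2 + ‖V‖ ^ 2) : ℝ) : EReal)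

/-- The space of factor pairs `(U, V)`, as the Euclidean space of stacked matrices; its norm is
`(‖U‖_F² + ‖V‖_F²)^{1/2}`. -/
abbrev FactorSpace (n m r : ℕ) : Type := EuclideanSpace ℝ ((Fin n ⊕ Fin m) × Fin r)

/-- The factor pair `(U, V)` as a point of `FactorSpace`. -/
def stack {n m r : ℕ} (U : Matrix (Fin n) (Fin r) ℝ) (V : Matrix (Fin m) (Fin r) ℝ) :
    FactorSpace n m r :=
  WithLp.toLp 2 fun p => Sum.elim (fun a => U a p.2) (fun b => V b p.2) p.1

/-- The objective as a function on the space of factor pairs. -/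
def objectiveOn {n m r : ℕ} (f : Matrix (Fin n) (Fin m) ℝ → ℝ) (θ : ℝ → EReal) (lam mu : ℝ)
    (x : FactorSpace n m r) : EReal :=
  objective f θ lam mu (Matrix.of fun a i => x (Sum.inl a, i))
    (Matrix.of fun b i => x (Sum.inr b, i))

theorem objectiveOn_stack {n m r : ℕ} (f : Matrix (Fin n) (Fin m) ℝ → ℝ) (θ : ℝ → EReal)
    (lam mu : ℝ) (U : Matrix (Fin n) (Fin r) ℝ) (V : Matrix (Fin m) (Fin r) ℝ) :
    objectiveOn f θ lam mu (stack U V) = objective f θ lam mu U V := rfl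

/-! ### The algorithm -/

/-- The quantities generated by the majorized proximal alternating minimization algorithm with
subspace correction. A suffix `h` stands for a hat and a suffix `b` for a bar. The entries with
index `0` of `U, V, Uh, Vh, Xh, Qh, Dh` are not used by the algorithm. -/
structure Sequences (n m r : ℕ) where
  (U Uh Ub : ℕ → Matrix (Fin n) (Fin r) ℝ)
  (V Vh Vb : ℕ → Matrix (Fin m) (Fin r) ℝ)
  (Xh Xb : ℕ → Matrix (Fin n) (Fin m) ℝ)
  (Ph : ℕ → Matrix (Fin n) (Fin r) ℝ)
  (Pb : ℕ → Matrix (Fin m) (Fin r) ℝ)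
  (Qh Qb Dh Db : ℕ → Matrix (Fin r) (Fin r) ℝ)
  (gam1 gam2 : ℕ → ℝ)

/-- `s` is a run of the majorized proximal alternating minimization algorithm with subspace
correction with parameters `rho`, `lgam1`, `lgam2` (the lower bounds of the proximal parameters). -/
structure IsRun {n m r : ℕ} (f : Matrix (Fin n) (Fin m) ℝ → ℝ) (θ : ℝ → EReal)
    (Lf lam mu rho lgam1 lgam2 : ℝ) (s : Sequences n m r) : Prop where
  -- initialization
  gam1_zero : 0 < s.gam1 0
  gam2_zero : 0 < s.gam2 0
  Pb_zero : OrthonormalCols (s.Pb 0)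
  Ph_zero : OrthonormalCols (s.Ph 0)
  Qb_zero : s.Qb 0 = 1
  Db_zero : s.Db 0 = 1
  Ub_zero : s.Ub 0 = s.Ph 0
  Vb_zero : s.Vb 0 = s.Pb 0
  Xb_zero : s.Xb 0 = s.Ub 0 * (s.Vb 0)ᵀ
  -- step 1
  U_min : ∀ k, ∀ W : Matrix (Fin n) (Fin r) ℝ,
    majorObjective f θ Lf lam mu (s.U (k + 1)) (s.Vb k) (s.Ub k) (s.Vb k) +
        ((s.gam1 k / 2 * ‖s.U (k + 1) - s.Ub k‖ ^ 2 : ℝ) : EReal) ≤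
      majorObjective f θ Lf lam mu W (s.Vb k) (s.Ub k) (s.Vb k) +
        ((s.gam1 k / 2 * ‖W - s.Ub k‖ ^ 2 : ℝ) : EReal)
  -- step 2: thin SVD of `U^{k+1} D̄^k`
  Ph_orth : ∀ k, OrthonormalCols (s.Ph (k + 1))
  Qh_orth : ∀ k, OrthonormalCols (s.Qh (k + 1))
  Dh_eq : ∀ k, s.Dh (k + 1) = sqrtSigma r (s.U (k + 1) * s.Db k)
  svd_U : ∀ k, s.U (k + 1) * s.Db k = s.Ph (k + 1) * s.Dh (k + 1) ^ 2 * (s.Qh (k + 1))ᵀ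
  Uh_eq : ∀ k, s.Uh (k + 1) = s.Ph (k + 1) * s.Dh (k + 1)
  Vh_eq : ∀ k, s.Vh (k + 1) = s.Pb k * s.Qh (k + 1) * s.Dh (k + 1)
  Xh_eq : ∀ k, s.Xh (k + 1) = s.Uh (k + 1) * (s.Vh (k + 1))ᵀ
  -- step 3
  V_min : ∀ k, ∀ W : Matrix (Fin m) (Fin r) ℝ,
    majorObjective f θ Lf lam mu (s.Uh (k + 1)) (s.V (k + 1)) (s.Uh (k + 1)) (s.Vh (k + 1)) +
        ((s.gam2 k / 2 * ‖s.V (k + 1) - s.Vh (k + 1)‖ ^ 2 : ℝ) : EReal) ≤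
      majorObjective f θ Lf lam mu (s.Uh (k + 1)) W (s.Uh (k + 1)) (s.Vh (k + 1)) +
        ((s.gam2 k / 2 * ‖W - s.Vh (k + 1)‖ ^ 2 : ℝ) : EReal)
  -- step 4: thin SVD of `V^{k+1} D̂^{k+1}`
  Pb_orth : ∀ k, OrthonormalCols (s.Pb (k + 1))
  Qb_orth : ∀ k, OrthonormalCols (s.Qb (k + 1))
  Db_eq : ∀ k, s.Db (k + 1) = sqrtSigma r (s.V (k + 1) * s.Dh (k + 1))
  svd_V : ∀ k, s.V (k + 1) * s.Dh (k + 1) = s.Pb (k + 1) * s.Db (k + 1) ^ 2 * (s.Qb (k + 1))ᵀ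
  Ub_eq : ∀ k, s.Ub (k + 1) = s.Ph (k + 1) * s.Qb (k + 1) * s.Db (k + 1)
  Vb_eq : ∀ k, s.Vb (k + 1) = s.Pb (k + 1) * s.Db (k + 1)
  Xb_eq : ∀ k, s.Xb (k + 1) = s.Ub (k + 1) * (s.Vb (k + 1))ᵀ
  -- step 5
  gam1_succ : ∀ k, s.gam1 (k + 1) = max lgam1 (rho * s.gam1 k)
  gam2_succ : ∀ k, s.gam2 (k + 1) = max lgam2 (rho * s.gam2 k)

/-! ### Assumptions of the convergence analysis -/

/-- Balanced singular value factorizations with `κ` columns minimize `ϑ(U) + ϑ(V)` among all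
factorizations `X = U Vᵀ` with `κ` columns. -/
def FactorizationOptimal (n m κ : ℕ) (hn : κ ≤ n) (hm : κ ≤ m) (θ : ℝ → EReal) : Prop :=
  ∀ X : Matrix (Fin n) (Fin m) ℝ, X.rank ≤ κ → ∀ P Q, (P, Q) ∈ svdPairs X →
    colPenalty θ (P.submatrix id (Fin.castLE hn) * sqrtSigma κ X) +
        colPenalty θ (Q.submatrix id (Fin.castLE hm) * sqrtSigma κ X) =
      sInf {v | ∃ (U : Matrix (Fin n) (Fin κ) ℝ) (V : Matrix (Fin m) (Fin κ) ℝ),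
        X = U * Vᵀ ∧ v = colPenalty θ U + colPenalty θ V}

/-- `β` bounds the squares of the diagonal entries of the scaling matrices
`Λ^k = [L_f (D̄^k)² + (μ + γ_{1,k}) I]^{1/2}` and
`Δ^{k+1} = [L_f (D̂^{k+1})² + (μ + γ_{2,k}) I]^{1/2}` along the run `s`. -/
def IsScalingBound {n m r : ℕ} (Lf mu : ℝ) (s : Sequences n m r) (β : ℝ) : Prop :=
  ∀ (k : ℕ) (i : Fin r),
    Lf * (s.Db k i i) ^ 2 + (mu + s.gam1 k) ≤ β ∧
    Lf * (s.Dh (k + 1) i i) ^ 2 + (mu + s.gam2 k) ≤ β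

/-- For each `γ ∈ [a, b]`, the nonzero elements of `prox_γ θ (t)`, `t ≥ 0`, are bounded away from
`0`. -/
def ProxGap (θ : ℝ → EReal) (a b : ℝ) : Prop :=
  ∀ γ, a ≤ γ → γ ≤ b → ∃ c : ℝ, 0 < c ∧ ∀ t, 0 ≤ t → ∀ x ∈ prox γ θ t, x = 0 ∨ c ≤ x

end

end PAMA

/-! Part (i) is a perturbation theorem for singular vectors. By Mirsky's inequality the
displacements of any two singular values, for a matrix within δ of the centre, have squares summing
to at most δ². A gap 2δ at the centre therefore stays above (2 − √2)δ throughout the ball. For SVDs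
of two nearby matrices X and X', the entries of the overlap matrices UᵀU' and VᵀV' solve 2×2 linear
systems whose right-hand sides are entries of Uᵀ(X' − X)V' and U'ᵀ(X' − X)V. The gap makes these
systems well conditioned, so the off-diagonal mass of column i is small and its diagonal entry is
close to ±1, with the same sign on both sides (`svd_perturbation_local`). The local estimate has
just enough slack to give the constant 2/δ. Cutting the segment from X to X' into many short pieces
adds the local bounds up without loss (`svd_perturbation`).

For part (ii), the bar and hat factor pairs are balanced: they are SVD factors scaled by square
roots of singular values. The SVD steps leave the products U^{k+1}(V̄^k)ᵀ and Û^{k+1}(V^{k+1})ᵀ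
unchanged and do not increase Φ, by (A1) for ϑ and by the variational property of the nuclear norm
for the quadratic term. With the descent lemma this gives sufficient decrease
(`IsRun.exists_decrease`), hence bounded iterates and vanishing steps.

Balanced factors have diagonal Gram matrices, so each subproblem splits into columns, and the norm
of a nonzero minimizing column lies in a proximal image of θ. Assumption (A2) then keeps nonzero
columns away from zero. Ranks are nonincreasing, hence eventually constant, and from then on the
leading columns are bounded below while the others vanish (`IsRun.exists_tailBounds`).

An explicit subgradient of Φ has columns that vanish where both factors have zero columns. On the
remaining columns it is compared with the optimality condition of the corresponding half step, after
matching signs by part (i). This yields the relative error bound as long as the product iterates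
stay in the δ-ball (`IsRun.exists_relative_error`).

It remains to trap the product iterates near the limit point. The usual KL finite-length argument
does this with one twist: the factors may flip column signs and so need not stay near (Ū*, V̄*). The
objective and the norms of the subgradient blocks are invariant under common sign changes, so the KL
inequality can be applied at a sign-corrected copy of each iterate, which does lie near (Ū*, V̄*)
(`IsRun.eventually_Xb_mem_closedBall`). -/

namespace PAMA

noncomputable section

/-! ### The trace inner product -/

section Frobenius

variable {ι κ l : Type*} [Fintype ι] [Fintype κ] [Fintype l]

/-- The trace inner product. -/
def frob (A B : Matrix ι κ ℝ) : ℝ := (Aᵀ * B).trace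

theorem frob_eq_sum (A B : Matrix ι κ ℝ) : frob A B = ∑ i, ∑ j, A i j * B i j := by
  simp only [frob, Matrix.trace, Matrix.diag, Matrix.mul_apply, Matrix.transpose_apply]
  exact Finset.sum_comm

theorem norm_sq_eq_sum (A : Matrix ι κ ℝ) : ‖A‖ ^ 2 = ∑ i, ∑ j, A i j ^ 2 := by
  rw [Matrix.frobenius_norm_def, ← Real.sqrt_eq_rpow, Real.sq_sqrt (by positivity)]
  simp

theorem frob_self (A : Matrix ι κ ℝ) : frob A A = ‖A‖ ^ 2 := by
  rw [frob_eq_sum, norm_sq_eq_sum]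
  simp only [sq]

theorem frob_comm (A B : Matrix ι κ ℝ) : frob A B = frob B A := by
  simp only [frob_eq_sum, mul_comm]

theorem frob_add_right (A B C : Matrix ι κ ℝ) : frob A (B + C) = frob A B + frob A C := by
  simp [frob, Matrix.mul_add]

theorem frob_sub_right (A B C : Matrix ι κ ℝ) : frob A (B - C) = frob A B - frob A C := by
  simp [frob, Matrix.mul_sub]

theorem frob_add_left (A B C : Matrix ι κ ℝ) : frob (A + B) C = frob A C + frob B C := by
  simp [frob, Matrix.add_mul]

theorem frob_sub_left (A B C : Matrix ι κ ℝ) : frob (A - B) C = frob A C - frob B C := by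
  simp [frob, Matrix.sub_mul]

theorem frob_smul_right (c : ℝ) (A B : Matrix ι κ ℝ) : frob A (c • B) = c * frob A B := by
  simp [frob]

theorem frob_transpose (A B : Matrix ι κ ℝ) : frob Aᵀ Bᵀ = frob A B := by
  simp only [frob_eq_sum, Matrix.transpose_apply]
  exact Finset.sum_comm

theorem frob_mul_left (M : Matrix l ι ℝ) (A : Matrix ι κ ℝ) (B : Matrix l κ ℝ) :
    frob (M * A) B = frob A (Mᵀ * B) := by
  simp [frob, Matrix.mul_assoc]

theorem frob_mul_right (A : Matrix ι l ℝ) (M : Matrix l κ ℝ) (B : Matrix ι κ ℝ) :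
    frob (A * M) B = frob A (B * Mᵀ) := by
  rw [← frob_transpose, Matrix.transpose_mul, frob_mul_left, ← frob_transpose,
    Matrix.transpose_mul]
  simp

theorem norm_add_sq_frob (A B : Matrix ι κ ℝ) :
    ‖A + B‖ ^ 2 = ‖A‖ ^ 2 + 2 * frob A B + ‖B‖ ^ 2 := by
  simp only [← frob_self, frob_add_left, frob_add_right, frob_comm B A]
  ring

theorem norm_sub_sq_frob (A B : Matrix ι κ ℝ) :
    ‖A - B‖ ^ 2 = ‖A‖ ^ 2 - 2 * frob A B + ‖B‖ ^ 2 := by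
  simp only [← frob_self, frob_sub_left, frob_sub_right, frob_comm B A]
  ring

theorem abs_frob_le (A B : Matrix ι κ ℝ) : |frob A B| ≤ ‖A‖ * ‖B‖ := by
  apply abs_le_of_sq_le_sq _ (by positivity)
  rw [mul_pow, norm_sq_eq_sum, norm_sq_eq_sum, frob_eq_sum]
  simp only [← Finset.sum_product', Finset.univ_product_univ]
  exact Finset.sum_mul_sq_le_sq_mul_sq _ _ _

theorem norm_mul_le_frob (A : Matrix ι l ℝ) (B : Matrix l κ ℝ) : ‖A * B‖ ≤ ‖A‖ * ‖B‖ :=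
  Matrix.frobenius_nnnorm_mul A B

theorem norm_transpose_frob (A : Matrix ι κ ℝ) : ‖Aᵀ‖ = ‖A‖ :=
  Matrix.frobenius_norm_transpose A

theorem norm_mul_left_of_orthonormal [DecidableEq ι] {M : Matrix l ι ℝ} (hM : Mᵀ * M = 1)
    (A : Matrix ι κ ℝ) : ‖M * A‖ = ‖A‖ := by
  rw [← sq_eq_sq₀ (norm_nonneg _) (norm_nonneg _), ← frob_self, frob_mul_left,
    ← Matrix.mul_assoc, hM, Matrix.one_mul, frob_self]

theorem norm_mul_right_of_orthonormal [DecidableEq κ] {M : Matrix l κ ℝ} (hM : Mᵀ * M = 1)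
    (A : Matrix ι κ ℝ) : ‖A * Mᵀ‖ = ‖A‖ := by
  rw [← norm_transpose_frob, Matrix.transpose_mul, Matrix.transpose_transpose,
    norm_mul_left_of_orthonormal hM, norm_transpose_frob]

end Frobenius

/-! ### Rearrangement and Mirsky's inequality -/

/-- By Birkhoff's theorem A is a convex combination of permutation matrices, and for one permutation
the bound is the rearrangement inequality. -/
theorem sum_doublyStochastic_le {N : ℕ} {A : Matrix (Fin N) (Fin N) ℝ}
    (hA : A ∈ doublyStochastic ℝ (Fin N)) {d e : Fin N → ℝ} (hd : Antitone d) (he : Antitone e) :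
    ∑ i, ∑ j, d i * e j * A i j ≤ ∑ i, d i * e i := by
  obtain ⟨w, hw0, hw1, rfl⟩ := exists_eq_sum_perm_of_mem_doublyStochastic hA
  have key : ∀ σ : Equiv.Perm (Fin N),
      ∑ i, ∑ j, d i * e j * (σ.permMatrix ℝ) i j ≤ ∑ i, d i * e i := by
    intro σ
    have : ∀ i, ∑ j, d i * e j * (σ.permMatrix ℝ) i j = d i * e (σ i) := by
      intro i
      simp [Equiv.Perm.permMatrix, PEquiv.toMatrix_apply, Equiv.toPEquiv_apply]
    simp only [this]
    have hm : Monovary d e := by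
      intro i j hij
      rcases le_total i j with h | h
      · exact absurd (he h) (not_le.2 hij)
      · exact hd h
    exact hm.sum_mul_comp_perm_le_sum_mul
  calc ∑ i, ∑ j, d i * e j * (∑ σ, w σ • σ.permMatrix ℝ) i j
      = ∑ σ, w σ * ∑ i, ∑ j, d i * e j * (σ.permMatrix ℝ) i j := by
        simp only [Matrix.sum_apply, Matrix.smul_apply, smul_eq_mul, Finset.mul_sum]
        rw [Finset.sum_comm' (t' := Finset.univ) (s' := fun _ => Finset.univ) (by simp)]
        conv_rhs => rw [Finset.sum_comm]
        rw [Finset.sum_comm]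
        refine Finset.sum_congr rfl fun i _ => ?_
        rw [Finset.sum_comm]
        refine Finset.sum_congr rfl fun σ _ => ?_
        refine Finset.sum_congr rfl fun j _ => ?_
        ring
    _ ≤ ∑ σ, w σ * ∑ i, d i * e i :=
        Finset.sum_le_sum fun σ _ => mul_le_mul_of_nonneg_left (key σ) (hw0 σ)
    _ = ∑ i, d i * e i := by rw [← Finset.sum_mul, hw1, one_mul]

theorem sq_mem_doublyStochastic {N : ℕ} {M : Matrix (Fin N) (Fin N) ℝ}
    (h1 : Mᵀ * M = 1) : (Matrix.of fun i j => M i j ^ 2) ∈ doublyStochastic ℝ (Fin N) := by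
  have h2 : M * Mᵀ = 1 := mul_eq_one_comm.1 h1
  rw [mem_doublyStochastic_iff_sum]
  refine ⟨fun i j => by simp [sq_nonneg], fun i => ?_, fun j => ?_⟩
  · have := congrFun (congrFun h2 i) i
    simpa [Matrix.mul_apply, sq] using this
  · have := congrFun (congrFun h1 j) j
    simpa [Matrix.mul_apply, sq] using this

/-- The rectangular diagonal matrix with diagonal `d`. -/
def rect (n m : ℕ) (d : ℕ → ℝ) : Matrix (Fin n) (Fin m) ℝ :=
  Matrix.of fun i j => if (i : ℕ) = j then d i else 0

theorem rect_apply (n m : ℕ) (d : ℕ → ℝ) (i : Fin n) (j : Fin m) :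
    rect n m d i j = if (i : ℕ) = j then d i else 0 := rfl

theorem rect_transpose (n m : ℕ) (d : ℕ → ℝ) : (rect n m d)ᵀ = rect m n d := by
  ext i j
  simp only [Matrix.transpose_apply, rect_apply]
  by_cases h : (i : ℕ) = j
  · simp [h]
  · simp [h, Ne.symm h]

theorem rect_mul_apply {n m l : ℕ} (hnm : n ≤ m) (d : ℕ → ℝ) (A : Matrix (Fin m) (Fin l) ℝ)
    (i : Fin n) (j : Fin l) : (rect n m d * A) i j = d i * A (Fin.castLE hnm i) j := by
  rw [Matrix.mul_apply, Finset.sum_eq_single (Fin.castLE hnm i)]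
  · simp [rect_apply]
  · intro b _ hb
    rw [rect_apply, if_neg, zero_mul]
    intro h
    exact hb (Fin.ext h.symm)
  · simp

theorem mul_rect_apply {n m l : ℕ} (hnm : n ≤ m) (d : ℕ → ℝ) (A : Matrix (Fin l) (Fin n) ℝ)
    (i : Fin l) (j : Fin n) : (A * rect n m d) i (Fin.castLE hnm j) = d j * A i j := by
  rw [Matrix.mul_apply, Finset.sum_eq_single j]
  · simp [rect_apply, mul_comm]
  · intro b _ hb
    rw [rect_apply, if_neg, mul_zero]
    intro h
    exact hb (Fin.ext h)
  · simp

theorem mul_rect_apply_of_ge {n m l : ℕ} (hnm : n ≤ m) (d : ℕ → ℝ) (A : Matrix (Fin l) (Fin m) ℝ)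
    (i : Fin l) (j : Fin n) : (A * rect m n d) i j = d j * A i (Fin.castLE hnm j) := by
  rw [← rect_transpose, ← Matrix.transpose_apply (A * _), Matrix.transpose_mul,
    Matrix.transpose_transpose, rect_mul_apply hnm, Matrix.transpose_apply]

theorem mul_rect_apply_of_le {n m l : ℕ} (d : ℕ → ℝ) (A : Matrix (Fin l) (Fin n) ℝ)
    (i : Fin l) (j : Fin m) (hj : n ≤ j) : (A * rect n m d) i j = 0 := by
  rw [Matrix.mul_apply]
  refine Finset.sum_eq_zero fun b _ => ?_
  rw [rect_apply, if_neg, mul_zero]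
  have := b.2
  omega

theorem norm_rect_sq {n m : ℕ} (hnm : n ≤ m) (d : ℕ → ℝ) :
    ‖rect n m d‖ ^ 2 = ∑ i : Fin n, d i ^ 2 := by
  rw [norm_sq_eq_sum]
  refine Finset.sum_congr rfl fun i _ => ?_
  rw [Finset.sum_eq_single (Fin.castLE hnm i)]
  · simp [rect_apply]
  · intro b _ hb
    rw [rect_apply, if_neg (fun h => hb (Fin.ext h.symm))]
    simp
  · simp

theorem sum_castLE_le_sum {n m : ℕ} (hnm : n ≤ m) (g : Fin m → ℝ) (hg : ∀ j, 0 ≤ g j) :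
    ∑ i : Fin n, g (Fin.castLE hnm i) ≤ ∑ j, g j := by
  have : ∑ i : Fin n, g (Fin.castLE hnm i) =
      ∑ j ∈ Finset.univ.map (Fin.castLEEmb hnm), g j := by simp
  rw [this]
  exact Finset.sum_le_sum_of_subset_of_nonneg (Finset.subset_univ _) fun j _ _ => hg j

/-- The function `d` on `i < n`, continued by zero. -/
def cut (n : ℕ) (d : ℕ → ℝ) (i : ℕ) : ℝ := if i < n then d i else 0

theorem cut_antitone {n : ℕ} {d : ℕ → ℝ} (hd : Antitone d) (h0 : ∀ i, 0 ≤ d i) :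
    Antitone (cut n d) := by
  intro i j hij
  unfold cut
  split_ifs with h1 h2
  · exact hd hij
  · omega
  · exact h0 i
  · exact le_rfl

theorem sum_fin_cut {n m : ℕ} (hnm : n ≤ m) (g : ℕ → ℝ) (hg : ∀ i, n ≤ i → g i = 0) :
    ∑ j : Fin m, g j = ∑ i : Fin n, g i := by
  rw [Fin.sum_univ_eq_sum_range, Fin.sum_univ_eq_sum_range]
  refine (Finset.sum_subset (Finset.range_mono hnm) ?_).symm
  intro i _ hi
  exact hg i (by simpa using hi)

/-- The n×n corner of the squared entries is only doubly substochastic. Continuing d and e by zeros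
and keeping the full m×m matrix reduces to the doubly stochastic case. -/
theorem sum_rect_le {n m : ℕ} (hnm : n ≤ m) {d e : ℕ → ℝ} (hd : Antitone d) (he : Antitone e)
    (hd0 : ∀ i, 0 ≤ d i) (he0 : ∀ i, 0 ≤ e i) {N : Matrix (Fin m) (Fin m) ℝ} (hN : Nᵀ * N = 1) :
    ∑ i : Fin n, ∑ j : Fin n, d i * e j * N (Fin.castLE hnm i) (Fin.castLE hnm j) ^ 2 ≤
      ∑ i : Fin n, d i * e i := by
  have h := sum_doublyStochastic_le (sq_mem_doublyStochastic hN)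
    (d := fun i => cut n d i) (e := fun i => cut n e i)
    (fun i j hij => cut_antitone hd hd0 hij) (fun i j hij => cut_antitone he he0 hij)
  have e1 : ∑ i : Fin m, cut n d i * cut n e i = ∑ i : Fin n, d i * e i := by
    rw [sum_fin_cut hnm (fun i => cut n d i * cut n e i)]
    · simp [cut]
    · intro i hi
      simp [cut, not_lt.2 hi]
  rw [e1] at h
  simp only [Matrix.of_apply] at h
  have hd' : ∀ i, 0 ≤ cut n d i := fun i => by unfold cut; split_ifs; exacts [hd0 _, le_rfl]
  have he' : ∀ i, 0 ≤ cut n e i := fun i => by unfold cut; split_ifs; exacts [he0 _, le_rfl]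
  have hnn : ∀ i j : Fin m, 0 ≤ cut n d i * cut n e j * N i j ^ 2 := fun i j =>
    mul_nonneg (mul_nonneg (hd' i) (he' j)) (sq_nonneg _)
  have s1 := sum_castLE_le_sum hnm (fun i => ∑ j : Fin m, cut n d i * cut n e j * N i j ^ 2)
    fun i => Finset.sum_nonneg fun j _ => hnn i j
  refine le_trans (Finset.sum_le_sum fun i _ => ?_) (s1.trans h)
  have s2 := sum_castLE_le_sum hnm
    (fun j => cut n d i * cut n e j * N (Fin.castLE hnm i) j ^ 2) fun j => hnn (Fin.castLE hnm i) j
  refine le_trans (le_of_eq ?_) s2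
  exact Finset.sum_congr rfl fun j _ => by simp [cut]

/-- Mirsky's inequality for the Frobenius norm. -/
theorem mirsky {n m : ℕ} (hnm : n ≤ m) {d e : ℕ → ℝ} (hd : Antitone d) (he : Antitone e)
    (hd0 : ∀ i, 0 ≤ d i) (he0 : ∀ i, 0 ≤ e i)
    {U U' : Matrix (Fin n) (Fin n) ℝ} {V V' : Matrix (Fin m) (Fin m) ℝ}
    (hU : Uᵀ * U = 1) (hU' : U'ᵀ * U' = 1) (hV : Vᵀ * V = 1) (hV' : V'ᵀ * V' = 1) :
    ∑ i : Fin n, (d i - e i) ^ 2 ≤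
      ‖U * rect n m d * Vᵀ - U' * rect n m e * V'ᵀ‖ ^ 2 := by
  have hM : (Uᵀ * U')ᵀ * (Uᵀ * U') = 1 := by
    rw [Matrix.transpose_mul, Matrix.transpose_transpose, Matrix.mul_assoc, ← Matrix.mul_assoc U,
      mul_eq_one_comm.1 hU, Matrix.one_mul, hU']
  have hN : (Vᵀ * V')ᵀ * (Vᵀ * V') = 1 := by
    rw [Matrix.transpose_mul, Matrix.transpose_transpose, Matrix.mul_assoc, ← Matrix.mul_assoc V,
      mul_eq_one_comm.1 hV, Matrix.one_mul, hV']
  rw [norm_sub_sq_frob, norm_mul_right_of_orthonormal hV, norm_mul_left_of_orthonormal hU,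
    norm_mul_right_of_orthonormal hV', norm_mul_left_of_orthonormal hU', norm_rect_sq hnm,
    norm_rect_sq hnm]
  have e1 : frob (U * rect n m d * Vᵀ) (U' * rect n m e * V'ᵀ) =
      ∑ i : Fin n, ∑ j : Fin n, d i * e j *
        ((Uᵀ * U') i j * (Vᵀ * V') (Fin.castLE hnm i) (Fin.castLE hnm j)) := by
    have e2 : frob (U * rect n m d * Vᵀ) (U' * rect n m e * V'ᵀ) =
        frob (rect n m d * (Vᵀ * V')) ((Uᵀ * U') * rect n m e) := by
      rw [Matrix.mul_assoc U, frob_mul_left, frob_mul_right (rect n m d), frob_mul_right (rect n m d)]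
      simp [Matrix.mul_assoc]
    rw [e2, frob_comm, frob_mul_right, frob_eq_sum]
    refine Finset.sum_congr rfl fun i _ => Finset.sum_congr rfl fun j _ => ?_
    rw [rect_transpose, mul_rect_apply_of_ge hnm, rect_mul_apply hnm]
    ring
  -- The cross term couples the two overlap matrices through products of entries; 2xy ≤ x² + y²
  -- separates them into two doubly stochastic sums.
  have e3 : frob (U * rect n m d * Vᵀ) (U' * rect n m e * V'ᵀ) ≤ ∑ i : Fin n, d i * e i := by
    have b1 := sum_rect_le hnm hd he hd0 he0 hN
    have b2 := sum_rect_le le_rfl hd he hd0 he0 hM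
    have b3 : frob (U * rect n m d * Vᵀ) (U' * rect n m e * V'ᵀ) ≤
        1 / 2 * (∑ i : Fin n, ∑ j : Fin n, d i * e j * (Uᵀ * U') i j ^ 2) +
        1 / 2 * (∑ i : Fin n, ∑ j : Fin n, d i * e j *
          (Vᵀ * V') (Fin.castLE hnm i) (Fin.castLE hnm j) ^ 2) := by
      rw [e1]
      simp only [Finset.mul_sum, ← Finset.sum_add_distrib]
      refine Finset.sum_le_sum fun i _ => Finset.sum_le_sum fun j _ => ?_
      have := mul_nonneg (hd0 i) (he0 j)
      have h2 := sq_nonneg ((Uᵀ * U') i j - (Vᵀ * V') (Fin.castLE hnm i) (Fin.castLE hnm j))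
      nlinarith [mul_nonneg this h2]
    have b2' : ∑ i : Fin n, ∑ j : Fin n, d i * e j * (Uᵀ * U') i j ^ 2 ≤ ∑ i : Fin n, d i * e i := b2
    linarith
  have e4 : ∑ i : Fin n, (d i - e i) ^ 2 =
      ∑ i : Fin n, d i ^ 2 - 2 * ∑ i : Fin n, d i * e i + ∑ i : Fin n, e i ^ 2 := by
    rw [Finset.mul_sum, ← Finset.sum_sub_distrib, ← Finset.sum_add_distrib]
    exact Finset.sum_congr rfl fun i _ => by ring
  rw [e4]
  linarith

end

end PAMA

namespace PAMA

noncomputable section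

/-! ### Singular value decompositions -/

theorem sigma_nonneg {n m : ℕ} (X : Matrix (Fin n) (Fin m) ℝ) (i : ℕ) : 0 ≤ sigma X i :=
  LinearMap.singularValues_nonneg _ _

theorem sigma_antitone {n m : ℕ} (X : Matrix (Fin n) (Fin m) ℝ) : Antitone (sigma X) :=
  LinearMap.singularValues_antitone _

theorem sigma_pos_iff {n m : ℕ} (X : Matrix (Fin n) (Fin m) ℝ) (i : ℕ) :
    0 < sigma X i ↔ i < X.rank := by
  rw [sigma, LinearMap.singularValues_pos_iff_lt_finrank_range,
    Matrix.rank_eq_finrank_range_toLin X (EuclideanSpace.basisFun (Fin n) ℝ).toBasis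
      (EuclideanSpace.basisFun (Fin m) ℝ).toBasis, Matrix.toEuclideanLin,
    Matrix.toLpLin_eq_toLin]
  rfl

theorem sigma_eq_zero_of_rank_le {n m : ℕ} (X : Matrix (Fin n) (Fin m) ℝ) {i : ℕ}
    (h : X.rank ≤ i) : sigma X i = 0 :=
  le_antisymm (not_lt.1 fun hp => not_lt.2 h ((sigma_pos_iff X i).1 hp)) (sigma_nonneg X i)

theorem sigma_eq_zero_of_le {n m : ℕ} (X : Matrix (Fin n) (Fin m) ℝ) {i : ℕ} (h : n ≤ i) :
    sigma X i = 0 :=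
  sigma_eq_zero_of_rank_le X ((Matrix.rank_le_height X).trans h)

/-- The columns of a matrix as Euclidean vectors. -/
def col {l r : ℕ} (W : Matrix (Fin l) (Fin r) ℝ) (i : Fin r) : EuclideanSpace ℝ (Fin l) :=
  WithLp.toLp 2 fun a => W a i

theorem col_apply {l r : ℕ} (W : Matrix (Fin l) (Fin r) ℝ) (i : Fin r) (a : Fin l) :
    col W i a = W a i := rfl

theorem inner_col {l r r' : ℕ} (W : Matrix (Fin l) (Fin r) ℝ) (W' : Matrix (Fin l) (Fin r') ℝ)
    (i : Fin r) (j : Fin r') : inner ℝ (col W i) (col W' j) = (Wᵀ * W') i j := by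
  rw [PiLp.inner_apply, Matrix.mul_apply]
  exact Finset.sum_congr rfl fun a _ => by simp [col_apply, mul_comm]

/-- Vectors outside `s` are discarded and replaced by an orthonormal completion, so an SVD can be
built from normalized images even when some singular values vanish. -/
theorem exists_orthogonal_matrix {l : ℕ} (v : Fin l → EuclideanSpace ℝ (Fin l)) (s : Set (Fin l))
    (hv : ∀ i ∈ s, ∀ j ∈ s, inner ℝ (v i) (v j) = if i = j then (1 : ℝ) else 0) :
    ∃ O : Matrix (Fin l) (Fin l) ℝ, Oᵀ * O = 1 ∧ ∀ i ∈ s, col O i = v i := by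
  have ho : Orthonormal ℝ (s.domRestrict v) := by
    rw [orthonormal_iff_ite]
    rintro ⟨i, hi⟩ ⟨j, hj⟩
    have := hv i hi j hj
    simpa [Set.domRestrict] using this
  obtain ⟨b, hb⟩ := ho.exists_orthonormalBasis_extension_of_card_eq (ι := Fin l) (by simp)
  have hcol : ∀ i, col (Matrix.of fun a j => b j a) i = b i := fun i => rfl
  refine ⟨Matrix.of fun a j => b j a, ?_, fun i hi => by rw [hcol, hb i hi]⟩
  ext i j
  rw [← inner_col, hcol, hcol, orthonormal_iff_ite.1 b.orthonormal, Matrix.one_apply]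

theorem exists_orthogonal_extension {l r : ℕ} (hr : r ≤ l) {P : Matrix (Fin l) (Fin r) ℝ}
    (hP : OrthonormalCols P) :
    ∃ O : Matrix (Fin l) (Fin l) ℝ, Oᵀ * O = 1 ∧ O.submatrix id (Fin.castLE hr) = P := by
  obtain ⟨O, hO, h⟩ := exists_orthogonal_matrix
    (fun i => if h : (i : ℕ) < r then col P ⟨i, h⟩ else 0) {i | (i : ℕ) < r} (by
      intro i hi j hj
      have hi' : (i : ℕ) < r := hi
      have hj' : (j : ℕ) < r := hj
      rw [dif_pos hi', dif_pos hj', inner_col, hP, Matrix.one_apply]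
      simp [Fin.ext_iff])
  refine ⟨O, hO, ?_⟩
  ext a i
  have := h (Fin.castLE hr i) (by simp)
  have := congrFun (congrArg WithLp.ofLp this) a
  simpa [col_apply] using this

theorem mem_svdPairs_iff {n m : ℕ} {X : Matrix (Fin n) (Fin m) ℝ} {U : Matrix (Fin n) (Fin n) ℝ}
    {V : Matrix (Fin m) (Fin m) ℝ} : (U, V) ∈ svdPairs X ↔
      Uᵀ * U = 1 ∧ Vᵀ * V = 1 ∧ X = U * rect n m (sigma X) * Vᵀ := by
  simp only [svdPairs, Set.mem_ofPred_eq, Matrix.mem_orthogonalGroup_iff']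
  rfl

/-- The right singular vectors are eigenvectors of XᵀX; their images are orthogonal with squared
norms σ², so normalizing the nonzero ones gives left singular vectors. -/
theorem exists_mem_svdPairs {n m : ℕ} (hnm : n ≤ m) (X : Matrix (Fin n) (Fin m) ℝ) :
    ∃ U V, (U, V) ∈ svdPairs X := by
  set T := Matrix.toEuclideanLin X with hT
  have hm : Module.finrank ℝ (EuclideanSpace ℝ (Fin m)) = m := by simp
  set w := T.isSymmetric_adjoint_comp_self.eigenvectorBasis hm with hw
  have hTT : ∀ i j : Fin m, inner ℝ (T (w i)) (T (w j)) =
      if i = j then sigma X j ^ 2 else (0 : ℝ) := by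
    intro i j
    rw [← LinearMap.adjoint_inner_right]
    have h1 := T.isSymmetric_adjoint_comp_self.apply_eigenvectorBasis hm j
    rw [← T.sq_singularValues_fin hm, ← hw] at h1
    have h2 : (LinearMap.adjoint T) (T (w j)) = (sigma X j ^ 2 : ℝ) • w j := h1
    rw [h2, inner_smul_right, orthonormal_iff_ite.1 w.orthonormal]
    split_ifs <;> simp
  have hT0 : ∀ j : Fin m, sigma X j = 0 → T (w j) = 0 := by
    intro j hj
    have := hTT j j
    rw [if_pos rfl, hj] at this
    exact inner_self_eq_zero.1 (this.trans (by simp))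
  obtain ⟨U, hU, hUs⟩ := exists_orthogonal_matrix
    (fun i : Fin n => (sigma X i)⁻¹ • T (w (Fin.castLE hnm i))) {i | sigma X i ≠ 0} (by
      intro i hi j hj
      rw [inner_smul_left, inner_smul_right, hTT]
      by_cases hij : i = j
      · subst hij
        have : sigma X i ≠ 0 := hi
        simp
        field_simp
      · rw [if_neg (fun h => hij (by simpa [Fin.ext_iff] using h)), if_neg hij]
        simp)
  have hV : (Matrix.of fun a j => w j a : Matrix (Fin m) (Fin m) ℝ)ᵀ *
      (Matrix.of fun a j => w j a : Matrix (Fin m) (Fin m) ℝ) = 1 := by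
    have hcol : ∀ i, col (Matrix.of fun a j => w j a : Matrix (Fin m) (Fin m) ℝ) i = w i :=
      fun i => rfl
    ext i j
    rw [← inner_col, hcol, hcol, orthonormal_iff_ite.1 w.orthonormal, Matrix.one_apply]
  refine ⟨U, Matrix.of fun a j => w j a, mem_svdPairs_iff.2 ⟨hU, hV, ?_⟩⟩
  have hXV : X * (Matrix.of fun a j => w j a : Matrix (Fin m) (Fin m) ℝ) =
      U * rect n m (sigma X) := by
    ext a j
    have h1 : (X * (Matrix.of fun a j => w j a : Matrix (Fin m) (Fin m) ℝ)) a j = T (w j) a := by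
      simp [hT, Matrix.toLpLin_apply, Matrix.mul_apply, Matrix.mulVec, dotProduct]
    rw [h1]
    by_cases hj : (j : ℕ) < n
    · have hj' : j = Fin.castLE hnm ⟨j, hj⟩ := rfl
      rw [hj', mul_rect_apply hnm]
      by_cases h0 : sigma X j = 0
      · rw [← hj', hT0 j h0]
        simp [h0]
      · have := congrFun (congrArg WithLp.ofLp (hUs ⟨j, hj⟩ h0)) a
        change U a ⟨j, hj⟩ = _ at this
        rw [this]
        simp
        field_simp
    · rw [mul_rect_apply_of_le _ _ _ _ (not_lt.1 hj), hT0 j (sigma_eq_zero_of_le X (not_lt.1 hj))]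
      rfl
  rw [← hXV, Matrix.mul_assoc, mul_eq_one_comm.1 hV, Matrix.mul_one]

/-! ### Stability and uniqueness of singular values. -/

theorem sum_sigma_sub_sq_le {n m : ℕ} (hnm : n ≤ m) (X Y : Matrix (Fin n) (Fin m) ℝ) :
    ∑ i : Fin n, (sigma X i - sigma Y i) ^ 2 ≤ ‖X - Y‖ ^ 2 := by
  obtain ⟨U, V, h⟩ := exists_mem_svdPairs hnm X
  obtain ⟨U', V', h'⟩ := exists_mem_svdPairs hnm Y
  rw [mem_svdPairs_iff] at h h'
  have := mirsky hnm (sigma_antitone X) (sigma_antitone Y) (sigma_nonneg X) (sigma_nonneg Y)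
    h.1 h'.1 h.2.1 h'.2.1
  rwa [← h.2.2, ← h'.2.2] at this

theorem sum_range_sigma_sub_sq_le {n m : ℕ} (hnm : n ≤ m) (X Y : Matrix (Fin n) (Fin m) ℝ)
    (N : ℕ) : ∑ i ∈ Finset.range N, (sigma X i - sigma Y i) ^ 2 ≤ ‖X - Y‖ ^ 2 := by
  refine le_trans ?_ (sum_sigma_sub_sq_le hnm X Y)
  rw [Fin.sum_univ_eq_sum_range (fun i => (sigma X i - sigma Y i) ^ 2) n]
  rcases le_total N n with h | h
  · exact Finset.sum_le_sum_of_subset_of_nonneg (Finset.range_mono h) fun _ _ _ => sq_nonneg _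
  · refine (Finset.sum_subset (Finset.range_mono h) fun i _ hi => ?_).ge
    have : n ≤ i := by simpa using hi
    simp [sigma_eq_zero_of_le _ this]

/-- Treating two singular values jointly costs a factor √2 on their gap; separate bounds would cost
2, which would exhaust a gap of 2δ on the boundary of the δ-ball. -/
theorem two_sigma_sub_sq_le {n m : ℕ} (hnm : n ≤ m) (X Y : Matrix (Fin n) (Fin m) ℝ)
    {i j : ℕ} (hij : i ≠ j) :
    (sigma X i - sigma Y i) ^ 2 + (sigma X j - sigma Y j) ^ 2 ≤ ‖X - Y‖ ^ 2 := by
  refine le_trans ?_ (sum_range_sigma_sub_sq_le hnm X Y (max i j + 1))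
  rw [← Finset.sum_pair (f := fun i => (sigma X i - sigma Y i) ^ 2) hij]
  refine Finset.sum_le_sum_of_subset_of_nonneg ?_ fun _ _ _ => sq_nonneg _
  intro k hk
  simp only [Finset.mem_insert, Finset.mem_singleton] at hk
  simp only [Finset.mem_range]
  omega

theorem abs_sigma_sub_le {n m : ℕ} (hnm : n ≤ m) (X Y : Matrix (Fin n) (Fin m) ℝ) (i : ℕ) :
    |sigma X i - sigma Y i| ≤ ‖X - Y‖ := by
  apply abs_le_of_sq_le_sq _ (norm_nonneg _)
  have := two_sigma_sub_sq_le hnm X Y (Nat.ne_of_lt (Nat.lt_succ_self i))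
  nlinarith [sq_nonneg (sigma X (i + 1) - sigma Y (i + 1))]

/-- Mirsky's inequality applied to two decompositions of the same matrix has right-hand side zero,
so the two diagonals coincide. -/
theorem sigma_mul_rect_mul {n m : ℕ} (hnm : n ≤ m) {d : ℕ → ℝ} (hd : Antitone d)
    (hd0 : ∀ i, 0 ≤ d i) {U : Matrix (Fin n) (Fin n) ℝ} {V : Matrix (Fin m) (Fin m) ℝ}
    (hU : Uᵀ * U = 1) (hV : Vᵀ * V = 1) {i : ℕ} (hi : i < n) :
    sigma (U * rect n m d * Vᵀ) i = d i := by
  set X := U * rect n m d * Vᵀ with hX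
  obtain ⟨U', V', h'⟩ := exists_mem_svdPairs hnm X
  rw [mem_svdPairs_iff] at h'
  have := mirsky hnm (sigma_antitone X) hd (sigma_nonneg X) hd0 h'.1 hU h'.2.1 hV
  rw [← h'.2.2, ← hX, sub_self, norm_zero, zero_pow two_ne_zero] at this
  have h0 := (Finset.sum_eq_zero_iff_of_nonneg fun j _ => sq_nonneg _).1
    (le_antisymm this (Finset.sum_nonneg fun j _ => sq_nonneg _)) ⟨i, hi⟩ (Finset.mem_univ _)
  exact sub_eq_zero.1 (pow_eq_zero_iff two_ne_zero |>.1 h0)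

/-- A thin factorization with orthonormal columns extends to a singular value decomposition. -/
theorem exists_svdPairs_of_thin {n m r : ℕ} (hrn : r ≤ n) (hnm : n ≤ m) {d : ℕ → ℝ}
    (hd : Antitone d) (hd0 : ∀ i, 0 ≤ d i) {P : Matrix (Fin n) (Fin r) ℝ}
    {Q : Matrix (Fin m) (Fin r) ℝ} (hP : OrthonormalCols P) (hQ : OrthonormalCols Q) :
    ∃ U V, (U, V) ∈ svdPairs (P * Matrix.diagonal (fun i : Fin r => d i) * Qᵀ) ∧
      U.submatrix id (Fin.castLE hrn) = P ∧ V.submatrix id (Fin.castLE (hrn.trans hnm)) = Q ∧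
      ∀ i < r, sigma (P * Matrix.diagonal (fun i : Fin r => d i) * Qᵀ) i = d i := by
  obtain ⟨U, hU, hUP⟩ := exists_orthogonal_extension hrn hP
  obtain ⟨V, hV, hVQ⟩ := exists_orthogonal_extension (hrn.trans hnm) hQ
  have hX : P * Matrix.diagonal (fun i : Fin r => d i) * Qᵀ = U * rect n m (cut r d) * Vᵀ := by
    ext a b
    rw [Matrix.mul_apply, Matrix.mul_assoc, Matrix.mul_apply]
    simp only [rect_mul_apply hnm, Matrix.mul_diagonal, Matrix.transpose_apply]
    have := sum_fin_cut hrn (fun i => if h : i < n then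
      U a ⟨i, h⟩ * (cut r d i * V b (Fin.castLE hnm ⟨i, h⟩)) else 0) (by
        intro i hi
        simp [cut, not_lt.2 hi])
    simp only [Fin.is_lt, dite_true, Fin.eta] at this
    rw [this]
    refine Finset.sum_congr rfl fun i _ => ?_
    rw [dif_pos (i.2.trans_le hrn), ← hUP, ← hVQ]
    simp only [Matrix.submatrix_apply, id, cut, i.2, if_true]
    change _ = U a (Fin.castLE hrn i) * (d i * V b (Fin.castLE (hrn.trans hnm) i))
    ring
  have hc0 : ∀ i, 0 ≤ cut r d i := fun i => by unfold cut; split_ifs; exacts [hd0 _, le_rfl]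
  have hs : ∀ i < n, sigma (P * Matrix.diagonal (fun i : Fin r => d i) * Qᵀ) i = cut r d i := by
    intro i hi
    rw [hX]
    exact sigma_mul_rect_mul hnm (cut_antitone hd hd0) hc0 hU hV hi
  refine ⟨U, V, mem_svdPairs_iff.2 ⟨hU, hV, ?_⟩, hUP, hVQ, fun i hi => ?_⟩
  · have : rect n m (sigma (P * Matrix.diagonal (fun i : Fin r => d i) * Qᵀ)) =
        rect n m (cut r d) := by
      ext i j
      simp only [rect_apply, hs i i.2]
    rw [this, hX]
  · rw [hs i (hi.trans_le hrn), cut, if_pos hi]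

end

end PAMA

namespace PAMA

noncomputable section

/-! ### Perturbation of singular vectors -/

theorem sum_row_sq_le {ι κ : Type*} [Fintype ι] [Fintype κ] (A : Matrix ι κ ℝ) (i : ι) :
    ∑ j, A i j ^ 2 ≤ ‖A‖ ^ 2 := by
  rw [norm_sq_eq_sum]
  exact Finset.single_le_sum (f := fun i => ∑ j, A i j ^ 2)
    (fun i _ => Finset.sum_nonneg fun j _ => sq_nonneg _) (Finset.mem_univ i)

theorem sum_col_sq_le {ι κ : Type*} [Fintype ι] [Fintype κ] (A : Matrix ι κ ℝ) (j : κ) :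
    ∑ i, A i j ^ 2 ≤ ‖A‖ ^ 2 := by
  rw [← norm_transpose_frob]
  exact sum_row_sq_le Aᵀ j

theorem norm_col_eq_one {l : ℕ} {U : Matrix (Fin l) (Fin l) ℝ} (hU : Uᵀ * U = 1) (i : Fin l) :
    ‖col U i‖ = 1 := by
  rw [← sq_eq_sq₀ (norm_nonneg _) zero_le_one, ← real_inner_self_eq_norm_sq, inner_col, hU]
  simp

theorem sum_sq_inner_col_eq_one {l : ℕ} {U U' : Matrix (Fin l) (Fin l) ℝ} (hU : Uᵀ * U = 1)
    (hU' : U'ᵀ * U' = 1) (i : Fin l) : ∑ j, (Uᵀ * U') j i ^ 2 = 1 := by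
  have hM : (Uᵀ * U')ᵀ * (Uᵀ * U') = 1 := by
    rw [Matrix.transpose_mul, Matrix.transpose_transpose, Matrix.mul_assoc, ← Matrix.mul_assoc U,
      mul_eq_one_comm.1 hU, Matrix.one_mul, hU']
  have := congrFun (congrFun hM i) i
  rw [Matrix.mul_apply] at this
  simpa only [sq, Matrix.transpose_apply, Matrix.one_apply_eq] using this

theorem norm_col_sub_smul_le {l : ℕ} {U U' : Matrix (Fin l) (Fin l) ℝ} (hU : Uᵀ * U = 1)
    (hU' : U'ᵀ * U' = 1) (i : Fin l) {ε t : ℝ} (hε : ε = 1 ∨ ε = -1) (ht : 0 ≤ t)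
    (h : 1 - 2 * t ^ 2 ≤ ε * (Uᵀ * U') i i) : ‖col U i - ε • col U' i‖ ≤ 2 * t := by
  apply le_of_sq_le_sq _ (by positivity)
  rw [norm_sub_sq_real, norm_smul, norm_col_eq_one hU, norm_col_eq_one hU', inner_smul_right,
    inner_col]
  have : ‖ε‖ = 1 := by rcases hε with rfl | rfl <;> simp
  rw [this]
  nlinarith

/-- From M i ² ≥ 1 − 3.94 t², the slack between 3.94 and 4 leaves 0.06 t², which absorbs the term 4
t⁴ in (1 − 2t²)² for small t. -/
theorem diagonal_entry_ge {l : ℕ} {M : Fin l → ℝ} (i : Fin l) (h1 : ∑ j, M j ^ 2 = 1) {t : ℝ}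
    (ht0 : 0 ≤ t) (ht : t ≤ 1 / 1000)
    (h2 : ∑ j ∈ Finset.univ.erase i, M j ^ 2 ≤ 394 / 100 * t ^ 2) :
    1 - 2 * t ^ 2 ≤ |M i| := by
  rw [← Finset.sum_erase_add _ _ (Finset.mem_univ i)] at h1
  have h3 : (1 - 2 * t ^ 2) ^ 2 ≤ |M i| ^ 2 := by
    rw [sq_abs]
    nlinarith [sq_nonneg t, mul_nonneg (sq_nonneg t) ht0]
  exact le_of_sq_le_sq h3 (abs_nonneg _)

/-- Solving the 2×2 system expresses (s'² − sj²)a and (s'² − sj²)b through p and q, and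
Cauchy-Schwarz bounds either one by (s'² + sj²)(p² + q²). -/
theorem sq_le_of_gap {a b s' sj δ p q x : ℝ} (hδ : 0 < δ) (hs' : δ ≤ s') (hsj : 0 ≤ sj)
    (hgap : 584 / 1000 * δ ≤ |s' - sj|) (hp : p = s' * a - sj * b) (hq : q = s' * b - sj * a)
    (hx : x = a ∨ x = b) : x ^ 2 ≤ 197 / 100 / δ ^ 2 * (p ^ 2 + q ^ 2) := by
  have hD : 341 / 1000 * δ ^ 2 ≤ (s' - sj) ^ 2 := by
    rw [← sq_abs (s' - sj)]
    nlinarith [abs_nonneg (s' - sj)]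
  have hS : δ ^ 2 ≤ (s' + sj) ^ 2 := by nlinarith
  have hδ2 : 0 < δ ^ 2 := by positivity
  have hDS : 0 < (s' - sj) ^ 2 * (s' + sj) ^ 2 := by
    have : 0 < (s' - sj) ^ 2 := by linarith
    have : 0 < (s' + sj) ^ 2 := by linarith
    positivity
  have key : x ^ 2 * ((s' - sj) ^ 2 * (s' + sj) ^ 2) ≤ (s' ^ 2 + sj ^ 2) * (p ^ 2 + q ^ 2) := by
    rcases hx with rfl | rfl
    · have : x ^ 2 * ((s' - sj) ^ 2 * (s' + sj) ^ 2) = (s' * p + sj * q) ^ 2 := by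
        rw [hp, hq]; ring
      rw [this]
      nlinarith [sq_nonneg (s' * q - sj * p)]
    · have : x ^ 2 * ((s' - sj) ^ 2 * (s' + sj) ^ 2) = (sj * p + s' * q) ^ 2 := by
        rw [hp, hq]; ring
      rw [this]
      nlinarith [sq_nonneg (sj * q - s' * p)]
  -- Since 2(s'² + sj²) = (s' − sj)² + (s' + sj)², the quotient is at most (1/0.341 + 1)/2 < 1.97.
  have hc : (s' ^ 2 + sj ^ 2) * δ ^ 2 ≤ 197 / 100 * ((s' - sj) ^ 2 * (s' + sj) ^ 2) := by
    have h1 := mul_le_mul_of_nonneg_right hD (sq_nonneg (s' + sj))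
    have h2 := mul_le_mul_of_nonneg_left hS (sq_nonneg (s' - sj))
    nlinarith
  have hpq : 0 ≤ p ^ 2 + q ^ 2 := by positivity
  rw [div_mul_eq_mul_div, le_div_iff₀ hδ2]
  have h3 := mul_le_mul_of_nonneg_right hc hpq
  have h4 := mul_le_mul_of_nonneg_right key hδ2.le
  by_contra hcon
  push Not at hcon
  have h5 := mul_lt_mul_of_pos_right hcon hDS
  nlinarith

/-- Off-diagonal overlaps come from the 2×2 systems `hPe`, `hQe`. Because the overlap columns are
unit vectors, small off-diagonal mass forces a diagonal entry of modulus at least 1 − 2t², and ‖u −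
εu'‖² = 2 − 2ε⟨u, u'⟩ turns this into the bound 2t. -/
theorem svd_perturbation_local {n m : ℕ} (hnm : n ≤ m) {X X' : Matrix (Fin n) (Fin m) ℝ}
    {δ t : ℝ} (hδ : 0 < δ) (ht0 : 0 ≤ t) (ht : t ≤ 1 / 1000) (hXX : ‖X' - X‖ ≤ t * δ) (i : Fin n)
    (hs : δ ≤ sigma X' i)
    (hgap : ∀ j : ℕ, j ≠ i → 584 / 1000 * δ ≤ |sigma X' i - sigma X j|)
    {U U' : Matrix (Fin n) (Fin n) ℝ} {V V' : Matrix (Fin m) (Fin m) ℝ}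
    (h : (U, V) ∈ svdPairs X) (h' : (U', V') ∈ svdPairs X') :
    ∃ ε : ℝ, (ε = 1 ∨ ε = -1) ∧ ‖col U i - ε • col U' i‖ ≤ 2 * t ∧
      ‖col V (Fin.castLE hnm i) - ε • col V' (Fin.castLE hnm i)‖ ≤ 2 * t := by
  obtain ⟨hU, hV, hX⟩ := mem_svdPairs_iff.1 h
  obtain ⟨hU', hV', hX'⟩ := mem_svdPairs_iff.1 h'
  set c := Fin.castLE hnm with hc
  set M := Uᵀ * U' with hM
  set N := Vᵀ * V' with hN
  set P := Uᵀ * (X' - X) * V' with hP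
  set Q := U'ᵀ * (X' - X) * V with hQ
  have hUX : Uᵀ * X = rect n m (sigma X) * Vᵀ := by
    conv_lhs => rw [hX]
    rw [← Matrix.mul_assoc, ← Matrix.mul_assoc, hU, Matrix.one_mul]
  have hXV : X * V = U * rect n m (sigma X) := by
    conv_lhs => rw [hX]
    rw [Matrix.mul_assoc, hV, Matrix.mul_one]
  have hUX' : U'ᵀ * X' = rect n m (sigma X') * V'ᵀ := by
    conv_lhs => rw [hX']
    rw [← Matrix.mul_assoc, ← Matrix.mul_assoc, hU', Matrix.one_mul]
  have hXV' : X' * V' = U' * rect n m (sigma X') := by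
    conv_lhs => rw [hX']
    rw [Matrix.mul_assoc, hV', Matrix.mul_one]
  have eP : P = M * rect n m (sigma X') - rect n m (sigma X) * N := by
    rw [hP, Matrix.mul_sub, Matrix.sub_mul, hUX, Matrix.mul_assoc, hXV', hM, hN]
    simp only [Matrix.mul_assoc]
  have eQ : Q = rect n m (sigma X') * Nᵀ - Mᵀ * rect n m (sigma X) := by
    rw [hQ, Matrix.mul_sub, Matrix.sub_mul, hUX', Matrix.mul_assoc U'ᵀ X, hXV, hM, hN]
    simp only [Matrix.mul_assoc, Matrix.transpose_mul, Matrix.transpose_transpose]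
  have nP : ‖P‖ ≤ t * δ := by
    have hUt : (Uᵀ)ᵀ * Uᵀ = 1 := by rw [Matrix.transpose_transpose]; exact mul_eq_one_comm.1 hU
    have hVt : (V'ᵀ)ᵀ * V'ᵀ = 1 := by rw [Matrix.transpose_transpose]; exact mul_eq_one_comm.1 hV'
    have := norm_mul_right_of_orthonormal hVt (Uᵀ * (X' - X))
    rw [Matrix.transpose_transpose] at this
    rwa [hP, this, norm_mul_left_of_orthonormal hUt]
  have nQ : ‖Q‖ ≤ t * δ := by
    have hUt : (U'ᵀ)ᵀ * U'ᵀ = 1 := by rw [Matrix.transpose_transpose]; exact mul_eq_one_comm.1 hU'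
    have hVt : (Vᵀ)ᵀ * Vᵀ = 1 := by rw [Matrix.transpose_transpose]; exact mul_eq_one_comm.1 hV
    have := norm_mul_right_of_orthonormal hVt (U'ᵀ * (X' - X))
    rw [Matrix.transpose_transpose] at this
    rwa [hQ, this, norm_mul_left_of_orthonormal hUt]
  have hPe : ∀ j : Fin n, P j (c i) = sigma X' i * M j i - sigma X j * N (c j) (c i) := by
    intro j
    rw [eP, Matrix.sub_apply, hc, mul_rect_apply hnm, rect_mul_apply hnm]
  have hQe : ∀ j : Fin n, Q i (c j) = sigma X' i * N (c j) (c i) - sigma X j * M j i := by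
    intro j
    rw [eQ, Matrix.sub_apply, hc, mul_rect_apply hnm, rect_mul_apply hnm]
    rfl
  have hQe' : ∀ j : Fin m, n ≤ j → Q i j = sigma X' i * N j (c i) := by
    intro j hj
    rw [eQ, Matrix.sub_apply, mul_rect_apply_of_le _ _ _ _ hj, rect_mul_apply hnm, sub_zero]
    rfl
  have sP : ∑ j, P j (c i) ^ 2 ≤ (t * δ) ^ 2 :=
    (sum_col_sq_le P (c i)).trans (pow_le_pow_left₀ (norm_nonneg _) nP 2)
  have sQ : ∑ j, Q i j ^ 2 ≤ (t * δ) ^ 2 :=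
    (sum_row_sq_le Q i).trans (pow_le_pow_left₀ (norm_nonneg _) nQ 2)
  have hδ2 : 0 < δ ^ 2 := by positivity
  have fin : ∀ A B : ℝ, A ≤ (t * δ) ^ 2 → B ≤ (t * δ) ^ 2 →
      197 / 100 / δ ^ 2 * (A + B) ≤ 394 / 100 * t ^ 2 := by
    intro A B hA hB
    rw [div_mul_eq_mul_div, div_le_iff₀ hδ2]
    nlinarith
  have bM : ∑ j ∈ Finset.univ.erase i, M j i ^ 2 ≤ 394 / 100 * t ^ 2 := by
    calc ∑ j ∈ Finset.univ.erase i, M j i ^ 2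
        ≤ ∑ j ∈ Finset.univ.erase i, 197 / 100 / δ ^ 2 * (P j (c i) ^ 2 + Q i (c j) ^ 2) := by
          refine Finset.sum_le_sum fun j hj => ?_
          have hji : (j : ℕ) ≠ i := fun h => Finset.ne_of_mem_erase hj (Fin.ext h)
          exact sq_le_of_gap hδ hs (sigma_nonneg X j) (hgap j hji) (hPe j) (hQe j) (Or.inl rfl)
      _ ≤ ∑ j, 197 / 100 / δ ^ 2 * (P j (c i) ^ 2 + Q i (c j) ^ 2) :=
          Finset.sum_le_sum_of_subset_of_nonneg (Finset.erase_subset _ _) fun _ _ _ => by positivity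
      _ ≤ 394 / 100 * t ^ 2 := by
          rw [← Finset.mul_sum, Finset.sum_add_distrib]
          refine fin _ _ sP (le_trans ?_ sQ)
          exact sum_castLE_le_sum hnm (fun j => Q i j ^ 2) fun _ => sq_nonneg _
  -- Rows of N with index at least n have no counterpart in M. There the system degenerates to one
  -- equation with zero singular value, so P is padded by zeros.
  have bN : ∑ j ∈ Finset.univ.erase (c i), N j (c i) ^ 2 ≤ 394 / 100 * t ^ 2 := by
    set p : ℕ → ℝ := fun j => if h : j < n then P ⟨j, h⟩ (c i) ^ 2 else 0 with hp
    have hp0 : ∀ j, 0 ≤ p j := fun j => by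
      simp only [hp]; split_ifs; exacts [sq_nonneg _, le_rfl]
    calc ∑ j ∈ Finset.univ.erase (c i), N j (c i) ^ 2
        ≤ ∑ j ∈ Finset.univ.erase (c i), 197 / 100 / δ ^ 2 * (p j + Q i j ^ 2) := by
          refine Finset.sum_le_sum fun j hj => ?_
          have hji : (j : ℕ) ≠ i := fun h => Finset.ne_of_mem_erase hj (Fin.ext h)
          by_cases hjn : (j : ℕ) < n
          · have := sq_le_of_gap hδ hs (sigma_nonneg X j) (hgap j hji) (hPe ⟨j, hjn⟩)
              (hQe ⟨j, hjn⟩) (Or.inr rfl)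
            simp only [hp, dif_pos hjn]
            exact this
          · have := sq_le_of_gap (a := 0) (b := N j (c i)) (p := 0) (q := Q i j) hδ hs le_rfl
              (by have := hgap j hji; rwa [sigma_eq_zero_of_le X (not_lt.1 hjn)] at this)
              (by ring) (by rw [hQe' j (not_lt.1 hjn)]; ring) (Or.inr rfl)
            simp only [hp, dif_neg hjn]
            simpa using this
      _ ≤ ∑ j : Fin m, 197 / 100 / δ ^ 2 * (p j + Q i j ^ 2) :=
          Finset.sum_le_sum_of_subset_of_nonneg (Finset.erase_subset _ _) fun j _ _ => by
            have := hp0 j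
            positivity
      _ ≤ 394 / 100 * t ^ 2 := by
          rw [← Finset.mul_sum, Finset.sum_add_distrib]
          refine fin _ _ (le_trans (le_of_eq ?_) sP) sQ
          rw [sum_fin_cut hnm p fun j hj => by simp only [hp, dif_neg (not_lt.2 hj)]]
          exact Finset.sum_congr rfl fun j _ => by simp only [hp, dif_pos j.2]
  have dM := diagonal_entry_ge (M := fun j => M j i) i (sum_sq_inner_col_eq_one hU hU' i) ht0 ht bM
  have dN := diagonal_entry_ge (M := fun j => N j (c i)) (c i)
    (sum_sq_inner_col_eq_one hV hV' (c i)) ht0 ht bN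
  -- The diagonal entry of P decides the common sign: σ'_i M_ii − σ_i N_ii is tiny while σ'_i |M_ii|
  -- is nearly at least δ, so M_ii and N_ii cannot have opposite signs.
  have hPi : |P i (c i)| ≤ t * δ := by
    apply abs_le_of_sq_le_sq _ (by positivity)
    refine le_trans ?_ sP
    exact Finset.single_le_sum (f := fun j => P j (c i) ^ 2) (fun j _ => sq_nonneg _)
      (Finset.mem_univ i)
  have ht2 : t ^ 2 ≤ 1 / 1000 := by nlinarith
  rw [hPe i] at hPi
  have hPi' := abs_le.1 hPi
  have htδ : t * δ ≤ 1 / 1000 * δ := mul_le_mul_of_nonneg_right ht hδ.le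
  have hsi := sigma_nonneg X i
  rcases le_or_gt 0 (M i i) with hm | hm
  · rw [abs_of_nonneg hm] at dM
    have hn : 0 ≤ N (c i) (c i) := by
      by_contra hn
      push Not at hn
      nlinarith [mul_nonneg hsi (neg_nonneg.2 hn.le)]
    rw [abs_of_nonneg hn] at dN
    exact ⟨1, Or.inl rfl, norm_col_sub_smul_le hU hU' i (Or.inl rfl) ht0 (by simpa using dM),
      norm_col_sub_smul_le hV hV' (c i) (Or.inl rfl) ht0 (by simpa using dN)⟩
  · rw [abs_of_neg hm] at dM
    have hn : N (c i) (c i) ≤ 0 := by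
      by_contra hn
      push Not at hn
      nlinarith [mul_nonneg hsi hn.le]
    rw [abs_of_nonpos hn] at dN
    exact ⟨-1, Or.inr rfl, norm_col_sub_smul_le hU hU' i (Or.inr rfl) ht0 (by simpa using dM),
      norm_col_sub_smul_le hV hV' (c i) (Or.inr rfl) ht0 (by simpa using dN)⟩

/-- Along a ball in which the leading `R` singular values keep a gap, the singular vectors are
Lipschitz continuous up to signs. -/
theorem svd_perturbation {n m : ℕ} (hnm : n ≤ m) {Xs : Matrix (Fin n) (Fin m) ℝ} {R : ℕ} {δ : ℝ}
    (hδ : 0 < δ) (hgaps : ∀ i j : ℕ, i < j → j ≤ R → 2 * δ ≤ sigma Xs i - sigma Xs j)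
    {X X' : Matrix (Fin n) (Fin m) ℝ} (hX : X ∈ Metric.closedBall Xs δ)
    (hX' : X' ∈ Metric.closedBall Xs δ)
    {U U' : Matrix (Fin n) (Fin n) ℝ} {V V' : Matrix (Fin m) (Fin m) ℝ}
    (h : (U, V) ∈ svdPairs X) (h' : (U', V') ∈ svdPairs X') (i : Fin n) (hi : (i : ℕ) < R) :
    ∃ ε : ℝ, (ε = 1 ∨ ε = -1) ∧ ‖col U i - ε • col U' i‖ ≤ 2 / δ * ‖X - X'‖ ∧
      ‖col V (Fin.castLE hnm i) - ε • col V' (Fin.castLE hnm i)‖ ≤ 2 / δ * ‖X - X'‖ := by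
  -- The constant 0.585 is just below 2 − √2. The local lemma asks only for 0.584, the difference
  -- paying for replacing one of the two singular values by its value at a point at distance δ/1000.
  have gap0 : ∀ Y ∈ Metric.closedBall Xs δ, ∀ a b : ℕ, a < b → b ≤ R →
      585 / 1000 * δ ≤ sigma Y a - sigma Y b := by
    intro Y hY a b hab hb
    have h1 := two_sigma_sub_sq_le hnm Y Xs hab.ne
    rw [Metric.mem_closedBall, dist_eq_norm] at hY
    have h2 : ‖Y - Xs‖ ^ 2 ≤ δ ^ 2 := pow_le_pow_left₀ (norm_nonneg _) hY 2
    have h3 := hgaps a b hab hb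
    have h4 : (sigma Xs a - sigma Y a + (sigma Y b - sigma Xs b)) ^ 2 ≤ (1415 / 1000 * δ) ^ 2 := by
      nlinarith [sq_nonneg (sigma Xs a - sigma Y a - (sigma Y b - sigma Xs b)), sq_nonneg δ]
    have h5 := abs_le_of_sq_le_sq' h4 (by positivity)
    linarith [h5.2]
  have gap1 : ∀ Y ∈ Metric.closedBall Xs δ, ∀ b : ℕ, b ≠ i →
      585 / 1000 * δ ≤ |sigma Y i - sigma Y b| := by
    intro Y hY b hb
    rcases lt_or_gt_of_ne hb with hlt | hgt
    · have := gap0 Y hY b i hlt hi.le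
      rw [abs_sub_comm]
      exact this.trans (le_abs_self _)
    · refine le_trans ?_ (le_abs_self _)
      rcases le_total b R with hbR | hbR
      · exact gap0 Y hY i b hgt hbR
      · have := gap0 Y hY i R hi le_rfl
        have := sigma_antitone Y hbR
        linarith
  have low : ∀ Y ∈ Metric.closedBall Xs δ, δ ≤ sigma Y i := by
    intro Y hY
    rw [Metric.mem_closedBall, dist_eq_norm] at hY
    have h1 := (abs_le.1 ((abs_sigma_sub_le hnm Y Xs i).trans hY)).1
    have h2 := hgaps i R hi le_rfl
    have := sigma_nonneg Xs R
    linarith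
  have loc : ∀ Y ∈ Metric.closedBall Xs δ, ∀ Y' ∈ Metric.closedBall Xs δ,
      ∀ t : ℝ, 0 ≤ t → t ≤ 1 / 1000 → ‖Y' - Y‖ ≤ t * δ →
      ∀ A B A' B', (A, B) ∈ svdPairs Y → (A', B') ∈ svdPairs Y' →
      ∃ ε : ℝ, (ε = 1 ∨ ε = -1) ∧ ‖col A i - ε • col A' i‖ ≤ 2 * t ∧
      ‖col B (Fin.castLE hnm i) - ε • col B' (Fin.castLE hnm i)‖ ≤ 2 * t := by
    intro Y hY Y' hY' t ht0 ht hYY A B A' B' hA hA'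
    refine svd_perturbation_local hnm hδ ht0 ht hYY i (low Y' hY') ?_ hA hA'
    intro j hj
    have h1 := gap1 Y hY j hj
    have h2 := (abs_sigma_sub_le hnm Y' Y i).trans hYY
    have h3 : |sigma Y i - sigma Y j| ≤ |sigma Y' i - sigma Y j| + |sigma Y' i - sigma Y i| := by
      have := abs_sub (sigma Y' i - sigma Y j) (sigma Y' i - sigma Y i)
      simpa using this
    have h4 : t * δ ≤ 1 / 1000 * δ := mul_le_mul_of_nonneg_right ht hδ.le
    linarith
  -- K pieces make each step at most δ/1000, as the local estimate demands; the K bounds 2t sum to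
  -- 2‖X − X'‖/δ exactly.
  obtain ⟨K, hK⟩ := exists_nat_gt (1000 * ‖X - X'‖ / δ)
  have hK0 : 0 < (K : ℝ) := lt_of_le_of_lt (by positivity) hK
  set t := ‖X - X'‖ / δ / K with ht
  have ht0 : 0 ≤ t := by positivity
  have ht1 : t ≤ 1 / 1000 := by
    rw [ht, div_le_iff₀ hK0]
    have : 1000 * ‖X - X'‖ / δ = 1000 * (‖X - X'‖ / δ) := by ring
    linarith
  set Z : ℕ → Matrix (Fin n) (Fin m) ℝ := fun k => X + ((k : ℝ) / K) • (X' - X) with hZ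
  have hZmem : ∀ k ≤ K, Z k ∈ Metric.closedBall Xs δ := by
    intro k hk
    have hk' : (k : ℝ) ≤ K := by exact_mod_cast hk
    exact (convex_closedBall Xs δ).add_smul_sub_mem hX hX'
      ⟨by positivity, (div_le_one hK0).2 hk'⟩
  have hstep : ∀ k, ‖Z (k + 1) - Z k‖ ≤ t * δ := by
    intro k
    have : Z (k + 1) - Z k = (1 / (K : ℝ)) • (X' - X) := by
      simp only [hZ]
      push_cast
      rw [add_sub_add_left_eq_sub, ← sub_smul]
      congr 1
      ring
    rw [this, norm_smul, Real.norm_of_nonneg (by positivity), ht, norm_sub_rev X' X]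
    apply le_of_eq
    field_simp
  have chain : ∀ k ≤ K, ∀ A B, (A, B) ∈ svdPairs (Z k) →
      ∃ ε : ℝ, (ε = 1 ∨ ε = -1) ∧ ‖col U i - ε • col A i‖ ≤ k * (2 * t) ∧
      ‖col V (Fin.castLE hnm i) - ε • col B (Fin.castLE hnm i)‖ ≤ k * (2 * t) := by
    intro k
    induction k with
    | zero =>
      intro _ A B hA
      have hZ0 : Z 0 = X := by simp [hZ]
      rw [hZ0] at hA
      obtain ⟨ε, hε, h1, h2⟩ := loc X hX X hX 0 le_rfl (by norm_num) (by simp) U V A B h hA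
      exact ⟨ε, hε, by simpa using h1, by simpa using h2⟩
    | succ k ih =>
      intro hk A B hA
      obtain ⟨A₁, B₁, hA₁⟩ := exists_mem_svdPairs hnm (Z k)
      obtain ⟨ε₁, hε₁, h1, h2⟩ := ih (by omega) A₁ B₁ hA₁
      obtain ⟨ε₂, hε₂, h3, h4⟩ := loc (Z k) (hZmem k (by omega)) (Z (k + 1)) (hZmem _ hk) t ht0 ht1
        (hstep k) A₁ B₁ A B hA₁ hA
      have tri : ∀ {l : ℕ} (x y z : EuclideanSpace ℝ (Fin l)), ‖x - ε₁ • y‖ ≤ k * (2 * t) →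
          ‖y - ε₂ • z‖ ≤ 2 * t → ‖x - (ε₁ * ε₂) • z‖ ≤ (k + 1 : ℕ) * (2 * t) := by
        intro l x y z hxy hyz
        have e : x - (ε₁ * ε₂) • z = (x - ε₁ • y) + ε₁ • (y - ε₂ • z) := by
          rw [smul_sub, smul_smul]; abel
        have hn : ‖ε₁ • (y - ε₂ • z)‖ = ‖y - ε₂ • z‖ := by
          rw [norm_smul]
          rcases hε₁ with rfl | rfl <;> simp
        rw [e]
        refine (norm_add_le _ _).trans ?_
        rw [hn]
        push_cast
        linarith
      refine ⟨ε₁ * ε₂, ?_, tri _ _ _ h1 h3, tri _ _ _ h2 h4⟩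
      rcases hε₁ with rfl | rfl <;> rcases hε₂ with rfl | rfl <;> simp
  have hZK : Z K = X' := by simp [hZ, div_self hK0.ne']
  obtain ⟨ε, hε, h1, h2⟩ := chain K le_rfl U' V' (by rw [hZK]; exact h')
  have e : (K : ℝ) * (2 * t) = 2 / δ * ‖X - X'‖ := by
    rw [ht]; field_simp
  rw [e] at h1 h2
  exact ⟨ε, hε, h1, h2⟩

end

end PAMA

namespace PAMA

noncomputable section

/-! ### The penalty and the objective as real functions -/

/-- The real-valued penalty on the nonnegative half-line. -/
def pen (θ : ℝ → EReal) (t : ℝ) : ℝ := (θ t).toReal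

/-- The real-valued column penalty. -/
def penSum (θ : ℝ → EReal) {l r : ℕ} (W : Matrix (Fin l) (Fin r) ℝ) : ℝ :=
  ∑ i, pen θ ‖col W i‖

theorem IsPenalty.nonneg {θ : ℝ → EReal} (hθ : IsPenalty θ) {t : ℝ} (ht : 0 ≤ t) : 0 ≤ θ t := by
  rcases ht.eq_or_lt with rfl | h
  · rw [hθ.zero]
  · exact (hθ.pos t h).le

theorem IsPenalty.coe_pen {θ : ℝ → EReal} (hθ : IsPenalty θ) {t : ℝ} (ht : 0 ≤ t) :
    ((pen θ t : ℝ) : EReal) = θ t := by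
  refine EReal.coe_toReal ?_ (ne_of_gt (lt_of_lt_of_le EReal.bot_lt_zero (hθ.nonneg ht)))
  rcases ht.eq_or_lt with rfl | h
  · rw [hθ.zero]
    exact EReal.zero_ne_top
  · exact hθ.finite t h

theorem IsPenalty.pen_nonneg {θ : ℝ → EReal} (hθ : IsPenalty θ) {t : ℝ} (ht : 0 ≤ t) :
    0 ≤ pen θ t := EReal.toReal_nonneg (hθ.nonneg ht)

theorem IsPenalty.pen_zero {θ : ℝ → EReal} (hθ : IsPenalty θ) : pen θ 0 = 0 := by
  simp [pen, hθ.zero]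

theorem IsPenalty.pen_pos {θ : ℝ → EReal} (hθ : IsPenalty θ) {t : ℝ} (ht : 0 < t) :
    0 < pen θ t := EReal.toReal_pos (hθ.pos t ht) (hθ.finite t ht)

theorem IsPenalty.hasDerivAt_pen {θ : ℝ → EReal} (hθ : IsPenalty θ) {t : ℝ} (ht : 0 < t) :
    HasDerivAt (pen θ) (penaltyDeriv θ t) t :=
  (hθ.differentiable t ht).hasDerivAt

theorem IsPenalty.colPenalty_eq {θ : ℝ → EReal} (hθ : IsPenalty θ) {l r : ℕ}
    (W : Matrix (Fin l) (Fin r) ℝ) : colPenalty θ W = ((penSum θ W : ℝ) : EReal) := by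
  have h : ∀ s : Finset (Fin r), ∑ i ∈ s, θ (colNorm W i) =
      ((∑ i ∈ s, pen θ ‖col W i‖ : ℝ) : EReal) := by
    intro s
    induction s using Finset.induction_on with
    | empty => simp
    | insert i s hi ih =>
      rw [Finset.sum_insert hi, Finset.sum_insert hi, ih, EReal.coe_add,
        hθ.coe_pen (norm_nonneg _)]
      rfl
  exact h Finset.univ

theorem IsPenalty.penSum_nonneg {θ : ℝ → EReal} (hθ : IsPenalty θ) {l r : ℕ}
    (W : Matrix (Fin l) (Fin r) ℝ) : 0 ≤ penSum θ W :=
  Finset.sum_nonneg fun _ _ => hθ.pen_nonneg (norm_nonneg _)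

/-- The real-valued objective. -/
def objR {n m r : ℕ} (f : Matrix (Fin n) (Fin m) ℝ → ℝ) (θ : ℝ → EReal) (lam mu : ℝ)
    (U : Matrix (Fin n) (Fin r) ℝ) (V : Matrix (Fin m) (Fin r) ℝ) : ℝ :=
  f (U * Vᵀ) + lam * (penSum θ U + penSum θ V) + mu / 2 * (‖U‖ ^ 2 + ‖V‖ ^ 2)

theorem IsPenalty.objective_eq {θ : ℝ → EReal} (hθ : IsPenalty θ) {n m r : ℕ}
    (f : Matrix (Fin n) (Fin m) ℝ → ℝ) (lam mu : ℝ)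
    (U : Matrix (Fin n) (Fin r) ℝ) (V : Matrix (Fin m) (Fin r) ℝ) :
    objective f θ lam mu U V = ((objR f θ lam mu U V : ℝ) : EReal) := by
  rw [objective, hθ.colPenalty_eq, hθ.colPenalty_eq, objR]
  push_cast
  rfl

theorem IsPenalty.majorObjective_eq {θ : ℝ → EReal} (hθ : IsPenalty θ) {n m r : ℕ}
    (f : Matrix (Fin n) (Fin m) ℝ → ℝ) (Lf lam mu : ℝ)
    (U U' : Matrix (Fin n) (Fin r) ℝ) (V V' : Matrix (Fin m) (Fin r) ℝ) :
    majorObjective f θ Lf lam mu U V U' V' = ((majorF f Lf U V U' V' +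
      lam * (penSum θ U + penSum θ V) + mu / 2 * (‖U‖ ^ 2 + ‖V‖ ^ 2) : ℝ) : EReal) := by
  rw [majorObjective, hθ.colPenalty_eq, hθ.colPenalty_eq]
  push_cast
  rfl

/-! ### Columns -/

theorem frob_eq_sum_inner_col {l r : ℕ} (A B : Matrix (Fin l) (Fin r) ℝ) :
    frob A B = ∑ i, inner ℝ (col A i) (col B i) := by
  simp only [inner_col]
  rfl

theorem norm_sq_eq_sum_col {l r : ℕ} (A : Matrix (Fin l) (Fin r) ℝ) :
    ‖A‖ ^ 2 = ∑ i, ‖col A i‖ ^ 2 := by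
  rw [← frob_self, frob_eq_sum_inner_col]
  exact Finset.sum_congr rfl fun i _ => real_inner_self_eq_norm_sq _

theorem col_sub {l r : ℕ} (A B : Matrix (Fin l) (Fin r) ℝ) (i : Fin r) :
    col (A - B) i = col A i - col B i := rfl

theorem col_add {l r : ℕ} (A B : Matrix (Fin l) (Fin r) ℝ) (i : Fin r) :
    col (A + B) i = col A i + col B i := rfl

theorem col_smul {l r : ℕ} (c : ℝ) (A : Matrix (Fin l) (Fin r) ℝ) (i : Fin r) :
    col (c • A) i = c • col A i := rfl

theorem norm_col_le {l r : ℕ} (A : Matrix (Fin l) (Fin r) ℝ) (i : Fin r) : ‖col A i‖ ≤ ‖A‖ := by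
  apply le_of_sq_le_sq _ (norm_nonneg _)
  rw [norm_sq_eq_sum_col]
  exact Finset.single_le_sum (f := fun i => ‖col A i‖ ^ 2) (fun _ _ => sq_nonneg _)
    (Finset.mem_univ i)

theorem norm_le_sum_norm_col {l r : ℕ} (A : Matrix (Fin l) (Fin r) ℝ) : ‖A‖ ≤ ∑ i, ‖col A i‖ := by
  apply le_of_sq_le_sq _ (Finset.sum_nonneg fun _ _ => norm_nonneg _)
  rw [norm_sq_eq_sum_col]
  exact Finset.sum_sq_le_sq_sum_of_nonneg fun _ _ => norm_nonneg _

theorem col_ext {l r : ℕ} {A B : Matrix (Fin l) (Fin r) ℝ} (h : ∀ i, col A i = col B i) :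
    A = B := by
  ext a i
  exact congrFun (congrArg WithLp.ofLp (h i)) a

theorem norm_col_mul_le {l p r : ℕ} (A : Matrix (Fin l) (Fin p) ℝ) (B : Matrix (Fin p) (Fin r) ℝ)
    (i : Fin r) : ‖col (A * B) i‖ ≤ ‖A‖ * ‖col B i‖ := by
  have h1 : ∀ {q : ℕ} (C : Matrix (Fin q) (Fin r) ℝ),
      ‖C.submatrix id (fun _ : Fin 1 => i)‖ = ‖col C i‖ := by
    intro q C
    rw [← sq_eq_sq₀ (norm_nonneg _) (norm_nonneg _), norm_sq_eq_sum_col]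
    simp
    rfl
  rw [← h1, ← h1]
  exact norm_mul_le_frob A (B.submatrix id (fun _ : Fin 1 => i))

theorem norm_sq_mul_transpose {p l r : ℕ} {A : Matrix (Fin p) (Fin r) ℝ} {d : Fin r → ℝ}
    (hA : Aᵀ * A = Matrix.diagonal d) (W : Matrix (Fin l) (Fin r) ℝ) :
    ‖W * Aᵀ‖ ^ 2 = ∑ i, d i * ‖col W i‖ ^ 2 := by
  rw [← frob_self, frob_mul_right, Matrix.transpose_transpose, Matrix.mul_assoc, hA,
    frob_eq_sum_inner_col]
  refine Finset.sum_congr rfl fun i _ => ?_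
  have : col (W * Matrix.diagonal d) i = d i • col W i := by
    ext a
    simp [col_apply, Matrix.mul_diagonal, mul_comm]
  rw [this, inner_smul_right, real_inner_self_eq_norm_sq]

/-- Changing a single column leaves the other summands fixed, so a minimizer of a separable sum
minimizes each summand. -/
theorem column_minimizer {l r : ℕ} {F : Fin r → EuclideanSpace ℝ (Fin l) → ℝ}
    {W : Matrix (Fin l) (Fin r) ℝ}
    (h : ∀ W' : Matrix (Fin l) (Fin r) ℝ, ∑ i, F i (col W i) ≤ ∑ i, F i (col W' i)) (i : Fin r)
    (x : EuclideanSpace ℝ (Fin l)) : F i (col W i) ≤ F i x := by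
  have h1 := h (W.updateCol i x)
  have hc : ∀ j, col (W.updateCol i x) j = if j = i then x else col W j := by
    intro j
    ext a
    by_cases hj : j = i
    · subst hj; simp [col_apply]
    · simp [col_apply, hj]
  rw [← Finset.sum_erase_add _ _ (Finset.mem_univ i),
    ← Finset.sum_erase_add (f := fun j => F j (col (W.updateCol i x) j)) (h := Finset.mem_univ i)]
    at h1
  have h2 : ∑ j ∈ Finset.univ.erase i, F j (col (W.updateCol i x) j) =
      ∑ j ∈ Finset.univ.erase i, F j (col W j) :=
    Finset.sum_congr rfl fun j hj => by rw [hc, if_neg (Finset.ne_of_mem_erase hj)]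
  rw [h2, hc, if_pos rfl] at h1
  linarith

/-! ### The proximal step on one column -/

section Column

variable {E : Type*} [NormedAddCommGroup E] [InnerProductSpace ℝ E]

/-- The gradient of `x ↦ θ(‖x‖)` away from the origin. -/
def radial (θ : ℝ → EReal) (x : E) : E := (penaltyDeriv θ ‖x‖ / ‖x‖) • x

theorem radial_zero (θ : ℝ → EReal) : radial θ (0 : E) = 0 := smul_zero _

theorem radial_sign (θ : ℝ → EReal) {ε : ℝ} (hε : ε = 1 ∨ ε = -1) (x : E) :
    radial θ (ε • x) = ε • radial θ x := by
  rcases hε with rfl | rfl <;> simp [radial]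

theorem hasFDerivAt_norm_of_ne_zero {x : E} (hx : x ≠ 0) :
    HasFDerivAt (fun y : E => ‖y‖) (‖x‖⁻¹ • innerSL ℝ x) x := by
  have h := ((hasStrictFDerivAt_norm_sq x).hasFDerivAt).sqrt
    (pow_ne_zero 2 (norm_ne_zero_iff.2 hx))
  simp only [Real.sqrt_sq (norm_nonneg _)] at h
  convert h using 1
  ext y
  simp
  have := norm_ne_zero_iff.2 hx
  field_simp

theorem IsPenalty.hasFDerivAt_pen_norm {θ : ℝ → EReal} (hθ : IsPenalty θ) {x : E} (hx : x ≠ 0) :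
    HasFDerivAt (fun y : E => pen θ ‖y‖) (innerSL ℝ (radial θ x)) x := by
  have h := (hθ.hasDerivAt_pen (norm_pos_iff.2 hx)).comp_hasFDerivAt x
    (hasFDerivAt_norm_of_ne_zero hx)
  refine h.congr_fderiv ?_
  rw [radial, map_smul, smul_smul, div_eq_mul_inv]

/-- The function minimized by one column in a step of the algorithm. -/
def columnObjective (θ : ℝ → EReal) (lam mu a : ℝ) (g w₀ x : E) : ℝ :=
  inner ℝ g x + a / 2 * ‖x - w₀‖ ^ 2 + mu / 2 * ‖x‖ ^ 2 + lam * pen θ ‖x‖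

theorem IsPenalty.column_stationary {θ : ℝ → EReal} (hθ : IsPenalty θ) {lam mu a : ℝ} {g w₀ x : E}
    (h : ∀ y, columnObjective θ lam mu a g w₀ x ≤ columnObjective θ lam mu a g w₀ y)
    (hx : x ≠ 0) : g + a • (x - w₀) + mu • x + lam • radial θ x = 0 := by
  have h1 : HasFDerivAt (fun y : E => inner ℝ g y) (innerSL ℝ g) x := (innerSL ℝ g).hasFDerivAt
  have h2 : HasFDerivAt (fun y : E => ‖y - w₀‖ ^ 2) (2 • innerSL ℝ (x - w₀)) x := by
    have := (hasStrictFDerivAt_norm_sq (x - w₀)).hasFDerivAt.comp x ((hasFDerivAt_id x).sub_const w₀)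
    rwa [ContinuousLinearMap.comp_id] at this
  have h3 := (hasStrictFDerivAt_norm_sq x).hasFDerivAt
  have h4 := hθ.hasFDerivAt_pen_norm hx
  have h5 := ((h1.add (h2.const_mul (a / 2))).add (h3.const_mul (mu / 2))).add (h4.const_mul lam)
  have hmin : IsLocalMin (columnObjective θ lam mu a g w₀) x := Filter.Eventually.of_forall h
  have h6 := hmin.hasFDerivAt_eq_zero h5
  -- The vanishing derivative is tested in the direction of the claimed gradient, giving its squared
  -- norm.
  have h7 := congrArg (fun L : E →L[ℝ] ℝ => L (g + a • (x - w₀) + mu • x + lam • radial θ x)) h6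
  rw [← inner_self_eq_zero (𝕜 := ℝ)]
  refine Eq.trans ?_ h7
  simp only [_root_.add_apply, _root_.smul_apply, innerSL_apply_apply,
    inner_add_left (g + a • (x - w₀) + mu • x), inner_add_left (g + a • (x - w₀)),
    inner_add_left g, inner_smul_left, smul_eq_mul, nsmul_eq_mul]
  simp
  ring

/-- Completing the square centres the quadratic at z. The radial problem bounds the vector problem
from below since |‖z‖ − ‖x‖| ≤ ‖z − x‖, and vectors collinear with z attain this bound. -/
theorem column_norm_mem_prox {θ : ℝ → EReal} {lam mu a : ℝ}
    (hpos : 0 < a + mu) {g w₀ x : E}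
    (h : ∀ y, columnObjective θ lam mu a g w₀ x ≤ columnObjective θ lam mu a g w₀ y)
    (hx : x ≠ 0) : ∃ t, 0 ≤ t ∧ ∀ y, 0 ≤ y →
      (a + mu) / 2 * (t - ‖x‖) ^ 2 + lam * pen θ ‖x‖ ≤
      (a + mu) / 2 * (t - y) ^ 2 + lam * pen θ y := by
  set z : E := (a + mu)⁻¹ • (a • w₀ - g) with hz
  have key : ∀ y, columnObjective θ lam mu a g w₀ y =
      (a + mu) / 2 * ‖y - z‖ ^ 2 + lam * pen θ ‖y‖ +
        (a / 2 * ‖w₀‖ ^ 2 - (a + mu) / 2 * ‖z‖ ^ 2) := by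
    intro y
    have hzy : inner ℝ y z = (a + mu)⁻¹ * (a * inner ℝ y w₀ - inner ℝ y g) := by
      rw [hz, inner_smul_right, inner_sub_right, inner_smul_right]
    rw [columnObjective, norm_sub_sq_real, norm_sub_sq_real, hzy, real_inner_comm]
    field_simp
    ring
  refine ⟨‖z‖, norm_nonneg z, fun y hy => ?_⟩
  have h1 : (‖z‖ - ‖x‖) ^ 2 ≤ ‖x - z‖ ^ 2 := by
    rw [← sq_abs]
    refine pow_le_pow_left₀ (abs_nonneg _) ?_ 2
    rw [norm_sub_rev]
    exact abs_norm_sub_norm_le z x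
  -- If z = 0 every direction is optimal, and the direction of x is at hand.
  have h2 : ∃ w : E, ‖w‖ = y ∧ ‖w - z‖ ^ 2 = (‖z‖ - y) ^ 2 := by
    by_cases hz0 : z = 0
    · refine ⟨(y / ‖x‖) • x, ?_, ?_⟩
      · rw [norm_smul, Real.norm_of_nonneg (by positivity),
          div_mul_cancel₀ _ (norm_ne_zero_iff.2 hx)]
      · rw [hz0, sub_zero, norm_smul, Real.norm_of_nonneg (by positivity),
          div_mul_cancel₀ _ (norm_ne_zero_iff.2 hx)]
        simp
    · have hzn := norm_ne_zero_iff.2 hz0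
      refine ⟨(y / ‖z‖) • z, ?_, ?_⟩
      · rw [norm_smul, Real.norm_of_nonneg (by positivity), div_mul_cancel₀ _ hzn]
      · have : (y / ‖z‖) • z - z = (y / ‖z‖ - 1) • z := by rw [sub_smul, one_smul]
        rw [this, norm_smul, mul_pow, Real.norm_eq_abs, sq_abs]
        field_simp
        ring
  obtain ⟨w, hw1, hw2⟩ := h2
  have h3 := h w
  rw [key, key, hw1, hw2] at h3
  have h4 := mul_le_mul_of_nonneg_left h1 (by positivity : 0 ≤ (a + mu) / 2)
  linarith

/-- With no linear term and starting point 0, all summands are nonnegative and vanish at the origin,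
while the penalty is strictly positive elsewhere. -/
theorem IsPenalty.column_eq_zero {θ : ℝ → EReal} (hθ : IsPenalty θ) {lam mu a : ℝ}
    (hlam : 0 < lam) (hmu : 0 < mu) (ha : 0 ≤ a) {x : E}
    (h : ∀ y : E, columnObjective θ lam mu a 0 0 x ≤ columnObjective θ lam mu a 0 0 y) : x = 0 := by
  by_contra hx
  have h1 := h (0 : E)
  have h2 := hθ.pen_pos (norm_pos_iff.2 hx)
  simp only [columnObjective, inner_zero_left, sub_zero, norm_zero, hθ.pen_zero] at h1
  have : 0 < lam * pen θ ‖x‖ := mul_pos hlam h2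
  have : 0 ≤ a / 2 * ‖x‖ ^ 2 := by positivity
  have : 0 ≤ mu / 2 * ‖x‖ ^ 2 := by positivity
  simp at h1
  linarith

end Column

theorem IsPenalty.mem_prox {θ : ℝ → EReal} (hθ : IsPenalty θ) {γ t x : ℝ} (hx : 0 ≤ x)
    (h : ∀ y, 0 ≤ y → 1 / (2 * γ) * (t - x) ^ 2 + pen θ x ≤ 1 / (2 * γ) * (t - y) ^ 2 + pen θ y) :
    x ∈ prox γ θ t := by
  intro y
  rcases le_or_gt 0 y with hy | hy
  · rw [← hθ.coe_pen hx, ← hθ.coe_pen hy]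
    exact_mod_cast h y hy
  · rw [hθ.top_of_neg y hy, EReal.coe_add_top]
    exact le_top

/-- A lower bound for the nonzero elements of the proximal mapping with the smallest parameter
serves all larger parameters. -/
theorem IsPenalty.exists_prox_gap {θ : ℝ → EReal} (hθ : IsPenalty θ) {a b : ℝ} (hab : a ≤ b)
    (ha : 0 < a) (h : ProxGap θ a b) : ∃ c : ℝ, 0 < c ∧ ∀ γ, a ≤ γ → ∀ t, 0 ≤ t → ∀ x, 0 < x →
      (∀ y, 0 ≤ y →
        1 / (2 * γ) * (t - x) ^ 2 + pen θ x ≤ 1 / (2 * γ) * (t - y) ^ 2 + pen θ y) → c ≤ x := by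
  obtain ⟨c, hc, hcx⟩ := h a le_rfl hab
  refine ⟨c, hc, fun γ hγ t ht x hx hmin => ?_⟩
  have hγ0 : 0 < γ := ha.trans_le hγ
  -- Moving t towards x in this proportion makes the two quadratics, normalized at x, differ by a
  -- nonnegative multiple of (y − x)². Thus x remains a minimizer for the smallest parameter.
  set t' := a / γ * t + (1 - a / γ) * x with ht'
  have h1 : 0 ≤ 1 - a / γ := by
    rw [sub_nonneg, div_le_one hγ0]
    exact hγ
  refine (hcx t' (by positivity) x (hθ.mem_prox hx.le fun y hy => ?_)).resolve_left hx.ne'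
  have h2 := hmin y hy
  have h3 : 1 / (2 * a) * (t' - y) ^ 2 - 1 / (2 * a) * (t' - x) ^ 2 =
      1 / (2 * γ) * (t - y) ^ 2 - 1 / (2 * γ) * (t - x) ^ 2 +
        (1 / (2 * a) - 1 / (2 * γ)) * (y - x) ^ 2 := by
    rw [ht']
    field_simp
    ring
  have h4 : 0 ≤ (1 / (2 * a) - 1 / (2 * γ)) * (y - x) ^ 2 := by
    apply mul_nonneg _ (sq_nonneg _)
    rw [sub_nonneg]
    exact one_div_le_one_div_of_le (by positivity) (by linarith)
  linarith

/-! ### The descent lemma -/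

theorem frob_matGrad {n m : ℕ} (f : Matrix (Fin n) (Fin m) ℝ → ℝ) (X H : Matrix (Fin n) (Fin m) ℝ) :
    frob (matGrad f X) H = fderiv ℝ f X H := by
  conv_rhs => rw [Matrix.matrix_eq_sum_single H]
  rw [frob_eq_sum, map_sum]
  refine Finset.sum_congr rfl fun i _ => ?_
  rw [map_sum]
  refine Finset.sum_congr rfl fun j _ => ?_
  have : Matrix.single i j (H i j) = H i j • Matrix.single i j (1 : ℝ) := by
    rw [Matrix.smul_single, smul_eq_mul, mul_one]
  rw [this, map_smul, smul_eq_mul, mul_comm]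
  rfl

/-- Along the segment, the linearization error minus its quadratic bound has nonpositive derivative.
Both signs matter: the upper bound gives the majorization, the lower one the subgradient inequality.
-/
theorem abs_sub_linear_le {n m : ℕ} {f : Matrix (Fin n) (Fin m) ℝ → ℝ} {Lf : ℝ≥0}
    (hf : Differentiable ℝ f) (hL : LipschitzWith Lf (matGrad f)) (X H : Matrix (Fin n) (Fin m) ℝ) :
    |f (X + H) - f X - frob (matGrad f X) H| ≤ Lf / 2 * ‖H‖ ^ 2 := by
  have hd : ∀ t : ℝ, HasDerivAt (fun t : ℝ => f (X + t • H)) (frob (matGrad f (X + t • H)) H) t := by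
    intro t
    rw [frob_matGrad]
    have h1 : HasDerivAt (fun t : ℝ => X + t • H) H t := by
      have := ((hasDerivAt_id t).smul_const H).const_add X
      rw [one_smul] at this
      exact this
    exact (hf (X + t • H)).hasFDerivAt.comp_hasDerivAt t h1
  have hb : ∀ t : ℝ, 0 ≤ t →
      |frob (matGrad f (X + t • H)) H - frob (matGrad f X) H| ≤ Lf * t * ‖H‖ ^ 2 := by
    intro t ht
    rw [← frob_sub_left]
    refine (abs_frob_le _ _).trans ?_
    have h1 := hL.dist_le_mul (X + t • H) X
    rw [dist_eq_norm, dist_eq_norm, add_sub_cancel_left, norm_smul, Real.norm_of_nonneg ht] at h1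
    calc _ ≤ Lf * (t * ‖H‖) * ‖H‖ := mul_le_mul_of_nonneg_right h1 (norm_nonneg _)
      _ = _ := by ring
  have mono : ∀ s : ℝ, (s = 1 ∨ s = -1) →
      s * (f (X + H) - f X - frob (matGrad f X) H) ≤ Lf / 2 * ‖H‖ ^ 2 := by
    intro s hs
    set g : ℝ → ℝ := fun t => s * (f (X + t • H) - t * frob (matGrad f X) H) -
      Lf / 2 * t ^ 2 * ‖H‖ ^ 2 with hg
    have hgd : ∀ t, HasDerivAt g (s * (frob (matGrad f (X + t • H)) H - frob (matGrad f X) H) -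
        Lf * t * ‖H‖ ^ 2) t := by
      intro t
      have h1 := ((hd t).sub ((hasDerivAt_id t).mul_const (frob (matGrad f X) H))).const_mul s
      have h2 := (((hasDerivAt_id t).pow 2).const_mul ((Lf : ℝ) / 2)).mul_const (‖H‖ ^ 2)
      refine (h1.sub h2).congr_deriv ?_
      push_cast
      simp only [id]
      ring
    have hanti : AntitoneOn g (Set.Icc 0 1) := by
      apply antitoneOn_of_deriv_nonpos (convex_Icc 0 1)
      · exact fun t _ => (hgd t).continuousAt.continuousWithinAt
      · exact fun t _ => (hgd t).differentiableAt.differentiableWithinAt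
      · intro t ht
        rw [interior_Icc] at ht
        rw [(hgd t).deriv]
        have h1 := abs_le.1 (hb t ht.1.le)
        rcases hs with rfl | rfl <;> linarith [h1.1, h1.2]
    have := hanti (by simp) (by simp) zero_le_one
    simp only [hg] at this
    simp at this
    linarith
  rw [abs_le]
  constructor
  · have := mono (-1) (Or.inr rfl)
    linarith
  · have := mono 1 (Or.inl rfl)
    linarith

theorem le_majorF {n m r : ℕ} {f : Matrix (Fin n) (Fin m) ℝ → ℝ} {Lf : ℝ≥0}
    (hf : Differentiable ℝ f) (hL : LipschitzWith Lf (matGrad f))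
    (U U' : Matrix (Fin n) (Fin r) ℝ) (V V' : Matrix (Fin m) (Fin r) ℝ) :
    f (U * Vᵀ) ≤ majorF f Lf U V U' V' := by
  have h := (abs_le.1 (abs_sub_linear_le hf hL (U' * V'ᵀ) (U * Vᵀ - U' * V'ᵀ))).2
  rw [add_sub_cancel] at h
  have : majorF f Lf U V U' V' = f (U' * V'ᵀ) + frob (matGrad f (U' * V'ᵀ)) (U * Vᵀ - U' * V'ᵀ) +
    Lf / 2 * ‖U * Vᵀ - U' * V'ᵀ‖ ^ 2 := rfl
  rw [this]
  linarith

theorem majorF_self {n m r : ℕ} (f : Matrix (Fin n) (Fin m) ℝ → ℝ) (Lf : ℝ)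
    (U : Matrix (Fin n) (Fin r) ℝ) (V : Matrix (Fin m) (Fin r) ℝ) :
    majorF f Lf U V U V = f (U * Vᵀ) := by
  simp [majorF]

end

end PAMA

namespace PAMA

noncomputable section

/-! ### First-order lower bounds -/

section LowerBound

variable {E F : Type*} [NormedAddCommGroup E] [NormedAddCommGroup F]

/-- `ℓ` supports `h` to first order at `x`. -/
def SupportsAt (h : E → ℝ) (ℓ : E → ℝ) (x : E) : Prop :=
  ∀ ε : ℝ, 0 < ε → ∀ᶠ x' in 𝓝 x, h x + ℓ (x' - x) - ε * ‖x' - x‖ ≤ h x'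

theorem SupportsAt.add {h₁ h₂ ℓ₁ ℓ₂ : E → ℝ} {x : E} (H₁ : SupportsAt h₁ ℓ₁ x)
    (H₂ : SupportsAt h₂ ℓ₂ x) :
    SupportsAt (fun y => h₁ y + h₂ y) (fun y => ℓ₁ y + ℓ₂ y) x := by
  intro ε hε
  filter_upwards [H₁ (ε / 2) (by positivity), H₂ (ε / 2) (by positivity)] with y h1 h2
  linarith

theorem SupportsAt.const_mul {h ℓ : E → ℝ} {x : E} (H : SupportsAt h ℓ x) {c : ℝ} (hc : 0 < c) :
    SupportsAt (fun y => c * h y) (fun y => c * ℓ y) x := by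
  intro ε hε
  filter_upwards [H (ε / c) (by positivity)] with y h1
  have h2 := mul_le_mul_of_nonneg_left h1 hc.le
  have h3 : c * (ε / c * ‖y - x‖) = ε * ‖y - x‖ := by field_simp
  linarith

theorem SupportsAt.sum {ι : Type*} {h ℓ : ι → E → ℝ} {x : E} (s : Finset ι)
    (H : ∀ i, SupportsAt (h i) (ℓ i) x) :
    SupportsAt (fun y => ∑ i ∈ s, h i y) (fun y => ∑ i ∈ s, ℓ i y) x := by
  classical
  induction s using Finset.induction_on with
  | empty =>
    intro ε hε
    refine Filter.Eventually.of_forall fun y => ?_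
    have : 0 ≤ ε * ‖y - x‖ := by positivity
    simpa using this
  | insert i s hi ih =>
    simp only [Finset.sum_insert hi]
    exact (H i).add ih

theorem SupportsAt.comp {h ℓ : F → ℝ} {L : E → F} {x : E} (H : SupportsAt h ℓ (L x))
    (hL : ∀ y, L y - L x = L (y - x)) (hn : ∀ y, ‖L y‖ ≤ ‖y‖) :
    SupportsAt (fun y => h (L y)) (fun y => ℓ (L y)) x := by
  intro ε hε
  have hc : Tendsto L (𝓝 x) (𝓝 (L x)) := by
    rw [tendsto_iff_norm_sub_tendsto_zero]
    refine squeeze_zero (fun _ => norm_nonneg _) (fun y => ?_)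
      (tendsto_iff_norm_sub_tendsto_zero.1 (tendsto_id (x := 𝓝 x)))
    rw [hL]
    exact hn _
  filter_upwards [hc.eventually (H ε hε)] with y h1
  rw [hL] at h1
  have := mul_le_mul_of_nonneg_left (hn (y - x)) hε.le
  linarith

/-- A quadratic error is eventually below ε‖y − x‖, namely on the ball of radius ε/(C + 1). -/
theorem supportsAt_of_sq {h ℓ : E → ℝ} {x : E} {C : ℝ} (hC : 0 ≤ C)
    (H : ∀ y, ‖y‖ ≤ 1 → h x + ℓ y - C * ‖y‖ ^ 2 ≤ h (x + y)) : SupportsAt h ℓ x := by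
  intro ε hε
  have hpos : 0 < min 1 (ε / (C + 1)) := by positivity
  filter_upwards [Metric.closedBall_mem_nhds x hpos] with y hy
  rw [Metric.mem_closedBall, dist_eq_norm] at hy
  have h1 := H (y - x) (hy.trans (min_le_left _ _))
  rw [add_sub_cancel] at h1
  have h2 : ‖y - x‖ * (C + 1) ≤ ε := by
    have := hy.trans (min_le_right _ _)
    rwa [le_div_iff₀ (by positivity)] at this
  have h3 : C * ‖y - x‖ ^ 2 ≤ ε * ‖y - x‖ := by
    nlinarith [norm_nonneg (y - x), mul_le_mul_of_nonneg_right h2 (norm_nonneg (y - x)),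
      sq_nonneg ‖y - x‖]
  linarith

end LowerBound

/-- At the origin the zero functional supports because the penalty is nonnegative and vanishes
there; no differentiability, nor even continuity, at 0 enters. -/
theorem IsPenalty.supportsAt_pen_norm {E : Type*} [NormedAddCommGroup E] [InnerProductSpace ℝ E]
    {θ : ℝ → EReal} (hθ : IsPenalty θ) (x : E) :
    SupportsAt (fun y : E => pen θ ‖y‖) (fun y => inner ℝ (radial θ x) y) x := by
  intro ε hε
  by_cases hx : x = 0
  · subst hx
    refine Filter.Eventually.of_forall fun y => ?_
    have h1 : 0 ≤ ε * ‖y - 0‖ := by positivity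
    have h2 := hθ.pen_nonneg (norm_nonneg y)
    simp only [radial_zero, inner_zero_left, norm_zero, hθ.pen_zero]
    linarith
  · have h := (hθ.hasFDerivAt_pen_norm hx).isLittleO.def hε
    filter_upwards [h] with y hy
    have := (abs_le.1 hy).1
    simp only [innerSL_apply_apply] at this
    linarith

/-! ### A subgradient of the objective -/

section Objective

variable {n m r : ℕ}

/-- The first factor of a pair. -/
def topMat (x : FactorSpace n m r) : Matrix (Fin n) (Fin r) ℝ := Matrix.of fun a i => x (Sum.inl a, i)

/-- The second factor of a pair. -/
def botMat (x : FactorSpace n m r) : Matrix (Fin m) (Fin r) ℝ := Matrix.of fun b i => x (Sum.inr b, i)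

theorem stack_topMat_botMat (x : FactorSpace n m r) : stack (topMat x) (botMat x) = x := by
  ext ⟨a | b, i⟩ <;> rfl

theorem inner_stack (A : Matrix (Fin n) (Fin r) ℝ) (B : Matrix (Fin m) (Fin r) ℝ)
    (x : FactorSpace n m r) : inner ℝ (stack A B) x = frob A (topMat x) + frob B (botMat x) := by
  rw [PiLp.inner_apply, Fintype.sum_prod_type, Fintype.sum_sum_type, frob_eq_sum, frob_eq_sum]
  simp [stack, topMat, botMat, mul_comm]

theorem norm_sq_factor (x : FactorSpace n m r) : ‖x‖ ^ 2 = ‖topMat x‖ ^ 2 + ‖botMat x‖ ^ 2 := by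
  rw [← real_inner_self_eq_norm_sq, ← frob_self, ← frob_self, ← inner_stack, stack_topMat_botMat]

theorem norm_topMat_le (x : FactorSpace n m r) : ‖topMat x‖ ≤ ‖x‖ := by
  apply le_of_sq_le_sq _ (norm_nonneg _)
  rw [norm_sq_factor]
  linarith [sq_nonneg ‖botMat x‖]

theorem norm_botMat_le (x : FactorSpace n m r) : ‖botMat x‖ ≤ ‖x‖ := by
  apply le_of_sq_le_sq _ (norm_nonneg _)
  rw [norm_sq_factor]
  linarith [sq_nonneg ‖topMat x‖]

theorem norm_factor_le (x : FactorSpace n m r) : ‖x‖ ≤ ‖topMat x‖ + ‖botMat x‖ := by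
  apply le_of_sq_le_sq _ (by positivity)
  rw [norm_sq_factor]
  nlinarith [mul_nonneg (norm_nonneg (topMat x)) (norm_nonneg (botMat x))]

theorem stack_sub (U U' : Matrix (Fin n) (Fin r) ℝ) (V V' : Matrix (Fin m) (Fin r) ℝ) :
    stack U V - stack U' V' = stack (U - U') (V - V') := by
  ext ⟨a | b, i⟩ <;> rfl

theorem norm_stack_le (U : Matrix (Fin n) (Fin r) ℝ) (V : Matrix (Fin m) (Fin r) ℝ) :
    ‖stack U V‖ ≤ ‖U‖ + ‖V‖ := norm_factor_le _

/-- The columnwise gradient of the penalty. -/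
def radialMat (θ : ℝ → EReal) {l : ℕ} (W : Matrix (Fin l) (Fin r) ℝ) : Matrix (Fin l) (Fin r) ℝ :=
  Matrix.of fun a i => radial θ (col W i) a

theorem col_radialMat (θ : ℝ → EReal) {l : ℕ} (W : Matrix (Fin l) (Fin r) ℝ) (i : Fin r) :
    col (radialMat θ W) i = radial θ (col W i) := rfl

/-- The first component of a subgradient of the objective. -/
def gradTop (f : Matrix (Fin n) (Fin m) ℝ → ℝ) (θ : ℝ → EReal) (lam mu : ℝ)
    (U : Matrix (Fin n) (Fin r) ℝ) (V : Matrix (Fin m) (Fin r) ℝ) : Matrix (Fin n) (Fin r) ℝ :=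
  matGrad f (U * Vᵀ) * V + mu • U + lam • radialMat θ U

/-- The second component of a subgradient of the objective. -/
def gradBot (f : Matrix (Fin n) (Fin m) ℝ → ℝ) (θ : ℝ → EReal) (lam mu : ℝ)
    (U : Matrix (Fin n) (Fin r) ℝ) (V : Matrix (Fin m) (Fin r) ℝ) : Matrix (Fin m) (Fin r) ℝ :=
  (matGrad f (U * Vᵀ))ᵀ * U + mu • V + lam • radialMat θ V

/-- The product map is bilinear, so its remainder dU dVᵀ is quadratic and joins the quadratic error
of the descent lemma. -/
theorem supportsAt_smooth {f : Matrix (Fin n) (Fin m) ℝ → ℝ} {Lf : ℝ≥0}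
    (hf : Differentiable ℝ f) (hL : LipschitzWith Lf (matGrad f)) (x : FactorSpace n m r) :
    SupportsAt (fun y : FactorSpace n m r => f (topMat y * (botMat y)ᵀ))
      (fun y => frob (matGrad f (topMat x * (botMat x)ᵀ) * botMat x) (topMat y) +
        frob ((matGrad f (topMat x * (botMat x)ᵀ))ᵀ * topMat x) (botMat y)) x := by
  set G := matGrad f (topMat x * (botMat x)ᵀ) with hG
  refine supportsAt_of_sq (C := ‖G‖ + Lf / 2 * (‖topMat x‖ + ‖botMat x‖ + 1) ^ 2) (by positivity) ?_
  intro y hy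
  set U := topMat x
  set V := botMat x
  set dU := topMat y
  set dV := botMat y
  set H := dU * Vᵀ + U * dVᵀ + dU * dVᵀ with hH
  have e1 : topMat (x + y) * (botMat (x + y))ᵀ = U * Vᵀ + H := by
    have h1 : topMat (x + y) = U + dU := rfl
    have h2 : botMat (x + y) = V + dV := rfl
    rw [h1, h2, Matrix.transpose_add, Matrix.add_mul, Matrix.mul_add, Matrix.mul_add, hH]
    abel
  have h1 := (abs_le.1 (abs_sub_linear_le hf hL (U * Vᵀ) H)).1
  have e2 : frob G H = frob (G * V) dU + frob (Gᵀ * U) dV + frob G (dU * dVᵀ) := by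
    rw [hH, frob_add_right, frob_add_right, frob_mul_right, frob_mul_left, frob_comm G (U * dVᵀ),
      frob_mul_right U, Matrix.transpose_transpose, Matrix.transpose_transpose]
  have hdU : ‖dU‖ ≤ ‖y‖ := norm_topMat_le y
  have hdV : ‖dV‖ ≤ ‖y‖ := norm_botMat_le y
  have n1 : ‖dU * dVᵀ‖ ≤ ‖y‖ * ‖y‖ := (norm_mul_le_frob _ _).trans (by
    rw [norm_transpose_frob]
    exact mul_le_mul hdU hdV (norm_nonneg _) (norm_nonneg _))
  have n2 : ‖dU * Vᵀ‖ ≤ ‖y‖ * ‖V‖ := (norm_mul_le_frob _ _).trans (by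
    rw [norm_transpose_frob]
    exact mul_le_mul_of_nonneg_right hdU (norm_nonneg _))
  have n3 : ‖U * dVᵀ‖ ≤ ‖U‖ * ‖y‖ := (norm_mul_le_frob _ _).trans (by
    rw [norm_transpose_frob]
    exact mul_le_mul_of_nonneg_left hdV (norm_nonneg _))
  have n4 : ‖H‖ ≤ (‖U‖ + ‖V‖ + 1) * ‖y‖ := by
    refine (norm_add_le _ _).trans ?_
    have := norm_add_le (dU * Vᵀ) (U * dVᵀ)
    nlinarith [norm_nonneg y]
  have n5 : ‖H‖ ^ 2 ≤ (‖U‖ + ‖V‖ + 1) ^ 2 * ‖y‖ ^ 2 := by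
    rw [← mul_pow]
    exact pow_le_pow_left₀ (norm_nonneg _) n4 2
  have n6 : -(‖G‖ * ‖y‖ ^ 2) ≤ frob G (dU * dVᵀ) := by
    have := (abs_le.1 (abs_frob_le G (dU * dVᵀ))).1
    have := mul_le_mul_of_nonneg_left n1 (norm_nonneg G)
    nlinarith
  have n7 := mul_le_mul_of_nonneg_left n5 (by positivity : (0 : ℝ) ≤ Lf / 2)
  simp only [e1]
  rw [← hG, e2] at h1
  change f (U * Vᵀ) + _ - _ ≤ _
  nlinarith

theorem supportsAt_sq_norm (x : FactorSpace n m r) :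
    SupportsAt (fun y : FactorSpace n m r => ‖topMat y‖ ^ 2 + ‖botMat y‖ ^ 2)
      (fun y => 2 * (frob (topMat x) (topMat y) + frob (botMat x) (botMat y))) x := by
  refine supportsAt_of_sq (C := 0) le_rfl fun y _ => ?_
  have h1 : topMat (x + y) = topMat x + topMat y := rfl
  have h2 : botMat (x + y) = botMat x + botMat y := rfl
  rw [h1, h2, norm_add_sq_frob, norm_add_sq_frob]
  nlinarith [sq_nonneg ‖topMat y‖, sq_nonneg ‖botMat y‖]

theorem IsPenalty.supportsAt_penSum {θ : ℝ → EReal} (hθ : IsPenalty θ) {l : ℕ}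
    (W : Matrix (Fin l) (Fin r) ℝ) :
    SupportsAt (fun Y : Matrix (Fin l) (Fin r) ℝ => penSum θ Y)
      (fun Y => frob (radialMat θ W) Y) W := by
  simp only [frob_eq_sum_inner_col]
  refine SupportsAt.sum Finset.univ fun i => ?_
  exact (hθ.supportsAt_pen_norm (col W i)).comp (L := fun Y : Matrix (Fin l) (Fin r) ℝ => col Y i)
    (fun _ => rfl) fun Y => norm_col_le Y i

/-- An explicit subgradient of the objective; it is available at every point, also where columns
vanish. -/
theorem IsPenalty.stack_mem_subdifferential {θ : ℝ → EReal} (hθ : IsPenalty θ)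
    {f : Matrix (Fin n) (Fin m) ℝ → ℝ} {Lf : ℝ≥0} (hf : Differentiable ℝ f)
    (hL : LipschitzWith Lf (matGrad f)) {lam mu : ℝ} (hlam : 0 < lam) (hmu : 0 < mu)
    (U : Matrix (Fin n) (Fin r) ℝ) (V : Matrix (Fin m) (Fin r) ℝ) :
    stack (gradTop f θ lam mu U V) (gradBot f θ lam mu U V) ∈
      subdifferential (objectiveOn f θ lam mu) (stack U V) := by
  have hval : ∀ x : FactorSpace n m r, objectiveOn f θ lam mu x =
      ((objR f θ lam mu (topMat x) (botMat x) : ℝ) : EReal) := fun x =>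
    hθ.objective_eq f lam mu _ _
  have hsup : SupportsAt (fun y : FactorSpace n m r => objR f θ lam mu (topMat y) (botMat y))
      (fun y => inner ℝ (stack (gradTop f θ lam mu U V) (gradBot f θ lam mu U V)) y)
      (stack U V) := by
    have h1 := supportsAt_smooth (r := r) hf hL (stack U V)
    have h2 := (hθ.supportsAt_penSum (topMat (stack U V))).comp
      (L := fun y : FactorSpace n m r => topMat y) (fun _ => rfl) norm_topMat_le
    have h3 := (hθ.supportsAt_penSum (botMat (stack U V))).comp
      (L := fun y : FactorSpace n m r => botMat y) (fun _ => rfl) norm_botMat_le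
    have h4 := (supportsAt_sq_norm (stack U V)).const_mul (half_pos hmu)
    have h5 := (h1.add ((h2.add h3).const_mul hlam)).add h4
    intro ε hε
    filter_upwards [h5 ε hε] with y hy
    have e : ∀ z : FactorSpace n m r,
        inner ℝ (stack (gradTop f θ lam mu U V) (gradBot f θ lam mu U V)) z =
        frob (matGrad f (U * Vᵀ) * V) (topMat z) + frob ((matGrad f (U * Vᵀ))ᵀ * U) (botMat z) +
        lam * (frob (radialMat θ U) (topMat z) + frob (radialMat θ V) (botMat z)) +
        mu / 2 * (2 * (frob U (topMat z) + frob V (botMat z))) := by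
      intro z
      rw [inner_stack, gradTop, gradBot]
      simp only [frob_add_left, frob_comm (_ • _), frob_smul_right]
      rw [frob_comm (topMat z) U, frob_comm (botMat z) V, frob_comm (topMat z) (radialMat θ U),
        frob_comm (botMat z) (radialMat θ V)]
      ring
    rw [e]
    exact hy
  have hreg : stack (gradTop f θ lam mu U V) (gradBot f θ lam mu U V) ∈
      regularSubdifferential (objectiveOn f θ lam mu) (stack U V) := by
    refine ⟨by rw [hval]; exact EReal.coe_ne_top _, by rw [hval]; exact EReal.coe_ne_bot _, ?_⟩
    intro ε hε
    filter_upwards [hsup ε hε] with y hy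
    rw [hval, hval, ← EReal.coe_add, EReal.coe_le_coe_iff]
    linarith
  -- Constant sequences exhibit a regular subgradient as a limiting one.
  exact ⟨hreg.1, hreg.2.1, fun _ => stack U V, fun _ => _, tendsto_const_nhds, tendsto_const_nhds,
    tendsto_const_nhds, fun _ => hreg⟩

theorem IsPenalty.infEDist_subdifferential_le {θ : ℝ → EReal} (hθ : IsPenalty θ)
    {f : Matrix (Fin n) (Fin m) ℝ → ℝ} {Lf : ℝ≥0} (hf : Differentiable ℝ f)
    (hL : LipschitzWith Lf (matGrad f)) {lam mu : ℝ} (hlam : 0 < lam) (hmu : 0 < mu)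
    (U : Matrix (Fin n) (Fin r) ℝ) (V : Matrix (Fin m) (Fin r) ℝ) {C : ℝ}
    (hC : ‖gradTop f θ lam mu U V‖ + ‖gradBot f θ lam mu U V‖ ≤ C) :
    Metric.infEDist 0 (subdifferential (objectiveOn f θ lam mu) (stack U V)) ≤
      ENNReal.ofReal C := by
  refine (Metric.infEDist_le_edist_of_mem
    (hθ.stack_mem_subdifferential hf hL hlam hmu U V)).trans ?_
  rw [edist_dist, dist_zero_left]
  exact ENNReal.ofReal_le_ofReal ((norm_stack_le _ _).trans hC)

end Objective

end

end PAMA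

namespace PAMA

noncomputable section

/-! ### Balanced factorizations -/

section Balanced

variable {n m r : ℕ}

theorem submatrix_orthonormalCols {l : ℕ} (h : r ≤ l) {P : Matrix (Fin l) (Fin l) ℝ}
    (hP : Pᵀ * P = 1) : OrthonormalCols (P.submatrix id (Fin.castLE h)) := by
  unfold OrthonormalCols
  ext i j
  rw [← inner_col]
  change inner ℝ (col P (Fin.castLE h i)) (col P (Fin.castLE h j)) = _
  rw [inner_col, hP, Matrix.one_apply, Matrix.one_apply]
  simp [Fin.ext_iff]

theorem norm_orthonormalCols_transpose_mul_le {l p : ℕ} {P : Matrix (Fin l) (Fin r) ℝ}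
    (hP : OrthonormalCols P) (A : Matrix (Fin l) (Fin p) ℝ) : ‖Pᵀ * A‖ ≤ ‖A‖ := by
  apply le_of_sq_le_sq _ (norm_nonneg _)
  have h1 := sq_nonneg ‖A - P * (Pᵀ * A)‖
  rw [norm_sub_sq_frob, norm_mul_left_of_orthonormal hP, frob_comm, frob_mul_left, frob_self] at h1
  linarith

/-- The factor pair `(U, V)` is built from the first `r` columns of a singular value decomposition
of `X` and the square roots of the singular values. -/
def Balanced (hrn : r ≤ n) (hnm : n ≤ m) (X : Matrix (Fin n) (Fin m) ℝ)
    (U : Matrix (Fin n) (Fin r) ℝ) (V : Matrix (Fin m) (Fin r) ℝ) : Prop :=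
  X = U * Vᵀ ∧ ∃ P Q, (P, Q) ∈ svdPairs X ∧ U = P.submatrix id (Fin.castLE hrn) * sqrtSigma r X ∧
    V = Q.submatrix id (Fin.castLE (hrn.trans hnm)) * sqrtSigma r X

/-- The singular values of the product are recognized as d by extending the thin factors to a full
SVD; this is how the iterates, given by thin SVDs of other matrices, are seen to be balanced. -/
theorem balanced_of_thin (hrn : r ≤ n) (hnm : n ≤ m) {d : ℕ → ℝ} (hd : Antitone d)
    (hd0 : ∀ i, 0 ≤ d i) {P : Matrix (Fin n) (Fin r) ℝ} {Q : Matrix (Fin m) (Fin r) ℝ}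
    (hP : OrthonormalCols P) (hQ : OrthonormalCols Q) {U : Matrix (Fin n) (Fin r) ℝ}
    {V : Matrix (Fin m) (Fin r) ℝ} (hU : U = P * Matrix.diagonal (fun i : Fin r => √(d i)))
    (hV : V = Q * Matrix.diagonal (fun i : Fin r => √(d i))) :
    Balanced hrn hnm (U * Vᵀ) U V := by
  have hX : U * Vᵀ = P * Matrix.diagonal (fun i : Fin r => d i) * Qᵀ := by
    rw [hU, hV, Matrix.transpose_mul, Matrix.diagonal_transpose, Matrix.mul_assoc,
      ← Matrix.mul_assoc (Matrix.diagonal _), Matrix.diagonal_mul_diagonal, ← Matrix.mul_assoc]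
    simp only [Real.mul_self_sqrt (hd0 _)]
  obtain ⟨P', Q', h, hP', hQ', hs⟩ := exists_svdPairs_of_thin hrn hnm hd hd0 hP hQ
  rw [← hX] at h hs
  have hsq : sqrtSigma r (U * Vᵀ) = Matrix.diagonal (fun i : Fin r => √(d i)) := by
    rw [sqrtSigma]
    congr 1
    funext i
    rw [hs i i.2]
  exact ⟨rfl, P', Q', h, by rw [hsq, hP', hU], by rw [hsq, hQ', hV]⟩

theorem col_mul_diagonal {l : ℕ} (P : Matrix (Fin l) (Fin r) ℝ) (d : Fin r → ℝ) (i : Fin r) :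
    col (P * Matrix.diagonal d) i = d i • col P i := by
  ext a
  simp [col_apply, Matrix.mul_diagonal, mul_comm]

variable {hrn : r ≤ n} {hnm : n ≤ m} {X : Matrix (Fin n) (Fin m) ℝ}
  {U : Matrix (Fin n) (Fin r) ℝ} {V : Matrix (Fin m) (Fin r) ℝ}

theorem gram_of_orthonormalCols_mul_sqrtSigma {l : ℕ} {P : Matrix (Fin l) (Fin r) ℝ}
    (hP : OrthonormalCols P) (X : Matrix (Fin n) (Fin m) ℝ) :
    (P * sqrtSigma r X)ᵀ * (P * sqrtSigma r X) =
      Matrix.diagonal fun i : Fin r => sigma X i := by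
  rw [Matrix.transpose_mul, Matrix.mul_assoc, ← Matrix.mul_assoc Pᵀ, hP, Matrix.one_mul, sqrtSigma,
    Matrix.diagonal_transpose, Matrix.diagonal_mul_diagonal]
  simp only [Real.mul_self_sqrt (sigma_nonneg _ _)]

theorem Balanced.gram_top (h : Balanced hrn hnm X U V) :
    Uᵀ * U = Matrix.diagonal fun i : Fin r => sigma X i := by
  obtain ⟨-, P, Q, hPQ, rfl, rfl⟩ := h
  obtain ⟨hP, hQ, -⟩ := mem_svdPairs_iff.1 hPQ
  exact gram_of_orthonormalCols_mul_sqrtSigma (submatrix_orthonormalCols _ hP) X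

theorem Balanced.gram_bot (h : Balanced hrn hnm X U V) :
    Vᵀ * V = Matrix.diagonal fun i : Fin r => sigma X i := by
  obtain ⟨-, P, Q, hPQ, rfl, rfl⟩ := h
  obtain ⟨hP, hQ, -⟩ := mem_svdPairs_iff.1 hPQ
  exact gram_of_orthonormalCols_mul_sqrtSigma (submatrix_orthonormalCols _ hQ) X

theorem Balanced.norm_col_top (h : Balanced hrn hnm X U V) (i : Fin r) :
    ‖col U i‖ = √(sigma X i) := by
  rw [← Real.sqrt_sq (norm_nonneg (col U i)), ← real_inner_self_eq_norm_sq, inner_col, h.gram_top,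
    Matrix.diagonal_apply_eq]

theorem Balanced.norm_col_bot (h : Balanced hrn hnm X U V) (i : Fin r) :
    ‖col V i‖ = √(sigma X i) := by
  rw [← Real.sqrt_sq (norm_nonneg (col V i)), ← real_inner_self_eq_norm_sq, inner_col, h.gram_bot,
    Matrix.diagonal_apply_eq]

theorem Balanced.rank_le (h : Balanced hrn hnm X U V) : X.rank ≤ r := by
  rw [h.1]
  exact (Matrix.rank_mul_le_left _ _).trans (Matrix.rank_le_width U)

theorem Balanced.col_top_eq_zero (h : Balanced hrn hnm X U V) {i : Fin r} (hi : X.rank ≤ i) :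
    col U i = 0 := by
  rw [← norm_eq_zero, h.norm_col_top, sigma_eq_zero_of_rank_le X hi, Real.sqrt_zero]

theorem Balanced.col_bot_eq_zero (h : Balanced hrn hnm X U V) {i : Fin r} (hi : X.rank ≤ i) :
    col V i = 0 := by
  rw [← norm_eq_zero, h.norm_col_bot, sigma_eq_zero_of_rank_le X hi, Real.sqrt_zero]

/-- The rank of U is that of its Gram matrix, which counts nonzero singular values. -/
theorem Balanced.rank_top (h : Balanced hrn hnm X U V) : U.rank ≤ X.rank := by
  rw [← Matrix.rank_transpose_mul_self, h.gram_top, Matrix.rank_diagonal, Fintype.card_subtype]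
  refine (Finset.card_le_card (t := Finset.univ.filter fun i : Fin r => (i : ℕ) < X.rank) ?_).trans ?_
  · intro i hi
    simp only [Finset.mem_filter, Finset.mem_univ, true_and] at hi ⊢
    exact (sigma_pos_iff X i).1 (lt_of_le_of_ne (sigma_nonneg X i) (Ne.symm hi))
  · have : (Finset.univ.filter fun i : Fin r => (i : ℕ) < X.rank).card =
        ((Finset.univ.filter fun i : Fin r => (i : ℕ) < X.rank).map Fin.valEmbedding).card :=
      (Finset.card_map _).symm
    rw [this]
    refine (Finset.card_le_card (t := Finset.range X.rank) ?_).trans (Finset.card_range _).le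
    intro j hj
    simp only [Finset.mem_map, Finset.mem_filter, Finset.mem_univ, true_and] at hj
    obtain ⟨i, hi, rfl⟩ := hj
    simpa using hi

theorem Balanced.rank_bot (h : Balanced hrn hnm X U V) : V.rank ≤ X.rank := by
  have h1 : V.rank = U.rank := by
    rw [← Matrix.rank_transpose_mul_self, ← Matrix.rank_transpose_mul_self U, h.gram_top,
      h.gram_bot]
  rw [h1]
  exact h.rank_top

/-- The left side is twice the sum of the singular values, which equals 2⟨P₁, XQ₁⟩ = 2⟨U'ᵀP₁, V'ᵀQ₁⟩
for orthonormal P₁ and Q₁. Cauchy-Schwarz bounds it by 2‖U'‖‖V'‖. -/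
theorem Balanced.norm_sq_add_norm_sq_le (h : Balanced hrn hnm X U V)
    {U' : Matrix (Fin n) (Fin r) ℝ} {V' : Matrix (Fin m) (Fin r) ℝ} (h' : X = U' * V'ᵀ) :
    ‖U‖ ^ 2 + ‖V‖ ^ 2 ≤ ‖U'‖ ^ 2 + ‖V'‖ ^ 2 := by
  have hU : ‖U‖ ^ 2 = ∑ i : Fin r, sigma X i := by
    rw [norm_sq_eq_sum_col]
    exact Finset.sum_congr rfl fun i _ => by rw [h.norm_col_top, Real.sq_sqrt (sigma_nonneg _ _)]
  have hV : ‖V‖ ^ 2 = ∑ i : Fin r, sigma X i := by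
    rw [norm_sq_eq_sum_col]
    exact Finset.sum_congr rfl fun i _ => by rw [h.norm_col_bot, Real.sq_sqrt (sigma_nonneg _ _)]
  obtain ⟨hX, P, Q, hPQ, hUP, hVQ⟩ := h
  obtain ⟨hP, hQ, -⟩ := mem_svdPairs_iff.1 hPQ
  have hP1 := submatrix_orthonormalCols hrn hP
  have hQ1 := submatrix_orthonormalCols (hrn.trans hnm) hQ
  set P₁ := P.submatrix id (Fin.castLE hrn)
  set Q₁ := Q.submatrix id (Fin.castLE (hrn.trans hnm))
  have e1 : frob P₁ (X * Q₁) = ∑ i : Fin r, sigma X i := by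
    have e2 : P₁ᵀ * (X * Q₁) = Matrix.diagonal fun i : Fin r => sigma X i := by
      have hP1' : P₁ᵀ * P₁ = 1 := hP1
      have hQ1' : Q₁ᵀ * Q₁ = 1 := hQ1
      have hS : sqrtSigma r X * (sqrtSigma r X)ᵀ = Matrix.diagonal fun i : Fin r => sigma X i := by
        rw [sqrtSigma, Matrix.diagonal_transpose, Matrix.diagonal_mul_diagonal]
        simp only [Real.mul_self_sqrt (sigma_nonneg _ _)]
      calc P₁ᵀ * (X * Q₁) = P₁ᵀ * (U * Vᵀ * Q₁) := by rw [← hX]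
        _ = (P₁ᵀ * P₁) * (sqrtSigma r X * (sqrtSigma r X)ᵀ) * (Q₁ᵀ * Q₁) := by
          rw [hUP, hVQ, Matrix.transpose_mul]
          simp only [Matrix.mul_assoc]
        _ = _ := by rw [hP1', hQ1', hS, Matrix.one_mul, Matrix.mul_one]
    rw [frob, e2, Matrix.trace_diagonal]
  have e3 : frob P₁ (X * Q₁) = frob (U'ᵀ * P₁) (V'ᵀ * Q₁) := by
    rw [frob_mul_left, Matrix.transpose_transpose, h', Matrix.mul_assoc]
  have h1 := (le_abs_self _).trans (abs_frob_le (U'ᵀ * P₁) (V'ᵀ * Q₁))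
  have h2 : ‖U'ᵀ * P₁‖ ≤ ‖U'‖ := by
    rw [← norm_transpose_frob, Matrix.transpose_mul, Matrix.transpose_transpose]
    exact norm_orthonormalCols_transpose_mul_le hP1 U'
  have h3 : ‖V'ᵀ * Q₁‖ ≤ ‖V'‖ := by
    rw [← norm_transpose_frob, Matrix.transpose_mul, Matrix.transpose_transpose]
    exact norm_orthonormalCols_transpose_mul_le hQ1 V'
  have h4 := mul_le_mul h2 h3 (norm_nonneg _) (norm_nonneg _)
  rw [hU, hV, ← e1, e3]
  nlinarith [sq_nonneg (‖U'‖ - ‖V'‖)]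

theorem Balanced.penSum_le {θ : ℝ → EReal} (hθ : IsPenalty θ)
    (hA : FactorizationOptimal n m r hrn (hrn.trans hnm) θ) (h : Balanced hrn hnm X U V)
    {U' : Matrix (Fin n) (Fin r) ℝ} {V' : Matrix (Fin m) (Fin r) ℝ} (h' : X = U' * V'ᵀ) :
    penSum θ U + penSum θ V ≤ penSum θ U' + penSum θ V' := by
  have hr := h.rank_le
  obtain ⟨-, P, Q, hPQ, hUP, hVQ⟩ := h
  have h1 := hA X hr P Q hPQ
  rw [← hUP, ← hVQ] at h1
  have h2 : colPenalty θ U + colPenalty θ V ≤ colPenalty θ U' + colPenalty θ V' := by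
    rw [h1]
    exact sInf_le ⟨U', V', h', rfl⟩
  rw [hθ.colPenalty_eq, hθ.colPenalty_eq, hθ.colPenalty_eq, hθ.colPenalty_eq] at h2
  exact_mod_cast h2

theorem Balanced.objR_le {θ : ℝ → EReal} (hθ : IsPenalty θ)
    (hA : FactorizationOptimal n m r hrn (hrn.trans hnm) θ) (h : Balanced hrn hnm X U V)
    {U' : Matrix (Fin n) (Fin r) ℝ} {V' : Matrix (Fin m) (Fin r) ℝ} (h' : X = U' * V'ᵀ)
    (f : Matrix (Fin n) (Fin m) ℝ → ℝ) {lam mu : ℝ} (hlam : 0 < lam) (hmu : 0 < mu) :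
    objR f θ lam mu U V ≤ objR f θ lam mu U' V' := by
  have h1 := mul_le_mul_of_nonneg_left (h.penSum_le hθ hA h') hlam.le
  have h2 := mul_le_mul_of_nonneg_left (h.norm_sq_add_norm_sq_le h') (half_pos hmu).le
  rw [objR, objR, ← h', ← h.1]
  linarith

/-- Columns of balanced factorizations depend Lipschitz continuously on the matrix, up to a common
sign. -/
theorem Balanced.exists_sign {Xs : Matrix (Fin n) (Fin m) ℝ} {R : ℕ} {δ : ℝ} (hδ : 0 < δ)
    (hgaps : ∀ i j : ℕ, i < j → j ≤ R → 2 * δ ≤ sigma Xs i - sigma Xs j)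
    {X' : Matrix (Fin n) (Fin m) ℝ} {U' : Matrix (Fin n) (Fin r) ℝ} {V' : Matrix (Fin m) (Fin r) ℝ}
    (h : Balanced hrn hnm X U V) (h' : Balanced hrn hnm X' U' V')
    (hX : X ∈ Metric.closedBall Xs δ) (hX' : X' ∈ Metric.closedBall Xs δ)
    {c : ℝ} (hc : 0 < c) (i : Fin r) (hi : (i : ℕ) < R) (hs : c ≤ √(sigma X i)) :
    ∃ ε : ℝ, (ε = 1 ∨ ε = -1) ∧
      ‖col U' i - ε • col U i‖ ≤ (1 / c + √(sigma X i) * (2 / δ)) * ‖X' - X‖ ∧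
      ‖col V' i - ε • col V i‖ ≤ (1 / c + √(sigma X i) * (2 / δ)) * ‖X' - X‖ := by
  obtain ⟨-, P, Q, hPQ, rfl, rfl⟩ := h
  obtain ⟨-, P', Q', hPQ', rfl, rfl⟩ := h'
  obtain ⟨ε, hε, h1, h2⟩ := svd_perturbation hnm hδ hgaps hX' hX hPQ' hPQ (Fin.castLE hrn i) hi
  -- The lower bound c on one square root makes the square root Lipschitz with constant 1/c.
  have hsq : |√(sigma X' i) - √(sigma X i)| ≤ 1 / c * ‖X' - X‖ := by
    have h3 : |√(sigma X' i) - √(sigma X i)| * (√(sigma X' i) + √(sigma X i)) ≤ ‖X' - X‖ := by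
      rw [← abs_of_nonneg (by positivity : 0 ≤ √(sigma X' i) + √(sigma X i)), ← abs_mul]
      have : (√(sigma X' i) - √(sigma X i)) * (√(sigma X' i) + √(sigma X i)) =
          sigma X' i - sigma X i := by
        rw [mul_comm, ← sq_sub_sq, Real.sq_sqrt (sigma_nonneg _ _), Real.sq_sqrt (sigma_nonneg _ _)]
      rw [this]
      exact abs_sigma_sub_le hnm X' X i
    rw [one_div, inv_mul_eq_div, le_div_iff₀ hc]
    refine le_trans (mul_le_mul_of_nonneg_left ?_ (abs_nonneg _)) h3
    linarith [Real.sqrt_nonneg (sigma X' i)]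
  have main : ∀ {l : ℕ} (x x' : EuclideanSpace ℝ (Fin l)), ‖x'‖ = 1 →
      ‖x' - ε • x‖ ≤ 2 / δ * ‖X' - X‖ →
      ‖√(sigma X' i) • x' - ε • √(sigma X i) • x‖ ≤
        (1 / c + √(sigma X i) * (2 / δ)) * ‖X' - X‖ := by
    intro l x x' hx' hxx
    have e : √(sigma X' i) • x' - ε • √(sigma X i) • x =
        (√(sigma X' i) - √(sigma X i)) • x' + √(sigma X i) • (x' - ε • x) := by
      rw [sub_smul, smul_sub, smul_comm ε]
      abel
    rw [e]
    refine (norm_add_le _ _).trans ?_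
    rw [norm_smul, norm_smul, hx', mul_one, Real.norm_eq_abs, Real.norm_of_nonneg (Real.sqrt_nonneg _)]
    have := mul_le_mul_of_nonneg_left hxx (Real.sqrt_nonneg (sigma X i))
    linarith
  obtain ⟨hP', hQ', -⟩ := mem_svdPairs_iff.1 hPQ'
  refine ⟨ε, hε, ?_, ?_⟩
  · rw [sqrtSigma, sqrtSigma, col_mul_diagonal, col_mul_diagonal]
    exact main _ _ (norm_col_eq_one hP' _) h1
  · rw [sqrtSigma, sqrtSigma, col_mul_diagonal, col_mul_diagonal]
    exact main _ _ (norm_col_eq_one hQ' _) h2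

end Balanced

/-! ### One proximal step -/

/-- A diagonal Gram matrix turns ‖(W − W₀)Aᵀ‖² into a weighted sum over columns, so the whole
subproblem separates, with curvature L d_i + γ in column i. -/
theorem half_step {l p r : ℕ} {θ : ℝ → EReal} {L lam mu γ : ℝ}
    {H W₀ W : Matrix (Fin l) (Fin r) ℝ} {A : Matrix (Fin p) (Fin r) ℝ} {d : Fin r → ℝ}
    (hA : Aᵀ * A = Matrix.diagonal d)
    (hmin : ∀ W' : Matrix (Fin l) (Fin r) ℝ,
      frob H W + L / 2 * ‖(W - W₀) * Aᵀ‖ ^ 2 + lam * penSum θ W + mu / 2 * ‖W‖ ^ 2 +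
        γ / 2 * ‖W - W₀‖ ^ 2 ≤
      frob H W' + L / 2 * ‖(W' - W₀) * Aᵀ‖ ^ 2 + lam * penSum θ W' + mu / 2 * ‖W'‖ ^ 2 +
        γ / 2 * ‖W' - W₀‖ ^ 2) (i : Fin r) (x : EuclideanSpace ℝ (Fin l)) :
    columnObjective θ lam mu (L * d i + γ) (col H i) (col W₀ i) (col W i) ≤
      columnObjective θ lam mu (L * d i + γ) (col H i) (col W₀ i) x := by
  refine column_minimizer (F := fun i x =>
    columnObjective θ lam mu (L * d i + γ) (col H i) (col W₀ i) x) (fun W' => ?_) i x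
  have key : ∀ Y : Matrix (Fin l) (Fin r) ℝ,
      ∑ i, columnObjective θ lam mu (L * d i + γ) (col H i) (col W₀ i) (col Y i) =
      frob H Y + L / 2 * ‖(Y - W₀) * Aᵀ‖ ^ 2 + lam * penSum θ Y + mu / 2 * ‖Y‖ ^ 2 +
        γ / 2 * ‖Y - W₀‖ ^ 2 := by
    intro Y
    rw [norm_sq_mul_transpose hA, norm_sq_eq_sum_col Y, norm_sq_eq_sum_col (Y - W₀),
      frob_eq_sum_inner_col, penSum]
    simp only [Finset.mul_sum, ← Finset.sum_add_distrib]
    refine Finset.sum_congr rfl fun i _ => ?_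
    rw [columnObjective, col_sub]
    ring
  rw [key, key]
  exact hmin W'

/-- W factors through a coordinate projection onto at most R − 1 columns. -/
theorem exists_col_eq_zero_of_rank_lt {l r R : ℕ} {W : Matrix (Fin l) (Fin r) ℝ} (i₀ : Fin r)
    (hi₀ : (i₀ : ℕ) < R) (h : ∀ i : Fin r, R ≤ i → col W i = 0) (h0 : col W i₀ = 0) :
    W.rank < R := by
  have hW : W = W * Matrix.diagonal (fun i : Fin r => if (i : ℕ) < R ∧ i ≠ i₀ then (1 : ℝ) else 0) := by
    refine col_ext fun i => ?_
    rw [col_mul_diagonal]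
    split_ifs with hi
    · rw [one_smul]
    · rw [zero_smul]
      by_cases hii : i = i₀
      · rw [hii, h0]
      · exact h i (not_lt.1 fun hlt => hi ⟨hlt, hii⟩)
  rw [hW]
  refine lt_of_le_of_lt (Matrix.rank_mul_le_right _ _) ?_
  rw [Matrix.rank_diagonal, Fintype.card_subtype]
  have : (Finset.univ.filter fun i : Fin r =>
      (if (i : ℕ) < R ∧ i ≠ i₀ then (1 : ℝ) else 0) ≠ 0).card =
      ((Finset.univ.filter fun i : Fin r =>
        (if (i : ℕ) < R ∧ i ≠ i₀ then (1 : ℝ) else 0) ≠ 0).map Fin.valEmbedding).card :=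
    (Finset.card_map _).symm
  rw [this]
  refine lt_of_le_of_lt (Finset.card_le_card (t := (Finset.range R).erase i₀) ?_) ?_
  · intro j hj
    simp only [Finset.mem_map, Finset.mem_filter, Finset.mem_univ, true_and] at hj
    obtain ⟨i, hi, rfl⟩ := hj
    have hi' : (i : ℕ) < R ∧ i ≠ i₀ := by
      by_contra hc
      exact hi (if_neg hc)
    simp [hi'.1, Fin.val_inj, hi'.2]
  · rw [Finset.card_erase_of_mem (by simpa using hi₀), Finset.card_range]
    omega

end

end PAMA

namespace PAMA

noncomputable section

/-! ### The iterates -/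

section Run

variable {n m r : ℕ} {f : Matrix (Fin n) (Fin m) ℝ → ℝ} {Lf : ℝ≥0} {θ : ℝ → EReal}
  {lam mu rho lgam1 lgam2 : ℝ} {s : Sequences n m r}

theorem OrthonormalCols.mul {l p q : ℕ} {P : Matrix (Fin l) (Fin p) ℝ} {Q : Matrix (Fin p) (Fin q) ℝ}
    (hP : OrthonormalCols P) (hQ : OrthonormalCols Q) : OrthonormalCols (P * Q) := by
  unfold OrthonormalCols at *
  rw [Matrix.transpose_mul, Matrix.mul_assoc, ← Matrix.mul_assoc Pᵀ, hP, Matrix.one_mul, hQ]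

theorem sqrtSigma_transpose (κ : ℕ) (X : Matrix (Fin n) (Fin m) ℝ) :
    (sqrtSigma κ X)ᵀ = sqrtSigma κ X := Matrix.diagonal_transpose _

theorem IsRun.Db_transpose (hs : IsRun f θ Lf lam mu rho lgam1 lgam2 s) (k : ℕ) :
    (s.Db k)ᵀ = s.Db k := by
  cases k with
  | zero => rw [hs.Db_zero, Matrix.transpose_one]
  | succ k => rw [hs.Db_eq, sqrtSigma_transpose]

theorem IsRun.Vb_eq_mul (hs : IsRun f θ Lf lam mu rho lgam1 lgam2 s) (k : ℕ) :
    s.Vb k = s.Pb k * s.Db k := by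
  cases k with
  | zero => rw [hs.Vb_zero, hs.Db_zero, Matrix.mul_one]
  | succ k => exact hs.Vb_eq k

theorem IsRun.orthonormal_Pb (hs : IsRun f θ Lf lam mu rho lgam1 lgam2 s) (k : ℕ) :
    OrthonormalCols (s.Pb k) := by
  cases k with
  | zero => exact hs.Pb_zero
  | succ k => exact hs.Pb_orth k

theorem IsRun.balanced_bar (hs : IsRun f θ Lf lam mu rho lgam1 lgam2 s) (hrn : r ≤ n) (hnm : n ≤ m)
    (k : ℕ) : Balanced hrn hnm (s.Xb k) (s.Ub k) (s.Vb k) := by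
  cases k with
  | zero =>
    rw [hs.Xb_zero]
    refine balanced_of_thin hrn hnm (d := fun _ => 1) antitone_const (fun _ => zero_le_one)
      hs.Ph_zero hs.Pb_zero ?_ ?_
    · rw [hs.Ub_zero]; simp
    · rw [hs.Vb_zero]; simp
  | succ k =>
    rw [hs.Xb_eq]
    exact balanced_of_thin hrn hnm (sigma_antitone (s.V (k + 1) * s.Dh (k + 1))) (sigma_nonneg _)
      ((hs.Ph_orth k).mul (hs.Qb_orth k)) (hs.Pb_orth k) (by rw [hs.Ub_eq, hs.Db_eq]; rfl)
      (by rw [hs.Vb_eq, hs.Db_eq]; rfl)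

theorem IsRun.balanced_hat (hs : IsRun f θ Lf lam mu rho lgam1 lgam2 s) (hrn : r ≤ n) (hnm : n ≤ m)
    (k : ℕ) : Balanced hrn hnm (s.Xh (k + 1)) (s.Uh (k + 1)) (s.Vh (k + 1)) := by
  rw [hs.Xh_eq]
  exact balanced_of_thin hrn hnm (sigma_antitone (s.U (k + 1) * s.Db k)) (sigma_nonneg _)
    (hs.Ph_orth k) ((hs.orthonormal_Pb k).mul (hs.Qh_orth k)) (by rw [hs.Uh_eq, hs.Dh_eq]; rfl)
    (by rw [hs.Vh_eq, hs.Dh_eq]; rfl)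

/-- The SVD step only refactors the product; it leaves the matrix itself unchanged. -/
theorem IsRun.Xh_eq_mul (hs : IsRun f θ Lf lam mu rho lgam1 lgam2 s) (k : ℕ) :
    s.Xh (k + 1) = s.U (k + 1) * (s.Vb k)ᵀ := by
  have hD : (s.Dh (k + 1))ᵀ = s.Dh (k + 1) := by rw [hs.Dh_eq, sqrtSigma_transpose]
  rw [hs.Xh_eq, hs.Uh_eq, hs.Vh_eq, hs.Vb_eq_mul, Matrix.transpose_mul (s.Pb k) (s.Db k),
    hs.Db_transpose, ← Matrix.mul_assoc, hs.svd_U, Matrix.transpose_mul, Matrix.transpose_mul, hD,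
    sq]
  simp only [Matrix.mul_assoc]

theorem IsRun.Xb_eq_mul (hs : IsRun f θ Lf lam mu rho lgam1 lgam2 s) (k : ℕ) :
    s.Xb (k + 1) = s.Uh (k + 1) * (s.V (k + 1))ᵀ := by
  have hD : (s.Dh (k + 1))ᵀ = s.Dh (k + 1) := by rw [hs.Dh_eq, sqrtSigma_transpose]
  have h1 : s.Dh (k + 1) * (s.V (k + 1))ᵀ = (s.V (k + 1) * s.Dh (k + 1))ᵀ := by
    rw [Matrix.transpose_mul, hD]
  rw [hs.Xb_eq, hs.Uh_eq, Matrix.mul_assoc (s.Ph (k + 1)), h1, hs.svd_V, hs.Ub_eq, hs.Vb_eq, sq]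
  simp only [Matrix.transpose_mul, Matrix.transpose_transpose, hs.Db_transpose, Matrix.mul_assoc]

theorem IsRun.sigma_Xb (hs : IsRun f θ Lf lam mu rho lgam1 lgam2 s) (hrn : r ≤ n) (hnm : n ≤ m)
    (k : ℕ) (i : Fin r) : sigma (s.Xb k) i = s.Db k i i ^ 2 := by
  have h1 := congrFun (congrFun (hs.balanced_bar hrn hnm k).gram_bot i) i
  have hP : (s.Pb k)ᵀ * s.Pb k = 1 := hs.orthonormal_Pb k
  rw [Matrix.diagonal_apply_eq, hs.Vb_eq_mul, Matrix.transpose_mul, Matrix.mul_assoc,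
    ← Matrix.mul_assoc (s.Pb k)ᵀ, hP, Matrix.one_mul, hs.Db_transpose] at h1
  have h2 : ∃ d, s.Db k = Matrix.diagonal d := by
    cases k with
    | zero => exact ⟨fun _ => 1, by rw [hs.Db_zero]; simp⟩
    | succ k => exact ⟨_, hs.Db_eq k⟩
  obtain ⟨d, hd⟩ := h2
  rw [← h1, hd, Matrix.diagonal_mul_diagonal, Matrix.diagonal_apply_eq, Matrix.diagonal_apply_eq, sq]

theorem IsRun.sigma_Xh (hs : IsRun f θ Lf lam mu rho lgam1 lgam2 s) (hrn : r ≤ n) (hnm : n ≤ m)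
    (k : ℕ) (i : Fin r) : sigma (s.Xh (k + 1)) i = s.Dh (k + 1) i i ^ 2 := by
  have h1 := congrFun (congrFun (hs.balanced_hat hrn hnm k).gram_top i) i
  have hP : (s.Ph (k + 1))ᵀ * s.Ph (k + 1) = 1 := hs.Ph_orth k
  have hD : (s.Dh (k + 1))ᵀ = s.Dh (k + 1) := by rw [hs.Dh_eq, sqrtSigma_transpose]
  rw [Matrix.diagonal_apply_eq, hs.Uh_eq, Matrix.transpose_mul, Matrix.mul_assoc,
    ← Matrix.mul_assoc (s.Ph (k + 1))ᵀ, hP, Matrix.one_mul, hD, hs.Dh_eq, sqrtSigma,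
    Matrix.diagonal_mul_diagonal, Matrix.diagonal_apply_eq] at h1
  rw [← h1, hs.Dh_eq, sqrtSigma, Matrix.diagonal_apply_eq, sq]

theorem gam_bounds {g : ℕ → ℝ} {lg : ℝ} (h0 : 0 < g 0) (hlg : 0 < lg)
    (h : ∀ k, g (k + 1) = max lg (rho * g k)) (k : ℕ) : 0 < g k ∧ lg ≤ g (k + 1) := by
  have h1 : ∀ k, lg ≤ g (k + 1) := fun k => by rw [h]; exact le_max_left _ _
  refine ⟨?_, h1 k⟩
  cases k with
  | zero => exact h0
  | succ k => exact hlg.trans_le (h1 k)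

/-! ### Columnwise subproblems, decrease and rank monotonicity. -/

theorem IsRun.U_column_min (hs : IsRun f θ Lf lam mu rho lgam1 lgam2 s) (hθ : IsPenalty θ)
    (hrn : r ≤ n) (hnm : n ≤ m) (k : ℕ) (i : Fin r) (x : EuclideanSpace ℝ (Fin n)) :
    columnObjective θ lam mu (Lf * sigma (s.Xb k) i + s.gam1 k)
        (col (matGrad f (s.Xb k) * s.Vb k) i) (col (s.Ub k) i) (col (s.U (k + 1)) i) ≤
      columnObjective θ lam mu (Lf * sigma (s.Xb k) i + s.gam1 k)
        (col (matGrad f (s.Xb k) * s.Vb k) i) (col (s.Ub k) i) x := by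
  refine half_step (hs.balanced_bar hrn hnm k).gram_bot (fun W => ?_) i x
  have h := hs.U_min k W
  rw [hθ.majorObjective_eq, hθ.majorObjective_eq, ← EReal.coe_add, ← EReal.coe_add,
    EReal.coe_le_coe_iff] at h
  have e : ∀ W : Matrix (Fin n) (Fin r) ℝ, majorF f Lf W (s.Vb k) (s.Ub k) (s.Vb k) =
      f (s.Xb k) + frob (matGrad f (s.Xb k) * s.Vb k) W -
        frob (matGrad f (s.Xb k) * s.Vb k) (s.Ub k) +
        Lf / 2 * ‖(W - s.Ub k) * (s.Vb k)ᵀ‖ ^ 2 := by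
    intro W
    have hX := (hs.balanced_bar hrn hnm k).1
    have e1 : majorF f Lf W (s.Vb k) (s.Ub k) (s.Vb k) = f (s.Xb k) +
        frob (matGrad f (s.Xb k)) ((W - s.Ub k) * (s.Vb k)ᵀ) +
        Lf / 2 * ‖(W - s.Ub k) * (s.Vb k)ᵀ‖ ^ 2 := by
      rw [Matrix.sub_mul, hX]
      rfl
    rw [e1, add_sub_assoc, ← frob_sub_right, frob_mul_right]
  rw [e, e] at h
  linarith

theorem IsRun.V_column_min (hs : IsRun f θ Lf lam mu rho lgam1 lgam2 s) (hθ : IsPenalty θ)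
    (hrn : r ≤ n) (hnm : n ≤ m) (k : ℕ) (i : Fin r) (x : EuclideanSpace ℝ (Fin m)) :
    columnObjective θ lam mu (Lf * sigma (s.Xh (k + 1)) i + s.gam2 k)
        (col ((matGrad f (s.Xh (k + 1)))ᵀ * s.Uh (k + 1)) i) (col (s.Vh (k + 1)) i)
        (col (s.V (k + 1)) i) ≤
      columnObjective θ lam mu (Lf * sigma (s.Xh (k + 1)) i + s.gam2 k)
        (col ((matGrad f (s.Xh (k + 1)))ᵀ * s.Uh (k + 1)) i) (col (s.Vh (k + 1)) i) x := by
  refine half_step (hs.balanced_hat hrn hnm k).gram_top (fun W => ?_) i x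
  have h := hs.V_min k W
  rw [hθ.majorObjective_eq, hθ.majorObjective_eq, ← EReal.coe_add, ← EReal.coe_add,
    EReal.coe_le_coe_iff] at h
  have e : ∀ W : Matrix (Fin m) (Fin r) ℝ,
      majorF f Lf (s.Uh (k + 1)) W (s.Uh (k + 1)) (s.Vh (k + 1)) =
      f (s.Xh (k + 1)) + frob ((matGrad f (s.Xh (k + 1)))ᵀ * s.Uh (k + 1)) W -
        frob ((matGrad f (s.Xh (k + 1)))ᵀ * s.Uh (k + 1)) (s.Vh (k + 1)) +
        Lf / 2 * ‖(W - s.Vh (k + 1)) * (s.Uh (k + 1))ᵀ‖ ^ 2 := by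
    intro W
    have e2 : s.Uh (k + 1) * Wᵀ - s.Uh (k + 1) * (s.Vh (k + 1))ᵀ =
        ((W - s.Vh (k + 1)) * (s.Uh (k + 1))ᵀ)ᵀ := by
      rw [Matrix.transpose_mul, Matrix.transpose_transpose, Matrix.transpose_sub, Matrix.mul_sub]
    have e1 : majorF f Lf (s.Uh (k + 1)) W (s.Uh (k + 1)) (s.Vh (k + 1)) = f (s.Xh (k + 1)) +
        frob (matGrad f (s.Xh (k + 1))) ((W - s.Vh (k + 1)) * (s.Uh (k + 1))ᵀ)ᵀ +
        Lf / 2 * ‖((W - s.Vh (k + 1)) * (s.Uh (k + 1))ᵀ)ᵀ‖ ^ 2 := by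
      rw [← e2, hs.Xh_eq k]
      rfl
    rw [e1, add_sub_assoc, ← frob_sub_right, frob_mul_right, norm_transpose_frob,
      ← frob_transpose (matGrad f (s.Xh (k + 1))), Matrix.transpose_transpose]
  rw [e, e] at h
  linarith

/-- The subproblem is compared at the old factor, where the majorization is exact; passing back to f
and rebalancing can only lower the value. -/
theorem IsRun.decrease_top (hs : IsRun f θ Lf lam mu rho lgam1 lgam2 s) (hθ : IsPenalty θ)
    (hrn : r ≤ n) (hnm : n ≤ m) (hA : FactorizationOptimal n m r hrn (hrn.trans hnm) θ)
    (hf : Differentiable ℝ f) (hL : LipschitzWith Lf (matGrad f)) (hlam : 0 < lam) (hmu : 0 < mu)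
    (k : ℕ) : objR f θ lam mu (s.Uh (k + 1)) (s.Vh (k + 1)) +
      s.gam1 k / 2 * ‖s.U (k + 1) - s.Ub k‖ ^ 2 ≤ objR f θ lam mu (s.Ub k) (s.Vb k) := by
  have h1 := (hs.balanced_hat hrn hnm k).objR_le hθ hA (hs.Xh_eq_mul k) f hlam hmu
  have h2 := le_majorF hf hL (s.U (k + 1)) (s.Ub k) (s.Vb k) (s.Vb k)
  have h := hs.U_min k (s.Ub k)
  rw [hθ.majorObjective_eq, hθ.majorObjective_eq, ← EReal.coe_add, ← EReal.coe_add,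
    EReal.coe_le_coe_iff, majorF_self, sub_self, norm_zero] at h
  unfold objR at *
  linarith

theorem IsRun.decrease_bot (hs : IsRun f θ Lf lam mu rho lgam1 lgam2 s) (hθ : IsPenalty θ)
    (hrn : r ≤ n) (hnm : n ≤ m) (hA : FactorizationOptimal n m r hrn (hrn.trans hnm) θ)
    (hf : Differentiable ℝ f) (hL : LipschitzWith Lf (matGrad f)) (hlam : 0 < lam) (hmu : 0 < mu)
    (k : ℕ) : objR f θ lam mu (s.Ub (k + 1)) (s.Vb (k + 1)) +
      s.gam2 k / 2 * ‖s.V (k + 1) - s.Vh (k + 1)‖ ^ 2 ≤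
      objR f θ lam mu (s.Uh (k + 1)) (s.Vh (k + 1)) := by
  have h1 := (hs.balanced_bar hrn hnm (k + 1)).objR_le hθ hA (hs.Xb_eq_mul k) f hlam hmu
  have h2 := le_majorF hf hL (s.Uh (k + 1)) (s.Uh (k + 1)) (s.V (k + 1)) (s.Vh (k + 1))
  have h := hs.V_min k (s.Vh (k + 1))
  rw [hθ.majorObjective_eq, hθ.majorObjective_eq, ← EReal.coe_add, ← EReal.coe_add,
    EReal.coe_le_coe_iff, majorF_self, sub_self, norm_zero] at h
  unfold objR at *
  linarith

theorem IsRun.rank_Xh_le (hs : IsRun f θ Lf lam mu rho lgam1 lgam2 s) (hrn : r ≤ n) (hnm : n ≤ m)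
    (k : ℕ) : (s.Xh (k + 1)).rank ≤ (s.Xb k).rank := by
  rw [hs.Xh_eq_mul]
  refine (Matrix.rank_mul_le_right _ _).trans ?_
  rw [Matrix.rank_transpose]
  exact (hs.balanced_bar hrn hnm k).rank_bot

theorem IsRun.rank_Xb_le (hs : IsRun f θ Lf lam mu rho lgam1 lgam2 s) (hrn : r ≤ n) (hnm : n ≤ m)
    (k : ℕ) : (s.Xb (k + 1)).rank ≤ (s.Xh (k + 1)).rank := by
  rw [hs.Xb_eq_mul]
  exact (Matrix.rank_mul_le_left _ _).trans (hs.balanced_hat hrn hnm k).rank_top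

theorem col_mul {l p q : ℕ} (A : Matrix (Fin l) (Fin p) ℝ) (B : Matrix (Fin p) (Fin q) ℝ) (i : Fin q)
    (h : col B i = 0) : col (A * B) i = 0 := by
  have := norm_col_mul_le A B i
  rw [h, norm_zero, mul_zero] at this
  exact norm_eq_zero.1 (le_antisymm this (norm_nonneg _))

/-- Past the rank both balanced factors have zero columns, so the linear term and the starting point
of the column problem vanish. -/
theorem IsRun.col_U_eq_zero (hs : IsRun f θ Lf lam mu rho lgam1 lgam2 s) (hθ : IsPenalty θ)
    (hrn : r ≤ n) (hnm : n ≤ m) (hlam : 0 < lam) (hmu : 0 < mu) {k : ℕ} (hg : 0 < s.gam1 k)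
    {i : Fin r} (hi : (s.Xb k).rank ≤ i) : col (s.U (k + 1)) i = 0 := by
  have h := hs.U_column_min hθ hrn hnm k i
  have hB := hs.balanced_bar hrn hnm k
  rw [col_mul _ _ _ (hB.col_bot_eq_zero hi), hB.col_top_eq_zero hi] at h
  refine hθ.column_eq_zero hlam hmu ?_ h
  have := sigma_nonneg (s.Xb k) i
  positivity

theorem IsRun.col_V_eq_zero (hs : IsRun f θ Lf lam mu rho lgam1 lgam2 s) (hθ : IsPenalty θ)
    (hrn : r ≤ n) (hnm : n ≤ m) (hlam : 0 < lam) (hmu : 0 < mu) {k : ℕ} (hg : 0 < s.gam2 k)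
    {i : Fin r} (hi : (s.Xh (k + 1)).rank ≤ i) : col (s.V (k + 1)) i = 0 := by
  have h := hs.V_column_min hθ hrn hnm k i
  have hB := hs.balanced_hat hrn hnm k
  rw [col_mul _ _ _ (hB.col_top_eq_zero hi), hB.col_bot_eq_zero hi] at h
  refine hθ.column_eq_zero hlam hmu ?_ h
  have := sigma_nonneg (s.Xh (k + 1)) i
  positivity

/-- The column problem, divided by λ, is a proximal problem with parameter λ/(a + μ), which is at
least λ/β. -/
theorem column_norm_ge {E : Type*} [NormedAddCommGroup E] [InnerProductSpace ℝ E]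
    {a β c : ℝ} {g w₀ x : E} (hlam : 0 < lam) (hpos : 0 < a + mu) (hβ : a + mu ≤ β)
    (hgap : ∀ γ, lam / β ≤ γ → ∀ t, 0 ≤ t → ∀ x, 0 < x →
      (∀ y, 0 ≤ y →
        1 / (2 * γ) * (t - x) ^ 2 + pen θ x ≤ 1 / (2 * γ) * (t - y) ^ 2 + pen θ y) → c ≤ x)
    (h : ∀ y, columnObjective θ lam mu a g w₀ x ≤ columnObjective θ lam mu a g w₀ y)
    (hx : x ≠ 0) : c ≤ ‖x‖ := by
  obtain ⟨t, ht, hmin⟩ := column_norm_mem_prox hpos h hx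
  refine hgap (lam / (a + mu)) (div_le_div_of_nonneg_left hlam.le hpos hβ) t ht ‖x‖
    (norm_pos_iff.2 hx) fun y hy => ?_
  have e : ∀ z : ℝ, 1 / (2 * (lam / (a + mu))) * z = lam⁻¹ * ((a + mu) / 2 * z) := by
    intro z
    field_simp
  have h2 := mul_le_mul_of_nonneg_left (hmin y hy) (inv_pos.2 hlam).le
  rw [mul_add, mul_add, inv_mul_cancel_left₀ hlam.ne', inv_mul_cancel_left₀ hlam.ne'] at h2
  rw [e, e]
  exact h2

end Run

end

end PAMA

namespace PAMA

noncomputable section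

/-! ### Descent, boundedness and stabilization of the rank -/

section Run

variable {n m r : ℕ} {f : Matrix (Fin n) (Fin m) ℝ → ℝ} {Lf : ℝ≥0} {θ : ℝ → EReal}
  {lam mu rho lgam1 lgam2 : ℝ} {s : Sequences n m r}

theorem gam_ge_min {g : ℕ → ℝ} {lg : ℝ} (h : ∀ k, g (k + 1) = max lg (rho * g k)) (k : ℕ) :
    min lg (g 0) ≤ g k := by
  cases k with
  | zero => exact min_le_right _ _
  | succ k => rw [h]; exact (min_le_left _ _).trans (le_max_left _ _)

theorem IsRun.exists_decrease (hs : IsRun f θ Lf lam mu rho lgam1 lgam2 s) (hθ : IsPenalty θ)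
    (hrn : r ≤ n) (hnm : n ≤ m) (hA : FactorizationOptimal n m r hrn (hrn.trans hnm) θ)
    (hf : Differentiable ℝ f) (hL : LipschitzWith Lf (matGrad f)) (hlam : 0 < lam) (hmu : 0 < mu)
    (hl1 : 0 < lgam1) (hl2 : 0 < lgam2) : ∃ c : ℝ, 0 < c ∧ ∀ k,
      objR f θ lam mu (s.Ub (k + 1)) (s.Vb (k + 1)) +
        c * (‖s.U (k + 1) - s.Ub k‖ ^ 2 + ‖s.V (k + 1) - s.Vh (k + 1)‖ ^ 2) ≤
      objR f θ lam mu (s.Ub k) (s.Vb k) := by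
  set c₁ := min lgam1 (s.gam1 0) with hc₁
  set c₂ := min lgam2 (s.gam2 0) with hc₂
  have h1 : 0 < c₁ := lt_min hl1 hs.gam1_zero
  have h2 : 0 < c₂ := lt_min hl2 hs.gam2_zero
  refine ⟨min c₁ c₂ / 2, half_pos (lt_min h1 h2), fun k => ?_⟩
  have d1 := hs.decrease_top hθ hrn hnm hA hf hL hlam hmu k
  have d2 := hs.decrease_bot hθ hrn hnm hA hf hL hlam hmu k
  have g1 : min c₁ c₂ ≤ s.gam1 k := (min_le_left _ _).trans (gam_ge_min hs.gam1_succ k)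
  have g2 : min c₁ c₂ ≤ s.gam2 k := (min_le_right _ _).trans (gam_ge_min hs.gam2_succ k)
  have m1 := mul_le_mul_of_nonneg_right g1 (sq_nonneg ‖s.U (k + 1) - s.Ub k‖)
  have m2 := mul_le_mul_of_nonneg_right g2 (sq_nonneg ‖s.V (k + 1) - s.Vh (k + 1)‖)
  linarith

/-- The quadratic term is coercive and everything else is bounded below. -/
theorem norms_le_of_objR_le (hθ : IsPenalty θ) (hlam : 0 < lam) (hmu : 0 < mu) {B H : ℝ}
    (hB : ∀ X, B ≤ f X) {U : Matrix (Fin n) (Fin r) ℝ} {V : Matrix (Fin m) (Fin r) ℝ}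
    (h : objR f θ lam mu U V ≤ H) :
    ‖U‖ ≤ √(2 * (H - B) / mu) ∧ ‖V‖ ≤ √(2 * (H - B) / mu) := by
  have h1 := hB (U * Vᵀ)
  have h2 := mul_nonneg hlam.le (add_nonneg (hθ.penSum_nonneg U) (hθ.penSum_nonneg V))
  have h3 : ‖U‖ ^ 2 + ‖V‖ ^ 2 ≤ 2 * (H - B) / mu := by
    rw [le_div_iff₀ hmu]
    unfold objR at h
    linarith
  constructor
  · exact Real.le_sqrt_of_sq_le (by linarith [sq_nonneg ‖V‖])
  · exact Real.le_sqrt_of_sq_le (by linarith [sq_nonneg ‖U‖])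

theorem objR_ge (hθ : IsPenalty θ) (hlam : 0 < lam) (hmu : 0 < mu) {B : ℝ} (hB : ∀ X, B ≤ f X)
    (U : Matrix (Fin n) (Fin r) ℝ) (V : Matrix (Fin m) (Fin r) ℝ) : B ≤ objR f θ lam mu U V := by
  have h1 := hB (U * Vᵀ)
  have h2 := mul_nonneg hlam.le (add_nonneg (hθ.penSum_nonneg U) (hθ.penSum_nonneg V))
  have h3 : 0 ≤ mu / 2 * (‖U‖ ^ 2 + ‖V‖ ^ 2) := by positivity
  unfold objR
  linarith

theorem tendsto_zero_of_decrease {H a : ℕ → ℝ} {B c : ℝ} (hc : 0 < c) (hB : ∀ k, B ≤ H k)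
    (h : ∀ k, H (k + 1) + c * a k ^ 2 ≤ H k) (ha : ∀ k, 0 ≤ a k) : Tendsto a atTop (𝓝 0) := by
  have hanti : Antitone H := antitone_nat_of_succ_le fun k => by
    have := h k
    have : 0 ≤ c * a k ^ 2 := by positivity
    linarith
  have hlim : Tendsto H atTop (𝓝 (⨅ k, H k)) :=
    tendsto_atTop_ciInf hanti ⟨B, by rintro _ ⟨k, rfl⟩; exact hB k⟩
  have h1 : Tendsto (fun k => (H k - H (k + 1)) / c) atTop (𝓝 0) := by
    have := (hlim.sub (hlim.comp (tendsto_add_atTop_nat 1))).div_const c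
    simpa using this
  have h2 : Tendsto (fun k => a k ^ 2) atTop (𝓝 0) := by
    refine squeeze_zero (fun k => sq_nonneg _) (fun k => ?_) h1
    rw [le_div_iff₀ hc]
    linarith [h k]
  have h3 := (Real.continuous_sqrt.tendsto 0).comp h2
  rw [Real.sqrt_zero] at h3
  refine h3.congr fun k => ?_
  simp [Real.sqrt_sq (ha k)]

/-- Properties of the iterates that hold from some index on. -/
structure TailBounds (s : Sequences n m r) (c C : ℝ) (R K : ℕ) : Prop where
  rank_Xb : ∀ k ≥ K, (s.Xb k).rank = R
  col_U : ∀ k ≥ K, ∀ i : Fin r, (i : ℕ) < R → c ≤ ‖col (s.U (k + 1)) i‖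
  col_V : ∀ k ≥ K, ∀ i : Fin r, (i : ℕ) < R → c ≤ ‖col (s.V (k + 1)) i‖
  sigma_Xb : ∀ k ≥ K, ∀ i : Fin r, (i : ℕ) < R → c ≤ √(sigma (s.Xb k) i)
  sigma_Xh : ∀ k ≥ K, ∀ i : Fin r, (i : ℕ) < R → c ≤ √(sigma (s.Xh (k + 1)) i)
  norm_Ub : ∀ k ≥ K, ‖s.Ub k‖ ≤ C
  norm_Vb : ∀ k ≥ K, ‖s.Vb k‖ ≤ C
  norm_Uh : ∀ k ≥ K, ‖s.Uh (k + 1)‖ ≤ C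
  norm_U : ∀ k ≥ K, ‖s.U (k + 1)‖ ≤ C
  norm_V : ∀ k ≥ K, ‖s.V (k + 1)‖ ≤ C

theorem exists_eventually_eq_of_antitone {g : ℕ → ℕ} (h : Antitone g) :
    ∃ R K, ∀ k ≥ K, g k = R := by
  obtain ⟨K, hK⟩ := WellFounded.has_min wellFounded_lt (Set.range g) ⟨g 0, 0, rfl⟩
  obtain ⟨⟨k₀, rfl⟩, hmin⟩ := hK
  exact ⟨g k₀, k₀, fun k hk => le_antisymm (h hk) (not_lt.1 (hmin _ ⟨k, rfl⟩))⟩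

theorem IsRun.tendsto_steps (hs : IsRun f θ Lf lam mu rho lgam1 lgam2 s) (hθ : IsPenalty θ)
    (hrn : r ≤ n) (hnm : n ≤ m) (hA : FactorizationOptimal n m r hrn (hrn.trans hnm) θ)
    (hf : Differentiable ℝ f) (hL : LipschitzWith Lf (matGrad f)) (hlam : 0 < lam) (hmu : 0 < mu)
    (hl1 : 0 < lgam1) (hl2 : 0 < lgam2) (hbdd : BddBelow (Set.range f)) :
    Tendsto (fun k => ‖s.U (k + 1) - s.Ub k‖) atTop (𝓝 0) ∧
      Tendsto (fun k => ‖s.V (k + 1) - s.Vh (k + 1)‖) atTop (𝓝 0) := by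
  obtain ⟨c, hc, hdec⟩ := hs.exists_decrease hθ hrn hnm hA hf hL hlam hmu hl1 hl2
  obtain ⟨B, hB⟩ := hbdd
  have hB' : ∀ X, B ≤ f X := fun X => hB ⟨X, rfl⟩
  constructor
  · refine tendsto_zero_of_decrease (H := fun k => objR f θ lam mu (s.Ub k) (s.Vb k)) hc
      (fun k => objR_ge hθ hlam hmu hB' _ _) (fun k => ?_) fun k => norm_nonneg _
    have := hdec k
    have : 0 ≤ c * ‖s.V (k + 1) - s.Vh (k + 1)‖ ^ 2 := by positivity
    linarith
  · refine tendsto_zero_of_decrease (H := fun k => objR f θ lam mu (s.Ub k) (s.Vb k)) hc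
      (fun k => objR_ge hθ hlam hmu hB' _ _) (fun k => ?_) fun k => norm_nonneg _
    have := hdec k
    have : 0 ≤ c * ‖s.U (k + 1) - s.Ub k‖ ^ 2 := by positivity
    linarith

/-- Once the rank R is constant, the columns of U^{k+1} past R vanish, so its first R columns must
all be nonzero to support a product of rank R. The proximal gap bounds them below, and vanishing
steps transfer this to the balanced factors, whose column norms are square roots of singular values.
-/
theorem IsRun.exists_tailBounds (hs : IsRun f θ Lf lam mu rho lgam1 lgam2 s) (hθ : IsPenalty θ)
    (hr : 1 ≤ r) (hrn : r ≤ n) (hnm : n ≤ m)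
    (hA : FactorizationOptimal n m r hrn (hrn.trans hnm) θ)
    (hf : Differentiable ℝ f) (hL : LipschitzWith Lf (matGrad f)) (hlam : 0 < lam) (hmu : 0 < mu)
    (hl1 : 0 < lgam1) (hl2 : 0 < lgam2) (hbdd : BddBelow (Set.range f)) {β : ℝ}
    (hβ : IsScalingBound Lf mu s β) (hA2 : ProxGap θ (lam / β) (lam / (mu + min lgam1 lgam2))) :
    ∃ c C R K, 0 < c ∧ TailBounds s c C R K := by
  obtain ⟨ta, tb⟩ := hs.tendsto_steps hθ hrn hnm hA hf hL hlam hmu hl1 hl2 hbdd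
  obtain ⟨c₁, hc₁, hdec⟩ := hs.exists_decrease hθ hrn hnm hA hf hL hlam hmu hl1 hl2
  obtain ⟨B, hB⟩ := hbdd
  have hB' : ∀ X, B ≤ f X := fun X => hB ⟨X, rfl⟩
  have g1 : ∀ k, 0 < s.gam1 k := fun k => (gam_bounds hs.gam1_zero hl1 hs.gam1_succ k).1
  have g2 : ∀ k, 0 < s.gam2 k := fun k => (gam_bounds hs.gam2_zero hl2 hs.gam2_succ k).1
  have hanti : Antitone fun k => objR f θ lam mu (s.Ub k) (s.Vb k) :=
    antitone_nat_of_succ_le fun k => by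
      have h1 := hdec k
      have h2 : 0 ≤ c₁ * (‖s.U (k + 1) - s.Ub k‖ ^ 2 + ‖s.V (k + 1) - s.Vh (k + 1)‖ ^ 2) := by
        positivity
      linarith
  have hH : ∀ k, objR f θ lam mu (s.Ub k) (s.Vb k) ≤ objR f θ lam mu (s.Ub 0) (s.Vb 0) :=
    fun k => hanti (Nat.zero_le k)
  have hHh : ∀ k, objR f θ lam mu (s.Uh (k + 1)) (s.Vh (k + 1)) ≤
      objR f θ lam mu (s.Ub 0) (s.Vb 0) := fun k => by
    have h1 := hs.decrease_top hθ hrn hnm hA hf hL hlam hmu k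
    have h2 : 0 ≤ s.gam1 k / 2 * ‖s.U (k + 1) - s.Ub k‖ ^ 2 := by
      have := g1 k
      positivity
    linarith [hH k]
  set C₀ := √(2 * (objR f θ lam mu (s.Ub 0) (s.Vb 0) - B) / mu)
  have nb := fun k => norms_le_of_objR_le hθ hlam hmu hB' (hH k)
  have nh := fun k => norms_le_of_objR_le hθ hlam hmu hB' (hHh k)
  -- the uniform lower bound for the nonzero columns
  have hβ1 := (hβ 1 ⟨0, hr⟩).1
  -- Index 1 is used because the initial proximal parameter may lie below its later lower bound. The
  -- inequality makes the parameter interval of (A2) contain λ/β.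
  have hβ0 : mu + min lgam1 lgam2 ≤ β := by
    have h1 := (gam_bounds hs.gam1_zero hl1 hs.gam1_succ 0).2
    have h2 : 0 ≤ (Lf : ℝ) * s.Db 1 ⟨0, hr⟩ ⟨0, hr⟩ ^ 2 := by positivity
    have h3 := min_le_left lgam1 lgam2
    simp only [zero_add] at h1
    linarith
  have hmin0 : 0 < mu + min lgam1 lgam2 := add_pos hmu (lt_min hl1 hl2)
  have hβpos : 0 < β := hmin0.trans_le hβ0
  obtain ⟨c, hc, hgap⟩ := hθ.exists_prox_gap (div_le_div_of_nonneg_left hlam.le hmin0 hβ0)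
    (div_pos hlam hβpos) hA2
  have cU : ∀ k i, col (s.U (k + 1)) i ≠ 0 → c ≤ ‖col (s.U (k + 1)) i‖ := by
    intro k i hne
    have hσ := sigma_nonneg (s.Xb k) i
    have hg := g1 k
    refine column_norm_ge hlam (by positivity) ?_ hgap (hs.U_column_min hθ hrn hnm k i) hne
    have := (hβ k i).1
    rw [← hs.sigma_Xb hrn hnm] at this
    linarith
  have cV : ∀ k i, col (s.V (k + 1)) i ≠ 0 → c ≤ ‖col (s.V (k + 1)) i‖ := by
    intro k i hne
    have hσ := sigma_nonneg (s.Xh (k + 1)) i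
    have hg := g2 k
    refine column_norm_ge hlam (by positivity) ?_ hgap (hs.V_column_min hθ hrn hnm k i) hne
    have := (hβ k i).2
    rw [← hs.sigma_Xh hrn hnm] at this
    linarith
  obtain ⟨R, K₀, hK₀⟩ := exists_eventually_eq_of_antitone
    (g := fun k => (s.Xb k).rank) (antitone_nat_of_succ_le fun k =>
      (hs.rank_Xb_le hrn hnm k).trans (hs.rank_Xh_le hrn hnm k))
  have hrh : ∀ k ≥ K₀, (s.Xh (k + 1)).rank = R := fun k hk => le_antisymm
    ((hs.rank_Xh_le hrn hnm k).trans (hK₀ k hk).le)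
    ((hK₀ (k + 1) (by omega)).ge.trans (hs.rank_Xb_le hrn hnm k))
  have nzU : ∀ k ≥ K₀, ∀ i : Fin r, (i : ℕ) < R → c ≤ ‖col (s.U (k + 1)) i‖ := by
    intro k hk i hi
    refine cU k i fun h0 => ?_
    have h1 := exists_col_eq_zero_of_rank_lt (W := s.U (k + 1)) i hi (fun j hj =>
      hs.col_U_eq_zero hθ hrn hnm hlam hmu (g1 k) (by rw [hK₀ k hk]; exact hj)) h0
    have h2 : (s.Xh (k + 1)).rank ≤ (s.U (k + 1)).rank := by
      rw [hs.Xh_eq_mul]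
      exact Matrix.rank_mul_le_left _ _
    rw [hrh k hk] at h2
    omega
  have nzV : ∀ k ≥ K₀, ∀ i : Fin r, (i : ℕ) < R → c ≤ ‖col (s.V (k + 1)) i‖ := by
    intro k hk i hi
    refine cV k i fun h0 => ?_
    have h1 := exists_col_eq_zero_of_rank_lt (W := s.V (k + 1)) i hi (fun j hj =>
      hs.col_V_eq_zero hθ hrn hnm hlam hmu (g2 k) (by rw [hrh k hk]; exact hj)) h0
    have h2 : (s.Xb (k + 1)).rank ≤ (s.V (k + 1)).rank := by
      rw [hs.Xb_eq_mul]
      refine (Matrix.rank_mul_le_right _ _).trans ?_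
      rw [Matrix.rank_transpose]
    rw [hK₀ (k + 1) (by omega)] at h2
    omega
  have hev : ∀ᶠ k in atTop, ‖s.U (k + 1) - s.Ub k‖ < min (c / 2) 1 ∧
      ‖s.V (k + 1) - s.Vh (k + 1)‖ < min (c / 2) 1 := by
    have hpos : 0 < min (c / 2) 1 := by positivity
    exact (ta.eventually_lt_const hpos).and (tb.eventually_lt_const hpos)
  obtain ⟨K₁, hK₁⟩ := eventually_atTop.1 hev
  have hb1 : ∀ k ≥ K₁, ‖s.U (k + 1) - s.Ub k‖ ≤ c / 2 ∧ ‖s.U (k + 1) - s.Ub k‖ ≤ 1 := fun k hk =>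
    ⟨(hK₁ k hk).1.le.trans (min_le_left _ _), (hK₁ k hk).1.le.trans (min_le_right _ _)⟩
  have hb2 : ∀ k ≥ K₁, ‖s.V (k + 1) - s.Vh (k + 1)‖ ≤ c / 2 ∧
      ‖s.V (k + 1) - s.Vh (k + 1)‖ ≤ 1 := fun k hk =>
    ⟨(hK₁ k hk).2.le.trans (min_le_left _ _), (hK₁ k hk).2.le.trans (min_le_right _ _)⟩
  -- Steps of size at most min(c/2, 1) cost half of the lower bound and add 1 to the upper bound.
  refine ⟨c / 2, C₀ + 1, R, max K₀ K₁, half_pos hc, ?_⟩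
  have k0 : ∀ {k}, k ≥ max K₀ K₁ → k ≥ K₀ := fun h => (le_max_left _ _).trans h
  have k1 : ∀ {k}, k ≥ max K₀ K₁ → k ≥ K₁ := fun h => (le_max_right _ _).trans h
  refine
    { rank_Xb := fun k hk => hK₀ k (k0 hk)
      col_U := fun k hk i hi => (half_le_self hc.le).trans (nzU k (k0 hk) i hi)
      col_V := fun k hk i hi => (half_le_self hc.le).trans (nzV k (k0 hk) i hi)
      sigma_Xb := fun k hk i hi => ?_
      sigma_Xh := fun k hk i hi => ?_
      norm_Ub := fun k _ => (nb k).1.trans (by linarith)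
      norm_Vb := fun k _ => (nb k).2.trans (by linarith)
      norm_Uh := fun k _ => (nh k).1.trans (by linarith)
      norm_U := fun k hk => ?_
      norm_V := fun k hk => ?_ }
  · rw [← (hs.balanced_bar hrn hnm k).norm_col_top]
    have h1 := nzU k (k0 hk) i hi
    have h2 := (norm_col_le (s.U (k + 1) - s.Ub k) i).trans (hb1 k (k1 hk)).1
    rw [col_sub] at h2
    have h3 := norm_sub_norm_le (col (s.U (k + 1)) i) (col (s.Ub k) i)
    linarith
  · rw [← (hs.balanced_hat hrn hnm k).norm_col_bot]
    have h1 := nzV k (k0 hk) i hi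
    have h2 := (norm_col_le (s.V (k + 1) - s.Vh (k + 1)) i).trans (hb2 k (k1 hk)).1
    rw [col_sub] at h2
    have h3 := norm_sub_norm_le (col (s.V (k + 1)) i) (col (s.Vh (k + 1)) i)
    linarith
  · have h3 := norm_sub_norm_le (s.U (k + 1)) (s.Ub k)
    linarith [(nb k).1, (hb1 k (k1 hk)).2]
  · have h3 := norm_sub_norm_le (s.V (k + 1)) (s.Vh (k + 1))
    linarith [(nh k).2, (hb2 k (k1 hk)).2]

/-- Singular values are continuous. Along the tail the R-th (counting from 0) is zero and the
earlier ones are at least c², and both facts survive in the limit. -/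
theorem TailBounds.rank_clusterPt {c C : ℝ} {R K : ℕ} (h : TailBounds s c C R K) (hc : 0 < c)
    (hs : IsRun f θ Lf lam mu rho lgam1 lgam2 s) (hrn : r ≤ n) (hnm : n ≤ m)
    {Xs : Matrix (Fin n) (Fin m) ℝ} (hX : MapClusterPt Xs atTop s.Xb) : Xs.rank = R := by
  have hfreq : ∀ ε > 0, ∃ k ≥ K, ∀ i, |sigma (s.Xb k) i - sigma Xs i| < ε := by
    intro ε hε
    have h1 := hX.frequently (Metric.ball_mem_nhds Xs hε)
    obtain ⟨k, hk, hkK⟩ := (h1.and_eventually (eventually_ge_atTop K)).exists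
    refine ⟨k, hkK, fun i => ?_⟩
    rw [dist_eq_norm] at hk
    exact (abs_sigma_sub_le hnm _ _ i).trans_lt hk
  apply le_antisymm
  · by_contra hlt
    push Not at hlt
    have hpos := (sigma_pos_iff Xs R).2 hlt
    obtain ⟨k, hk, hki⟩ := hfreq _ hpos
    have h1 := hki R
    rw [sigma_eq_zero_of_rank_le (s.Xb k) (h.rank_Xb k hk).le, zero_sub, abs_neg,
      abs_of_pos hpos] at h1
    exact lt_irrefl _ h1
  · by_contra hlt
    push Not at hlt
    have hRr : R ≤ r := by
      rw [← h.rank_Xb K le_rfl]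
      exact (hs.balanced_bar hrn hnm K).rank_le
    obtain ⟨k, hk, hki⟩ := hfreq (c ^ 2) (by positivity)
    have h1 := hki Xs.rank
    have h2 := h.sigma_Xb k hk ⟨Xs.rank, hlt.trans_le hRr⟩ hlt
    rw [sigma_eq_zero_of_rank_le Xs le_rfl, sub_zero, abs_of_nonneg (sigma_nonneg _ _)] at h1
    have h3 := pow_le_pow_left₀ hc.le h2 2
    rw [Real.sq_sqrt (sigma_nonneg _ _)] at h3
    simp only at h3
    linarith

end Run

end

end PAMA

namespace PAMA

noncomputable section

/-! ### The relative error bound -/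

theorem norm_inv_smul_sub_le {E : Type*} [NormedAddCommGroup E] [InnerProductSpace ℝ E] {x y : E}
    (hx : x ≠ 0) (hy : y ≠ 0) : ‖‖x‖⁻¹ • x - ‖y‖⁻¹ • y‖ ≤ 2 * ‖x‖⁻¹ * ‖x - y‖ := by
  have hxn := norm_pos_iff.2 hx
  have hyn := norm_pos_iff.2 hy
  have e : ‖x‖⁻¹ • x - ‖y‖⁻¹ • y = ‖x‖⁻¹ • (x - y) + (‖x‖⁻¹ - ‖y‖⁻¹) • y := by
    rw [smul_sub, sub_smul]; abel
  have h1 : ‖(‖x‖⁻¹ - ‖y‖⁻¹) • y‖ = ‖x‖⁻¹ * |‖y‖ - ‖x‖| := by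
    rw [norm_smul, Real.norm_eq_abs, inv_sub_inv hxn.ne' hyn.ne', abs_div, abs_mul, abs_norm,
      abs_norm]
    field_simp
  have h2 : |‖y‖ - ‖x‖| ≤ ‖x - y‖ := by
    rw [norm_sub_rev]
    exact abs_norm_sub_norm_le y x
  have h3 := mul_le_mul_of_nonneg_left h2 (inv_pos.2 hxn).le
  rw [e]
  refine (norm_add_le _ _).trans ?_
  rw [h1, norm_smul, norm_inv, norm_norm]
  linarith

/-- On an annulus, θ'(‖x‖) is Lipschitz and bounded by compactness, and x/‖x‖ is Lipschitz because
the norm is bounded below. One constant serves all dimensions, hence both factors. -/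
theorem exists_radial_lipschitz {θ : ℝ → EReal}
    (hθ : LocallyLipschitzOn (Set.Ioi 0) (penaltyDeriv θ)) {c : ℝ} (hc : 0 < c) (C : ℝ) :
    ∃ K : ℝ, 0 ≤ K ∧ ∀ {l : ℕ} (x y : EuclideanSpace ℝ (Fin l)), c ≤ ‖x‖ → ‖x‖ ≤ C → c ≤ ‖y‖ →
      ‖y‖ ≤ C → ‖radial θ x - radial θ y‖ ≤ K * ‖x - y‖ := by
  have hsub : Set.Icc c C ⊆ Set.Ioi 0 := fun t ht => hc.trans_le ht.1
  obtain ⟨L, hL⟩ := (hθ.mono hsub).exists_lipschitzOnWith_of_compact isCompact_Icc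
  -- The maximum with 0 keeps the constant nonnegative when C < c, where the annulus is empty.
  refine ⟨L + (|penaltyDeriv θ c| + L * (C - c) ⊔ 0) * (2 * c⁻¹), by positivity, ?_⟩
  intro l x y hx hx' hy hy'
  have hx0 : x ≠ 0 := norm_pos_iff.1 (hc.trans_le hx)
  have hy0 : y ≠ 0 := norm_pos_iff.1 (hc.trans_le hy)
  have h1 : |penaltyDeriv θ ‖x‖ - penaltyDeriv θ ‖y‖| ≤ L * ‖x - y‖ := by
    have := hL.dist_le_mul ‖x‖ ⟨hx, hx'⟩ ‖y‖ ⟨hy, hy'⟩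
    rw [Real.dist_eq, Real.dist_eq] at this
    exact this.trans (mul_le_mul_of_nonneg_left (abs_norm_sub_norm_le x y) L.2)
  have h2 : |penaltyDeriv θ ‖y‖| ≤ |penaltyDeriv θ c| + L * (C - c) := by
    have := hL.dist_le_mul ‖y‖ ⟨hy, hy'⟩ c ⟨le_rfl, hy.trans hy'⟩
    rw [Real.dist_eq, Real.dist_eq, abs_of_nonneg (by linarith : 0 ≤ ‖y‖ - c)] at this
    have h3 := abs_sub_abs_le_abs_sub (penaltyDeriv θ ‖y‖) (penaltyDeriv θ c)
    have h4 : (L : ℝ) * (‖y‖ - c) ≤ L * (C - c) :=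
      mul_le_mul_of_nonneg_left (by linarith) L.2
    linarith
  have h3 : ‖‖x‖⁻¹ • x - ‖y‖⁻¹ • y‖ ≤ 2 * c⁻¹ * ‖x - y‖ := by
    refine (norm_inv_smul_sub_le hx0 hy0).trans ?_
    have : ‖x‖⁻¹ ≤ c⁻¹ := inv_anti₀ hc hx
    exact mul_le_mul_of_nonneg_right (by linarith) (norm_nonneg _)
  have e : radial θ x - radial θ y =
      (penaltyDeriv θ ‖x‖ - penaltyDeriv θ ‖y‖) • (‖x‖⁻¹ • x) +
        penaltyDeriv θ ‖y‖ • (‖x‖⁻¹ • x - ‖y‖⁻¹ • y) := by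
    rw [radial, radial, sub_smul, smul_sub, smul_smul, smul_smul, smul_smul, ← div_eq_mul_inv,
      ← div_eq_mul_inv]
    abel
  have h4 : ‖‖x‖⁻¹ • x‖ = 1 := by
    rw [norm_smul, norm_inv, norm_norm, inv_mul_cancel₀ (norm_ne_zero_iff.2 hx0)]
  rw [e]
  refine (norm_add_le _ _).trans ?_
  rw [norm_smul (_ - _), norm_smul (penaltyDeriv θ ‖y‖), h4, mul_one, Real.norm_eq_abs,
    Real.norm_eq_abs]
  have h5 : |penaltyDeriv θ ‖y‖| ≤ |penaltyDeriv θ c| + L * (C - c) ⊔ 0 :=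
    h2.trans (add_le_add le_rfl (le_max_left _ _))
  have h6 := mul_le_mul h5 h3 (norm_nonneg _) (by positivity)
  have e2 : ((L : ℝ) + (|penaltyDeriv θ c| + L * (C - c) ⊔ 0) * (2 * c⁻¹)) * ‖x - y‖ =
    L * ‖x - y‖ + (|penaltyDeriv θ c| + L * (C - c) ⊔ 0) * (2 * c⁻¹ * ‖x - y‖) := by ring
  rw [e2]
  exact add_le_add h1 h6

/-- A stationarity relation at one pair of factors bounds the gradient column at a nearby pair. -/
theorem norm_col_grad_le {l p r : ℕ} {θ : ℝ → EReal} {lam mu : ℝ} (hlam : 0 < lam) (hmu : 0 < mu)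
    {c C K D Γ L β a x : ℝ} (hD : 0 ≤ D) (hC : 0 ≤ C) (hK0 : 0 ≤ K) (hΓ : 0 ≤ Γ) (hL : 0 ≤ L)
    (hx : 0 ≤ x)
    (hK : ∀ y z : EuclideanSpace ℝ (Fin l), c ≤ ‖y‖ → ‖y‖ ≤ C → c ≤ ‖z‖ → ‖z‖ ≤ C →
      ‖radial θ y - radial θ z‖ ≤ K * ‖y - z‖)
    {G G' : Matrix (Fin l) (Fin p) ℝ} {V V' : Matrix (Fin p) (Fin r) ℝ}
    {W U U' : Matrix (Fin l) (Fin r) ℝ} (i : Fin r)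
    (hopt : col (G * V) i + a • (col W i - col U i) + mu • col W i + lam • radial θ (col W i) = 0)
    (hG : ‖G' - G‖ ≤ L * x) (hGΓ : ‖G‖ ≤ Γ) {ε : ℝ} (hε : ε = 1 ∨ ε = -1)
    (hV' : ‖col V' i‖ ≤ C) (hVV : ‖col V' i - ε • col V i‖ ≤ D * x)
    (hUU : ‖col U' i - ε • col U i‖ ≤ D * x) (hW : c ≤ ‖col W i‖) (hWC : ‖col W i‖ ≤ C)
    (hU : c ≤ ‖col U' i‖) (hUC : ‖col U' i‖ ≤ C) (ha0 : 0 ≤ a) (ha : a ≤ β) :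
    ‖col (G' * V' + mu • U' + lam • radialMat θ U') i‖ ≤
      (L * C + Γ * D + (mu + lam * K) * (D + 1) + β) * (x + ‖col W i - col U i‖) := by
  set y := ‖col W i - col U i‖ with hy
  have hy0 : 0 ≤ y := norm_nonneg _
  have hεn : ∀ z : EuclideanSpace ℝ (Fin l), ‖ε • z‖ = ‖z‖ := by
    intro z
    rcases hε with rfl | rfl <;> simp
  have n1 : ‖col (G' * V') i - ε • col (G * V) i‖ ≤ L * x * C + Γ * (D * x) := by
    have e : G' * V' - ε • (G * V) = (G' - G) * V' + G * (V' - ε • V) := by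
      rw [Matrix.sub_mul, Matrix.mul_sub, Matrix.mul_smul]; abel
    have e2 : col (G' * V') i - ε • col (G * V) i =
        col ((G' - G) * V') i + col (G * (V' - ε • V)) i := by
      rw [← col_smul, ← col_sub, e, col_add]
    rw [e2]
    refine (norm_add_le _ _).trans (add_le_add ?_ ?_)
    · exact (norm_col_mul_le _ _ _).trans (mul_le_mul hG hV' (norm_nonneg _) (by positivity))
    · exact (norm_col_mul_le _ _ _).trans (mul_le_mul hGΓ hVV (norm_nonneg _) hΓ)
  have n2 : ‖col U' i - ε • col W i‖ ≤ D * x + y := by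
    have e : col U' i - ε • col W i =
        (col U' i - ε • col U i) - ε • (col W i - col U i) := by
      rw [smul_sub]; abel
    rw [e]
    refine (norm_sub_le _ _).trans ?_
    rw [hεn]
    linarith
  have n3 : ‖radial θ (col U' i) - radial θ (ε • col W i)‖ ≤ K * (D * x + y) :=
    (hK _ _ hU hUC (by rw [hεn]; exact hW) (by rw [hεn]; exact hWC)).trans
      (mul_le_mul_of_nonneg_left n2 hK0)
  have n4 : ‖(ε * a) • (col W i - col U i)‖ ≤ β * y := by
    rw [mul_smul, hεn, norm_smul, Real.norm_of_nonneg ha0]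
    exact mul_le_mul_of_nonneg_right ha hy0
  -- Subtracting ε times the stationarity relation leaves only differences of nearby quantities and
  -- the proximal residual; oddness of the radial gradient lets ε pass inside.
  have e : col (G' * V' + mu • U' + lam • radialMat θ U') i =
      (col (G' * V') i - ε • col (G * V) i) + mu • (col U' i - ε • col W i) +
        lam • (radial θ (col U' i) - radial θ (ε • col W i)) -
        (ε * a) • (col W i - col U i) := by
    have h1 := congrArg (fun z => ε • z) hopt
    simp only [smul_add, smul_zero] at h1
    rw [col_add, col_add, col_smul, col_smul, col_radialMat, radial_sign θ hε, ← sub_zero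
      (col (G' * V') i + mu • col U' i + lam • radial θ (col U' i)), ← h1]
    simp only [smul_sub, mul_smul, smul_comm ε]
    abel
  rw [e]
  refine (norm_sub_le _ _).trans ?_
  refine (add_le_add (norm_add₃_le) n4).trans ?_
  rw [norm_smul, norm_smul, Real.norm_of_nonneg hlam.le, Real.norm_of_nonneg hmu.le]
  have m2 := mul_le_mul_of_nonneg_left n2 hmu.le
  have m3 := mul_le_mul_of_nonneg_left n3 hlam.le
  have hβ : 0 ≤ β := ha0.trans ha
  have t1 : 0 ≤ (L * C + Γ * D) * y := by positivity
  have t2 : 0 ≤ (mu + lam * K) * x := by positivity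
  have t3 : 0 ≤ (mu + lam * K) * (D * y) := by positivity
  have t4 : 0 ≤ β * x := by positivity
  nlinarith

theorem norm_le_of_col_le {l r R : ℕ} {A : Matrix (Fin l) (Fin r) ℝ} {M : ℝ} (hM : 0 ≤ M)
    (h : ∀ i : Fin r, (i : ℕ) < R → ‖col A i‖ ≤ M) (h0 : ∀ i : Fin r, R ≤ i → col A i = 0) :
    ‖A‖ ≤ r * M := by
  refine (norm_le_sum_norm_col A).trans ?_
  have : ∀ i ∈ Finset.univ, ‖col A i‖ ≤ M := by
    intro i _
    rcases lt_or_ge (i : ℕ) R with hi | hi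
    · exact h i hi
    · rw [h0 i hi, norm_zero]; exact hM
  simpa using Finset.sum_le_card_nsmul Finset.univ _ M this

section Run

variable {n m r : ℕ} {f : Matrix (Fin n) (Fin m) ℝ → ℝ} {Lf : ℝ≥0} {θ : ℝ → EReal}
  {lam mu rho lgam1 lgam2 : ℝ} {s : Sequences n m r}

/-- Both factors vanish in this column, and the subgradient chosen for the penalty at 0 is 0, so
zero columns contribute nothing to the error. -/
theorem Balanced.col_gradTop_eq_zero {hrn : r ≤ n} {hnm : n ≤ m} {X : Matrix (Fin n) (Fin m) ℝ}
    {U : Matrix (Fin n) (Fin r) ℝ} {V : Matrix (Fin m) (Fin r) ℝ} (h : Balanced hrn hnm X U V)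
    {i : Fin r} (hi : X.rank ≤ i) : col (gradTop f θ lam mu U V) i = 0 := by
  rw [gradTop, col_add, col_add, col_smul, col_smul, col_radialMat, h.col_top_eq_zero hi,
    col_mul _ _ _ (h.col_bot_eq_zero hi), radial_zero]
  simp

theorem Balanced.col_gradBot_eq_zero {hrn : r ≤ n} {hnm : n ≤ m} {X : Matrix (Fin n) (Fin m) ℝ}
    {U : Matrix (Fin n) (Fin r) ℝ} {V : Matrix (Fin m) (Fin r) ℝ} (h : Balanced hrn hnm X U V)
    {i : Fin r} (hi : X.rank ≤ i) : col (gradBot f θ lam mu U V) i = 0 := by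
  rw [gradBot, col_add, col_add, col_smul, col_smul, col_radialMat, h.col_bot_eq_zero hi,
    col_mul _ _ _ (h.col_top_eq_zero hi), radial_zero]
  simp

-- Each half of the subgradient is compared with the optimality condition of its own half step: the
-- first with the pair at X̄^k, the second with the pair at X̂^{k+1}. The SVD perturbation bound
-- supplies the signs column by column.
set_option maxHeartbeats 800000 in
theorem IsRun.exists_relative_error (hs : IsRun f θ Lf lam mu rho lgam1 lgam2 s) (hθ : IsPenalty θ)
    (hrn : r ≤ n) (hnm : n ≤ m)
    (hL : LipschitzWith Lf (matGrad f)) (hlam : 0 < lam) (hmu : 0 < mu)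
    (hl1 : 0 < lgam1) (hl2 : 0 < lgam2) {β : ℝ} (hβ : IsScalingBound Lf mu s β)
    (hθ' : LocallyLipschitzOn (Set.Ioi 0) (penaltyDeriv θ))
    {c C : ℝ} {R K : ℕ} (hc : 0 < c) (hT : TailBounds s c C R K)
    {Xs : Matrix (Fin n) (Fin m) ℝ} {δ : ℝ} (hδ : 0 < δ)
    (hgaps : ∀ i j : ℕ, i < j → j ≤ R → 2 * δ ≤ sigma Xs i - sigma Xs j) :
    ∃ cs : ℝ, 0 < cs ∧ ∀ k ≥ K, s.Xb k ∈ Metric.closedBall Xs δ →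
      s.Xh (k + 1) ∈ Metric.closedBall Xs δ → s.Xb (k + 1) ∈ Metric.closedBall Xs δ →
      ‖gradTop f θ lam mu (s.Ub (k + 1)) (s.Vb (k + 1))‖ +
        ‖gradBot f θ lam mu (s.Ub (k + 1)) (s.Vb (k + 1))‖ ≤
      cs * (‖s.Xb (k + 1) - s.Xb k‖ + ‖s.Xh (k + 1) - s.Xb k‖) +
        cs * (‖s.U (k + 1) - s.Ub k‖ + ‖s.V (k + 1) - s.Vh (k + 1)‖) := by
  obtain ⟨Kl, hKl0, hKl⟩ := exists_radial_lipschitz hθ' hc C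
  have hC : 0 ≤ C := (norm_nonneg _).trans (hT.norm_Ub K le_rfl)
  set D := 1 / c + C * (2 / δ) with hD
  have hD0 : 0 ≤ D := by positivity
  set Γ := ‖matGrad f Xs‖ + Lf * δ with hΓ
  have hΓ0 : 0 ≤ Γ := by positivity
  have hΓb : ∀ X ∈ Metric.closedBall Xs δ, ‖matGrad f X‖ ≤ Γ := by
    intro X hX
    have h1 := hL.dist_le_mul X Xs
    rw [dist_eq_norm] at h1
    have h2 := mul_le_mul_of_nonneg_left (Metric.mem_closedBall.1 hX) Lf.2
    have h3 := norm_sub_norm_le (matGrad f X) (matGrad f Xs)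
    simp only [NNReal.val_eq_coe] at h2
    linarith
  have g1 : ∀ k, 0 < s.gam1 k := fun k => (gam_bounds hs.gam1_zero hl1 hs.gam1_succ k).1
  have g2 : ∀ k, 0 < s.gam2 k := fun k => (gam_bounds hs.gam2_zero hl2 hs.gam2_succ k).1
  set M := (Lf : ℝ) * C + Γ * D + (mu + lam * Kl) * (D + 1) + |β| with hM
  have hM0 : 0 ≤ M := by positivity
  -- At most r columns contribute, each with constant M. The 2 appears since ‖X̄^{k+1} − X̄^k‖
  -- enters once directly and once through ‖X̄^{k+1} − X̂^{k+1}‖; the 1 ensures positivity.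
  refine ⟨2 * (r * M) + 1, by positivity, fun k hk hX hXh hX' => ?_⟩
  have hB := hs.balanced_bar hrn hnm k
  have hBh := hs.balanced_hat hrn hnm k
  have hB' := hs.balanced_bar hrn hnm (k + 1)
  set x := ‖s.Xb (k + 1) - s.Xb k‖ with hx
  set z := ‖s.Xb (k + 1) - s.Xh (k + 1)‖ with hz
  set a := ‖s.U (k + 1) - s.Ub k‖ with ha
  set b := ‖s.V (k + 1) - s.Vh (k + 1)‖ with hb
  have hx0 : 0 ≤ x := norm_nonneg _
  have hz0 : 0 ≤ z := norm_nonneg _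
  have ha0 : 0 ≤ a := norm_nonneg _
  have hb0 : 0 ≤ b := norm_nonneg _
  have hk1 : k + 1 ≥ K := by omega
  have colTop : ∀ i : Fin r, (i : ℕ) < R →
      ‖col (gradTop f θ lam mu (s.Ub (k + 1)) (s.Vb (k + 1))) i‖ ≤ M * (x + a) := by
    intro i hi
    have hσ := hT.sigma_Xb k hk i hi
    obtain ⟨ε, hε, h1, h2⟩ := hB.exists_sign hδ hgaps hB' hX hX' hc i hi hσ
    have hσC : √(sigma (s.Xb k) i) ≤ C := by
      rw [← hB.norm_col_top]; exact (norm_col_le _ _).trans (hT.norm_Ub k hk)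
    have hDx : (1 / c + √(sigma (s.Xb k) i) * (2 / δ)) * x ≤ D * x :=
      mul_le_mul_of_nonneg_right (add_le_add le_rfl
        (mul_le_mul_of_nonneg_right hσC (by positivity))) hx0
    have hW := hT.col_U k hk i hi
    have hopt := hθ.column_stationary (hs.U_column_min hθ hrn hnm k i)
      (norm_pos_iff.1 (hc.trans_le hW))
    have hlip : ‖matGrad f (s.Xb (k + 1)) - matGrad f (s.Xb k)‖ ≤ Lf * x := by
      have := hL.dist_le_mul (s.Xb (k + 1)) (s.Xb k)
      rwa [dist_eq_norm, dist_eq_norm] at this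
    have hsig := sigma_nonneg (s.Xb k) i
    have hg := g1 k
    have haβ : (Lf : ℝ) * sigma (s.Xb k) i + s.gam1 k ≤ |β| := by
      have := (hβ k i).1
      rw [← hs.sigma_Xb hrn hnm] at this
      linarith [le_abs_self β]
    have hσ' := hT.sigma_Xb (k + 1) hk1 i hi
    rw [← hB'.norm_col_top] at hσ'
    have key := norm_col_grad_le hlam hmu hD0 hC hKl0 hΓ0 Lf.2 hx0 (fun y z => hKl y z) i hopt
      hlip (hΓb _ hX) hε ((norm_col_le _ _).trans (hT.norm_Vb (k + 1) hk1)) (h2.trans hDx)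
      (h1.trans hDx) hW ((norm_col_le _ _).trans (hT.norm_U k hk)) hσ'
      ((norm_col_le _ _).trans (hT.norm_Ub (k + 1) hk1)) (by positivity) haβ
    rw [gradTop, ← hB'.1]
    refine key.trans ?_
    have h5 : ‖col (s.U (k + 1)) i - col (s.Ub k) i‖ ≤ a := by
      rw [← col_sub]; exact norm_col_le _ _
    exact mul_le_mul_of_nonneg_left (by linarith) hM0
  have colBot : ∀ i : Fin r, (i : ℕ) < R →
      ‖col (gradBot f θ lam mu (s.Ub (k + 1)) (s.Vb (k + 1))) i‖ ≤ M * (z + b) := by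
    intro i hi
    have hσ := hT.sigma_Xh k hk i hi
    obtain ⟨ε, hε, h1, h2⟩ := hBh.exists_sign hδ hgaps hB' hXh hX' hc i hi hσ
    have hσC : √(sigma (s.Xh (k + 1)) i) ≤ C := by
      rw [← hBh.norm_col_top]; exact (norm_col_le _ _).trans (hT.norm_Uh k hk)
    have hDx : (1 / c + √(sigma (s.Xh (k + 1)) i) * (2 / δ)) * z ≤ D * z :=
      mul_le_mul_of_nonneg_right (add_le_add le_rfl
        (mul_le_mul_of_nonneg_right hσC (by positivity))) hz0
    have hW := hT.col_V k hk i hi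
    have hopt := hθ.column_stationary (hs.V_column_min hθ hrn hnm k i)
      (norm_pos_iff.1 (hc.trans_le hW))
    have hlip : ‖(matGrad f (s.Xb (k + 1)))ᵀ - (matGrad f (s.Xh (k + 1)))ᵀ‖ ≤ Lf * z := by
      rw [← Matrix.transpose_sub, norm_transpose_frob]
      have := hL.dist_le_mul (s.Xb (k + 1)) (s.Xh (k + 1))
      rwa [dist_eq_norm, dist_eq_norm] at this
    have hsig := sigma_nonneg (s.Xh (k + 1)) i
    have hg := g2 k
    have haβ : (Lf : ℝ) * sigma (s.Xh (k + 1)) i + s.gam2 k ≤ |β| := by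
      have := (hβ k i).2
      rw [← hs.sigma_Xh hrn hnm] at this
      linarith [le_abs_self β]
    have hσ' := hT.sigma_Xb (k + 1) hk1 i hi
    rw [← hB'.norm_col_bot] at hσ'
    have hΓt : ‖(matGrad f (s.Xh (k + 1)))ᵀ‖ ≤ Γ := by
      rw [norm_transpose_frob]; exact hΓb _ hXh
    have key := norm_col_grad_le hlam hmu hD0 hC hKl0 hΓ0 Lf.2 hz0 (fun y z => hKl y z) i hopt
      hlip hΓt hε ((norm_col_le _ _).trans (hT.norm_Ub (k + 1) hk1)) (h1.trans hDx)
      (h2.trans hDx) hW ((norm_col_le _ _).trans (hT.norm_V k hk)) hσ'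
      ((norm_col_le _ _).trans (hT.norm_Vb (k + 1) hk1)) (by positivity) haβ
    rw [gradBot, ← hB'.1]
    refine key.trans ?_
    have h5 : ‖col (s.V (k + 1)) i - col (s.Vh (k + 1)) i‖ ≤ b := by
      rw [← col_sub]; exact norm_col_le _ _
    exact mul_le_mul_of_nonneg_left (by linarith) hM0
  have hrk := hT.rank_Xb (k + 1) hk1
  have nT := norm_le_of_col_le (by positivity) colTop fun i hi =>
    hB'.col_gradTop_eq_zero (by rw [hrk]; exact hi)
  have nB := norm_le_of_col_le (by positivity) colBot fun i hi =>
    hB'.col_gradBot_eq_zero (by rw [hrk]; exact hi)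
  have hzx : z ≤ x + ‖s.Xh (k + 1) - s.Xb k‖ := by
    have e : s.Xb (k + 1) - s.Xh (k + 1) =
        (s.Xb (k + 1) - s.Xb k) - (s.Xh (k + 1) - s.Xb k) := by abel
    rw [hz, e]
    exact norm_sub_le _ _
  set w := ‖s.Xh (k + 1) - s.Xb k‖ with hw
  have hw0 : 0 ≤ w := norm_nonneg _
  set q := (r : ℝ) * M with hq
  have hq0 : 0 ≤ q := by positivity
  have t1 := mul_le_mul_of_nonneg_left hzx hq0
  have e1 : (r : ℝ) * (M * (x + a)) = q * x + q * a := by rw [hq]; ring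
  have e2 : (r : ℝ) * (M * (z + b)) = q * z + q * b := by rw [hq]; ring
  have e3 : (2 * q + 1) * (x + w) + (2 * q + 1) * (a + b) =
      2 * (q * x) + 2 * (q * w) + 2 * (q * a) + 2 * (q * b) + (x + w + a + b) := by ring
  rw [e1] at nT
  rw [e2] at nB
  rw [e3]
  linarith [mul_nonneg hq0 hw0, mul_nonneg hq0 ha0, mul_nonneg hq0 hb0, mul_nonneg hq0 hx0]

end Run

end

end PAMA

namespace PAMA

noncomputable section

/-! ### The Kurdyka-Lojasiewicz argument -/

/-- For a concave function the derivative at the right endpoint is at most the secant slope. Only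
differentiability at s > 0 is needed, so t = 0 is allowed. -/
theorem concave_deriv_mul_sub_le {η : EReal} {φ : ℝ → ℝ}
    (hφ : ConcaveOn ℝ {s : ℝ | 0 ≤ s ∧ (s : EReal) < η} φ)
    (hφ1 : ContDiffOn ℝ 1 φ {s : ℝ | 0 < s ∧ (s : EReal) < η}) {s t : ℝ} (ht : 0 ≤ t) (hts : t ≤ s)
    (hs0 : 0 < s) (hs : (s : EReal) < η) : deriv φ s * (s - t) ≤ φ s - φ t := by
  rcases hts.eq_or_lt with rfl | hlt
  · simp
  have hopen : IsOpen {s : ℝ | 0 < s ∧ (s : EReal) < η} :=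
    (isOpen_lt continuous_const continuous_id).inter
      (isOpen_lt continuous_coe_real_ereal continuous_const)
  have hd : DifferentiableAt ℝ φ s :=
    (hφ1.contDiffAt (hopen.mem_nhds ⟨hs0, hs⟩)).differentiableAt one_ne_zero
  have h := hφ.deriv_le_slope (x := t) (y := s)
    ⟨ht, lt_of_le_of_lt (EReal.coe_le_coe_iff.2 hts) hs⟩ ⟨hs0.le, hs⟩ hlt hd
  rw [slope_def_field] at h
  exact (le_div_iff₀ (sub_pos.2 hlt)).1 h

theorem le_half_add_of_sq_le {d e p : ℝ} (hp : 0 ≤ p) (hd : 0 ≤ d)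
    (h : e ^ 2 ≤ 2 * d * p) : e ≤ d / 2 + p := by
  apply le_of_sq_le_sq _ (by positivity)
  nlinarith [sq_nonneg (d / 2 - p)]

/-- A sequence whose steps are controlled near one of its cluster points stays near that point. -/
theorem eventually_mem_closedBall_of_step {E : Type*} [PseudoMetricSpace E] {Y : ℕ → E} {y : E}
    {d ψ : ℕ → ℝ} {A ρ : ℝ} {K : ℕ} (hA : 0 ≤ A) (hρ : 0 < ρ) (hd0 : ∀ k, 0 ≤ d k)
    (hψ0 : ∀ k ≥ K, 0 ≤ ψ k) (hd : Tendsto d atTop (𝓝 0)) (hψ : Tendsto ψ atTop (𝓝 0))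
    (hY : ∃ᶠ k in atTop, dist (Y k) y < ρ / 2)
    (hstep : ∀ k ≥ K, dist (Y (k + 1)) (Y k) ≤ A * d k)
    (hrec : ∀ k ≥ K, dist (Y k) y ≤ ρ → dist (Y (k + 1)) y ≤ ρ →
      d (k + 1) ≤ d k / 2 + (ψ (k + 1) - ψ (k + 2))) :
    ∃ l, ∀ k ≥ l, dist (Y k) y ≤ ρ := by
  have hlim : Tendsto (fun k => A * (2 * d k + 2 * ψ (k + 1))) atTop (𝓝 0) := by
    have := ((hd.const_mul 2).add ((hψ.comp (tendsto_add_atTop_nat 1)).const_mul 2)).const_mul A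
    simpa using this
  obtain ⟨l, hlY, hlK, hlA⟩ := (hY.and_eventually ((eventually_ge_atTop K).and
    (hlim.eventually_lt_const (half_pos hρ)))).exists
  -- The extra terms d(l + N) and 2ψ make the sum telescope: twice the recursion trades d(l + N) +
  -- 2ψ(l + N + 1) for 2d(l + N + 1) + 2ψ(l + N + 2). Confinement and the length bound must be
  -- proved together, since the recursion holds only inside the ball.
  have main : ∀ N, dist (Y (l + N)) y ≤ ρ ∧
      dist (Y (l + N + 1)) (Y l) ≤ A * ∑ j ∈ Finset.range (N + 1), d (l + j) ∧
      ∑ j ∈ Finset.range (N + 1), d (l + j) + d (l + N) + 2 * ψ (l + N + 1) ≤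
        2 * d l + 2 * ψ (l + 1) := by
    intro N
    induction N with
    | zero =>
      refine ⟨by simpa using hlY.le.trans (half_le_self hρ.le), by simpa using hstep l hlK, ?_⟩
      simp
      linarith
    | succ N ih =>
      obtain ⟨h1, h2, h3⟩ := ih
      have hin : dist (Y (l + (N + 1))) y ≤ ρ := by
        have hd1 := hd0 (l + N)
        have hψ1 := hψ0 (l + N + 1) (by omega)
        have h4 : A * ∑ j ∈ Finset.range (N + 1), d (l + j) ≤ A * (2 * d l + 2 * ψ (l + 1)) :=
          mul_le_mul_of_nonneg_left (by linarith) hA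
        have h5 := dist_triangle (Y (l + N + 1)) (Y l) y
        rw [← add_assoc]
        linarith
      have h6 := hrec (l + N) (by omega) h1 hin
      refine ⟨hin, ?_, ?_⟩
      · have h7 := dist_triangle (Y (l + (N + 1) + 1)) (Y (l + (N + 1))) (Y l)
        have h8 := hstep (l + (N + 1)) (by omega)
        have h2' : dist (Y (l + (N + 1))) (Y l) ≤ A * ∑ j ∈ Finset.range (N + 1), d (l + j) := h2
        rw [Finset.sum_range_succ, mul_add]
        linarith
      · rw [Finset.sum_range_succ]
        have e1 : l + (N + 1) = l + N + 1 := by ring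
        have e2 : l + (N + 1) + 1 = l + N + 2 := by ring
        rw [e2, e1]
        linarith
  refine ⟨l, fun k hk => ?_⟩
  obtain ⟨N, rfl⟩ := Nat.exists_eq_add_of_le hk
  exact (main N).1

/-! ### Sign changes of columns -/

section Signs

variable {n m r : ℕ} {f : Matrix (Fin n) (Fin m) ℝ → ℝ} {θ : ℝ → EReal} {lam mu : ℝ}

theorem radialMat_mul_sign {l : ℕ} (θ : ℝ → EReal) (U : Matrix (Fin l) (Fin r) ℝ) {e : Fin r → ℝ}
    (he : ∀ i, e i = 1 ∨ e i = -1) :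
    radialMat θ (U * Matrix.diagonal e) = radialMat θ U * Matrix.diagonal e := by
  refine col_ext fun i => ?_
  rw [col_radialMat, col_mul_diagonal, col_mul_diagonal, col_radialMat, radial_sign θ (he i)]

theorem diagonal_sign_mul_transpose {e : Fin r → ℝ} (he : ∀ i, e i = 1 ∨ e i = -1) :
    Matrix.diagonal e * (Matrix.diagonal e)ᵀ = (1 : Matrix (Fin r) (Fin r) ℝ) := by
  rw [Matrix.diagonal_transpose, Matrix.diagonal_mul_diagonal, ← Matrix.diagonal_one]
  congr 1
  funext i
  rcases he i with h | h <;> rw [h] <;> norm_num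

theorem norm_mul_sign {l : ℕ} (U : Matrix (Fin l) (Fin r) ℝ) {e : Fin r → ℝ}
    (he : ∀ i, e i = 1 ∨ e i = -1) : ‖U * Matrix.diagonal e‖ = ‖U‖ := by
  have h := norm_mul_right_of_orthonormal (M := Matrix.diagonal e)
    (by rw [Matrix.diagonal_transpose]
        simpa [Matrix.diagonal_transpose] using diagonal_sign_mul_transpose he) U
  rwa [Matrix.diagonal_transpose] at h

theorem mul_sign_mul_transpose (U : Matrix (Fin n) (Fin r) ℝ) (V : Matrix (Fin m) (Fin r) ℝ)
    {e : Fin r → ℝ} (he : ∀ i, e i = 1 ∨ e i = -1) :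
    (U * Matrix.diagonal e) * (V * Matrix.diagonal e)ᵀ = U * Vᵀ := by
  rw [Matrix.transpose_mul, Matrix.mul_assoc, ← Matrix.mul_assoc (Matrix.diagonal e),
    diagonal_sign_mul_transpose he, Matrix.one_mul]

theorem penSum_mul_sign {l : ℕ} (U : Matrix (Fin l) (Fin r) ℝ) {e : Fin r → ℝ}
    (he : ∀ i, e i = 1 ∨ e i = -1) : penSum θ (U * Matrix.diagonal e) = penSum θ U := by
  refine Finset.sum_congr rfl fun i _ => ?_
  rw [col_mul_diagonal, norm_smul]
  rcases he i with h | h <;> rw [h] <;> simp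

/-- Common sign changes of matching columns preserve the product and all column norms; this symmetry
lets the KL inequality be used away from (Ū*, V̄*). -/
theorem objR_mul_sign (U : Matrix (Fin n) (Fin r) ℝ) (V : Matrix (Fin m) (Fin r) ℝ)
    {e : Fin r → ℝ} (he : ∀ i, e i = 1 ∨ e i = -1) :
    objR f θ lam mu (U * Matrix.diagonal e) (V * Matrix.diagonal e) = objR f θ lam mu U V := by
  rw [objR, mul_sign_mul_transpose U V he, norm_mul_sign U he, norm_mul_sign V he,
    penSum_mul_sign U he, penSum_mul_sign V he]
  rfl

theorem norm_gradTop_mul_sign (U : Matrix (Fin n) (Fin r) ℝ) (V : Matrix (Fin m) (Fin r) ℝ)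
    {e : Fin r → ℝ} (he : ∀ i, e i = 1 ∨ e i = -1) :
    ‖gradTop f θ lam mu (U * Matrix.diagonal e) (V * Matrix.diagonal e)‖ =
      ‖gradTop f θ lam mu U V‖ := by
  rw [← norm_mul_sign (gradTop f θ lam mu U V) he, gradTop, gradTop, mul_sign_mul_transpose U V he,
    radialMat_mul_sign θ U he, Matrix.add_mul, Matrix.add_mul, Matrix.smul_mul, Matrix.smul_mul,
    Matrix.mul_assoc]

theorem norm_gradBot_mul_sign (U : Matrix (Fin n) (Fin r) ℝ) (V : Matrix (Fin m) (Fin r) ℝ)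
    {e : Fin r → ℝ} (he : ∀ i, e i = 1 ∨ e i = -1) :
    ‖gradBot f θ lam mu (U * Matrix.diagonal e) (V * Matrix.diagonal e)‖ =
      ‖gradBot f θ lam mu U V‖ := by
  rw [← norm_mul_sign (gradBot f θ lam mu U V) he, gradBot, gradBot, mul_sign_mul_transpose U V he,
    radialMat_mul_sign θ V he, Matrix.add_mul, Matrix.add_mul, Matrix.smul_mul, Matrix.smul_mul,
    Matrix.mul_assoc]

/-- The columnwise signs are assembled into one diagonal matrix acting on both factors; past the
common rank the columns are zero and any sign works. -/
theorem Balanced.exists_sign_matrix {hrn : r ≤ n} {hnm : n ≤ m} {Xs : Matrix (Fin n) (Fin m) ℝ}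
    {R : ℕ} {δ : ℝ} (hδ : 0 < δ)
    (hgaps : ∀ i j : ℕ, i < j → j ≤ R → 2 * δ ≤ sigma Xs i - sigma Xs j)
    {X X' : Matrix (Fin n) (Fin m) ℝ} {U U' : Matrix (Fin n) (Fin r) ℝ}
    {V V' : Matrix (Fin m) (Fin r) ℝ}
    (h : Balanced hrn hnm X U V) (h' : Balanced hrn hnm X' U' V')
    (hX : X ∈ Metric.closedBall Xs δ) (hX' : X' ∈ Metric.closedBall Xs δ)
    (hR : X.rank = R) (hR' : X'.rank = R)
    {c C : ℝ} (hc : 0 < c) (hs : ∀ i : Fin r, (i : ℕ) < R → c ≤ √(sigma X i)) (hC : ‖U‖ ≤ C) :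
    ∃ e : Fin r → ℝ, (∀ i, e i = 1 ∨ e i = -1) ∧
      ‖U * Matrix.diagonal e - U'‖ ≤ r * ((1 / c + C * (2 / δ)) * ‖X' - X‖) ∧
      ‖V * Matrix.diagonal e - V'‖ ≤ r * ((1 / c + C * (2 / δ)) * ‖X' - X‖) := by
  have hex : ∀ i : Fin r, ∃ ε : ℝ, (ε = 1 ∨ ε = -1) ∧ ((i : ℕ) < R →
      ‖col U' i - ε • col U i‖ ≤ (1 / c + C * (2 / δ)) * ‖X' - X‖ ∧
      ‖col V' i - ε • col V i‖ ≤ (1 / c + C * (2 / δ)) * ‖X' - X‖) := by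
    intro i
    by_cases hi : (i : ℕ) < R
    · obtain ⟨ε, hε, h1, h2⟩ := h.exists_sign hδ hgaps h' hX hX' hc i hi (hs i hi)
      have hσC : √(sigma X i) ≤ C := by
        rw [← h.norm_col_top]; exact (norm_col_le _ _).trans hC
      have hD : (1 / c + √(sigma X i) * (2 / δ)) * ‖X' - X‖ ≤
          (1 / c + C * (2 / δ)) * ‖X' - X‖ :=
        mul_le_mul_of_nonneg_right (add_le_add le_rfl
          (mul_le_mul_of_nonneg_right hσC (by positivity))) (norm_nonneg _)
      exact ⟨ε, hε, fun _ => ⟨h1.trans hD, h2.trans hD⟩⟩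
    · exact ⟨1, Or.inl rfl, fun h => absurd h hi⟩
  choose e he hcol using hex
  have hC0 : 0 ≤ C := (norm_nonneg _).trans hC
  refine ⟨e, he, ?_, ?_⟩
  · refine norm_le_of_col_le (R := R) (by positivity) (fun i hi => ?_) fun i hi => ?_
    · rw [col_sub, col_mul_diagonal, norm_sub_rev]
      exact (hcol i hi).1
    · rw [col_sub, col_mul_diagonal, h.col_top_eq_zero (by rw [hR]; exact hi),
        h'.col_top_eq_zero (by rw [hR']; exact hi)]
      simp
  · refine norm_le_of_col_le (R := R) (by positivity) (fun i hi => ?_) fun i hi => ?_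
    · rw [col_sub, col_mul_diagonal, norm_sub_rev]
      exact (hcol i hi).2
    · rw [col_sub, col_mul_diagonal, h.col_bot_eq_zero (by rw [hR]; exact hi),
        h'.col_bot_eq_zero (by rw [hR']; exact hi)]
      simp

end Signs

/-! ### Limits of the objective -/

theorem tendsto_col {l r : ℕ} {W : ℕ → Matrix (Fin l) (Fin r) ℝ} {Ws : Matrix (Fin l) (Fin r) ℝ}
    (h : Tendsto (fun j => ‖W j - Ws‖) atTop (𝓝 0)) (i : Fin r) :
    Tendsto (fun j => col (W j) i) atTop (𝓝 (col Ws i)) := by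
  rw [tendsto_iff_norm_sub_tendsto_zero]
  refine squeeze_zero (fun _ => norm_nonneg _) (fun j => ?_) h
  rw [← col_sub]
  exact norm_col_le _ _

/-- θ may jump at 0, so convergence of the penalty rests on the dichotomy that a column is either
bounded away from zero or identically zero along the tail. -/
theorem IsPenalty.tendsto_penSum {θ : ℝ → EReal} (hθ : IsPenalty θ) {l r R : ℕ} {c : ℝ} (hc : 0 < c)
    {W : ℕ → Matrix (Fin l) (Fin r) ℝ} {Ws : Matrix (Fin l) (Fin r) ℝ}
    (h : Tendsto (fun j => ‖W j - Ws‖) atTop (𝓝 0))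
    (h1 : ∀ᶠ j in atTop, ∀ i : Fin r, (i : ℕ) < R → c ≤ ‖col (W j) i‖)
    (h2 : ∀ᶠ j in atTop, ∀ i : Fin r, R ≤ i → col (W j) i = 0) :
    Tendsto (fun j => penSum θ (W j)) atTop (𝓝 (penSum θ Ws)) := by
  refine tendsto_finsetSum _ fun i _ => ?_
  have hcol := tendsto_col h i
  rcases lt_or_ge (i : ℕ) R with hi | hi
  · have hci : c ≤ ‖col Ws i‖ := ge_of_tendsto hcol.norm (h1.mono fun j hj => hj i hi)
    exact (hθ.hasDerivAt_pen (hc.trans_le hci)).continuousAt.tendsto.comp hcol.norm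
  · have h0 : (fun _ : ℕ => (0 : EuclideanSpace ℝ (Fin l))) =ᶠ[atTop] fun j => col (W j) i :=
      h2.mono fun j hj => (hj i hi).symm
    have hz : col Ws i = 0 := tendsto_nhds_unique hcol (tendsto_const_nhds.congr' h0)
    rw [hz]
    refine tendsto_const_nhds.congr' (h0.mono fun j hj => ?_)
    simp only at hj ⊢
    rw [← hj]

end

end PAMA

namespace PAMA
noncomputable section

/-! ### Convergence of the values and confinement of the product iterates. -/

section Convergence

variable {n m r : ℕ} {f : Matrix (Fin n) (Fin m) ℝ → ℝ} {θ : ℝ → EReal} {Lf : ℝ≥0}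
  {lam mu rho lgam1 lgam2 : ℝ} {s : Sequences n m r}

theorem firstCountableTopology_matrix {l r : ℕ} :
    FirstCountableTopology (Matrix (Fin l) (Fin r) ℝ) :=
  inferInstanceAs (FirstCountableTopology (Fin l → Fin r → ℝ))

theorem exists_subseq_tendsto {Uhs Ubs : Matrix (Fin n) (Fin r) ℝ}
    {Vhs Vbs : Matrix (Fin m) (Fin r) ℝ} {Xhs Xbs : Matrix (Fin n) (Fin m) ℝ}
    (hW : MapClusterPt (Uhs, Vhs, Ubs, Vbs, Xhs, Xbs) atTop
      fun k => (s.Uh k, s.Vh k, s.Ub k, s.Vb k, s.Xh k, s.Xb k)) :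
    ∃ ψ : ℕ → ℕ, StrictMono ψ ∧ Tendsto (fun j => ‖s.Ub (ψ j) - Ubs‖) atTop (𝓝 0) ∧
      Tendsto (fun j => ‖s.Vb (ψ j) - Vbs‖) atTop (𝓝 0) ∧
      Tendsto (fun j => ‖s.Xb (ψ j) - Xbs‖) atTop (𝓝 0) := by
  have i1 := @firstCountableTopology_matrix n r
  have i2 := @firstCountableTopology_matrix m r
  have i3 := @firstCountableTopology_matrix n m
  obtain ⟨ψ, h1, h2⟩ := hW.tendsto_subseq
  exact ⟨ψ, h1, tendsto_iff_norm_sub_tendsto_zero.1 h2.snd_nhds.snd_nhds.fst_nhds,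
    tendsto_iff_norm_sub_tendsto_zero.1 h2.snd_nhds.snd_nhds.snd_nhds.fst_nhds,
    tendsto_iff_norm_sub_tendsto_zero.1 h2.snd_nhds.snd_nhds.snd_nhds.snd_nhds.snd_nhds⟩

/-- Indices start at 0, so index `Xs.rank` is the first zero singular value. Positivity needs
distinctness below that index and positivity of the last nonzero value at it. -/
theorem gap_of_isLeast {Xs : Matrix (Fin n) (Fin m) ℝ}
    (hdist : ∀ i j, i < Xs.rank → j < Xs.rank → i ≠ j → sigma Xs i ≠ sigma Xs j)
    {δ : ℝ} (hδ : IsLeast {d | ∃ i j : ℕ, i < j ∧ j ≤ Xs.rank ∧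
      d = sigma Xs i - sigma Xs j} (2 * δ)) :
    0 < δ ∧ ∀ i j : ℕ, i < j → j ≤ Xs.rank → 2 * δ ≤ sigma Xs i - sigma Xs j := by
  refine ⟨?_, fun i j hij hj => hδ.2 ⟨i, j, hij, hj, rfl⟩⟩
  obtain ⟨i, j, hij, hj, h⟩ := hδ.1
  have hlt : sigma Xs j < sigma Xs i := by
    rcases hj.lt_or_eq with hj' | hj'
    · exact lt_of_le_of_ne (sigma_antitone Xs hij.le) (hdist j i hj' (hij.trans hj') hij.ne')
    · rw [sigma_eq_zero_of_rank_le Xs hj'.ge]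
      exact (sigma_pos_iff Xs i).2 (hij.trans_le hj)
  linarith

/-- The step estimate resulting from sufficient decrease and the KL inequality. -/
theorem step_le_of_concave {η : EReal} {φ : ℝ → ℝ}
    (hφ : ConcaveOn ℝ {s : ℝ | 0 ≤ s ∧ (s : EReal) < η} φ)
    (hφ1 : ContDiffOn ℝ 1 φ {s : ℝ | 0 < s ∧ (s : EReal) < η})
    (hφ' : ∀ s : ℝ, 0 < s → (s : EReal) < η → 0 < deriv φ s)
    {c₁ c₂ d d' s t : ℝ} (hc₁ : 0 < c₁) (hc₂ : 0 ≤ c₂) (hd : 0 ≤ d)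
    (ht : 0 ≤ t) (hts : t ≤ s) (hs : (s : EReal) < η) (hdec : c₁ / 2 * d' ^ 2 ≤ s - t)
    (hKL : 0 < s → 1 ≤ deriv φ s * (c₂ * d)) :
    d' ≤ d / 2 + (c₂ / c₁ * φ s - c₂ / c₁ * φ t) := by
  rcases (ht.trans hts).eq_or_lt with h0 | h0
  · obtain rfl : t = s := le_antisymm hts (h0 ▸ ht)
    have h1 : d' ^ 2 ≤ 0 := by
      rw [sub_self] at hdec
      exact nonpos_of_mul_nonpos_right hdec (by positivity)
    have h2 : d' = 0 := pow_eq_zero_iff two_ne_zero |>.1 (le_antisymm h1 (sq_nonneg _))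
    rw [h2]
    linarith
  · have h1 := concave_deriv_mul_sub_le hφ hφ1 ht hts h0 hs
    have h2 : 0 ≤ s - t := sub_nonneg.2 hts
    have h3 : 0 ≤ φ s - φ t := (mul_nonneg (hφ' s h0 hs).le h2).trans h1
    rw [← mul_sub]
    refine le_half_add_of_sq_le (by positivity) hd ?_
    have h4 : s - t ≤ c₂ * d * (φ s - φ t) := by
      calc s - t ≤ deriv φ s * (c₂ * d) * (s - t) := le_mul_of_one_le_left h2 (hKL h0)
        _ = c₂ * d * (deriv φ s * (s - t)) := by ring
        _ ≤ c₂ * d * (φ s - φ t) := by gcongr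
    have h5 : c₁ / 2 * d' ^ 2 ≤ c₁ / 2 * (2 * d * (c₂ / c₁ * (φ s - φ t))) := by
      refine (hdec.trans h4).trans_eq ?_
      field_simp
    exact le_of_mul_le_mul_left h5 (by positivity)

theorem IsRun.antitone_objR (hs : IsRun f θ Lf lam mu rho lgam1 lgam2 s) (hθ : IsPenalty θ)
    (hrn : r ≤ n) (hnm : n ≤ m) (hA : FactorizationOptimal n m r hrn (hrn.trans hnm) θ)
    (hf : Differentiable ℝ f) (hL : LipschitzWith Lf (matGrad f)) (hlam : 0 < lam) (hmu : 0 < mu)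
    (hl1 : 0 < lgam1) (hl2 : 0 < lgam2) :
    Antitone fun k => objR f θ lam mu (s.Ub k) (s.Vb k) := by
  obtain ⟨c, hc, hdec⟩ := hs.exists_decrease hθ hrn hnm hA hf hL hlam hmu hl1 hl2
  refine antitone_nat_of_succ_le fun k => ?_
  have h1 := hdec k
  have h2 : 0 ≤ c * (‖s.U (k + 1) - s.Ub k‖ ^ 2 + ‖s.V (k + 1) - s.Vh (k + 1)‖ ^ 2) := by
    positivity
  linarith

/-- The objective is continuous along convergent subsequences of the iterates. -/
theorem IsRun.tendsto_objR_subseq (hs : IsRun f θ Lf lam mu rho lgam1 lgam2 s) (hθ : IsPenalty θ)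
    (hrn : r ≤ n) (hnm : n ≤ m) (hf : Differentiable ℝ f)
    {c C : ℝ} {R K : ℕ} (hc : 0 < c) (hT : TailBounds s c C R K)
    {Us : Matrix (Fin n) (Fin r) ℝ} {Vs : Matrix (Fin m) (Fin r) ℝ} {ψ : ℕ → ℕ}
    (hψ : StrictMono ψ) (hU : Tendsto (fun j => ‖s.Ub (ψ j) - Us‖) atTop (𝓝 0))
    (hV : Tendsto (fun j => ‖s.Vb (ψ j) - Vs‖) atTop (𝓝 0)) :
    Tendsto (fun j => objR f θ lam mu (s.Ub (ψ j)) (s.Vb (ψ j))) atTop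
      (𝓝 (objR f θ lam mu Us Vs)) := by
  have hK : ∀ᶠ j in atTop, K ≤ ψ j := hψ.tendsto_atTop.eventually_ge_atTop K
  have hU' := tendsto_iff_norm_sub_tendsto_zero.2 hU
  have hV' := tendsto_iff_norm_sub_tendsto_zero.2 hV
  have hb := fun k => hs.balanced_bar hrn hnm k
  have pU := hθ.tendsto_penSum (R := R) hc hU
    (hK.mono fun j hj i hi => by rw [(hb _).norm_col_top]; exact hT.sigma_Xb _ hj i hi)
    (hK.mono fun j hj i hi => (hb _).col_top_eq_zero ((hT.rank_Xb _ hj).trans_le hi))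
  have pV := hθ.tendsto_penSum (R := R) hc hV
    (hK.mono fun j hj i hi => by rw [(hb _).norm_col_bot]; exact hT.sigma_Xb _ hj i hi)
    (hK.mono fun j hj i hi => (hb _).col_bot_eq_zero ((hT.rank_Xb _ hj).trans_le hi))
  have hprod : Tendsto (fun j => s.Ub (ψ j) * (s.Vb (ψ j))ᵀ) atTop (𝓝 (Us * Vsᵀ)) := by
    have hcont : Continuous fun p : Matrix (Fin n) (Fin r) ℝ × Matrix (Fin m) (Fin r) ℝ =>
        p.1 * p.2ᵀ := continuous_fst.matrix_mul continuous_snd.matrix_transpose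
    exact (hcont.tendsto (Us, Vs)).comp (hU'.prodMk_nhds hV')
  exact (((hf.continuous.tendsto _).comp hprod).add ((pU.add pV).const_mul lam)).add
    (((hU'.norm.pow 2).add (hV'.norm.pow 2)).const_mul (mu / 2))

/-- The KL inequality expressed through the partial gradients. -/
theorem IsPenalty.one_le_deriv_mul (hθ : IsPenalty θ) (hf : Differentiable ℝ f)
    (hL : LipschitzWith Lf (matGrad f)) (hlam : 0 < lam) (hmu : 0 < mu)
    {φ : ℝ → ℝ} {η : EReal} {x₀ : FactorSpace n m r} {Hs : ℝ}
    (hx₀ : objectiveOn f θ lam mu x₀ = (Hs : EReal))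
    {U : Matrix (Fin n) (Fin r) ℝ} {V : Matrix (Fin m) (Fin r) ℝ}
    (hKL : objectiveOn f θ lam mu x₀ < objectiveOn f θ lam mu (stack U V) →
      objectiveOn f θ lam mu (stack U V) < objectiveOn f θ lam mu x₀ + η →
      1 ≤ ENNReal.ofReal (deriv φ ((objectiveOn f θ lam mu (stack U V) -
          objectiveOn f θ lam mu x₀).toReal)) *
        Metric.infEDist 0 (subdifferential (objectiveOn f θ lam mu) (stack U V)))
    (h0 : 0 < objR f θ lam mu U V - Hs) (h1 : ((objR f θ lam mu U V - Hs : ℝ) : EReal) < η)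
    (hφ' : 0 < deriv φ (objR f θ lam mu U V - Hs)) {G : ℝ}
    (hG : ‖gradTop f θ lam mu U V‖ + ‖gradBot f θ lam mu U V‖ ≤ G) :
    1 ≤ deriv φ (objR f θ lam mu U V - Hs) * G := by
  rw [hx₀, objectiveOn_stack, hθ.objective_eq, ← EReal.coe_sub, EReal.toReal_coe] at hKL
  have h2 : ((objR f θ lam mu U V : ℝ) : EReal) < (Hs : EReal) + η := by
    have h3 := EReal.add_lt_add_left_coe h1 Hs
    rwa [← EReal.coe_add, add_sub_cancel] at h3
  have h3 := hKL (EReal.coe_lt_coe_iff.2 (sub_pos.1 h0)) h2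
  have h4 := h3.trans (mul_le_mul_right
    (hθ.infEDist_subdifferential_le hf hL hlam hmu U V hG) _)
  rw [← ENNReal.ofReal_mul hφ'.le] at h4
  exact ENNReal.one_le_ofReal.1 h4

theorem IsRun.norm_Xh_sub_le (hs : IsRun f θ Lf lam mu rho lgam1 lgam2 s)
    (hrn : r ≤ n) (hnm : n ≤ m) {c C : ℝ} {R K : ℕ} (hT : TailBounds s c C R K)
    {k : ℕ} (hk : K ≤ k) : ‖s.Xh (k + 1) - s.Xb k‖ ≤ C * ‖s.U (k + 1) - s.Ub k‖ := by
  rw [hs.Xh_eq_mul k, (hs.balanced_bar hrn hnm k).1, ← Matrix.sub_mul]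
  refine (norm_mul_le_frob _ _).trans ?_
  rw [norm_transpose_frob, mul_comm]
  exact mul_le_mul_of_nonneg_right (hT.norm_Vb k hk) (norm_nonneg _)

theorem IsRun.norm_Xb_sub_Xh_le (hs : IsRun f θ Lf lam mu rho lgam1 lgam2 s)
    (hrn : r ≤ n) (hnm : n ≤ m) {c C : ℝ} {R K : ℕ} (hT : TailBounds s c C R K)
    {k : ℕ} (hk : K ≤ k) :
    ‖s.Xb (k + 1) - s.Xh (k + 1)‖ ≤ C * ‖s.V (k + 1) - s.Vh (k + 1)‖ := by
  rw [hs.Xb_eq_mul k, (hs.balanced_hat hrn hnm k).1, ← Matrix.mul_sub, ← Matrix.transpose_sub]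
  refine (norm_mul_le_frob _ _).trans ?_
  rw [norm_transpose_frob]
  exact mul_le_mul_of_nonneg_right (hT.norm_Uh k hk) (norm_nonneg _)

/-- Under the KL property the product iterates remain near an accumulation point. -/
theorem IsRun.eventually_Xb_mem_closedBall (hs : IsRun f θ Lf lam mu rho lgam1 lgam2 s)
    (hθ : IsPenalty θ)
    (hrn : r ≤ n) (hnm : n ≤ m) (hA : FactorizationOptimal n m r hrn (hrn.trans hnm) θ)
    (hbdd : BddBelow (Set.range f))
    (hf : Differentiable ℝ f) (hL : LipschitzWith Lf (matGrad f)) (hlam : 0 < lam) (hmu : 0 < mu)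
    (hl1 : 0 < lgam1) (hl2 : 0 < lgam2)
    {c C : ℝ} {R K : ℕ} (hc : 0 < c) (hT : TailBounds s c C R K)
    {Us : Matrix (Fin n) (Fin r) ℝ} {Vs : Matrix (Fin m) (Fin r) ℝ}
    {Xs : Matrix (Fin n) (Fin m) ℝ} {ψ : ℕ → ℕ}
    (hψ : StrictMono ψ) (hU : Tendsto (fun j => ‖s.Ub (ψ j) - Us‖) atTop (𝓝 0))
    (hV : Tendsto (fun j => ‖s.Vb (ψ j) - Vs‖) atTop (𝓝 0))
    (hX : Tendsto (fun j => ‖s.Xb (ψ j) - Xs‖) atTop (𝓝 0))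
    {δ : ℝ} (hδ : 0 < δ)
    (hgaps : ∀ i j : ℕ, i < j → j ≤ R → 2 * δ ≤ sigma Xs i - sigma Xs j)
    {cs : ℝ} (hcs : 0 < cs) (hrel : ∀ k ≥ K, s.Xb k ∈ Metric.closedBall Xs δ →
      s.Xh (k + 1) ∈ Metric.closedBall Xs δ → s.Xb (k + 1) ∈ Metric.closedBall Xs δ →
      ‖gradTop f θ lam mu (s.Ub (k + 1)) (s.Vb (k + 1))‖ +
        ‖gradBot f θ lam mu (s.Ub (k + 1)) (s.Vb (k + 1))‖ ≤
      cs * (‖s.Xb (k + 1) - s.Xb k‖ + ‖s.Xh (k + 1) - s.Xb k‖) +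
        cs * (‖s.U (k + 1) - s.Ub k‖ + ‖s.V (k + 1) - s.Vh (k + 1)‖))
    (hKL : HasKLProperty (objectiveOn f θ lam mu) (stack Us Vs)) :
    ∃ l, ∀ k ≥ l, s.Xb k ∈ Metric.closedBall Xs (δ / 2) := by
  have hC : 0 ≤ C := (norm_nonneg _).trans (hT.norm_Ub K le_rfl)
  obtain ⟨-, η, φ, N, hη, hN, hφc, hφ, hφ0, hφz, hφ1, hφ', hKLi⟩ := hKL
  obtain ⟨ε, hε, hεN⟩ := Metric.mem_nhds_iff.1 hN
  obtain ⟨c₁, hc₁, hdec⟩ := hs.exists_decrease hθ hrn hnm hA hf hL hlam hmu hl1 hl2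
  have hanti := hs.antitone_objR hθ hrn hnm hA hf hL hlam hmu hl1 hl2
  have hsub := hs.tendsto_objR_subseq (lam := lam) (mu := mu) hθ hrn hnm hf hc hT hψ hU hV
  obtain ⟨ta, tb⟩ := hs.tendsto_steps hθ hrn hnm hA hf hL hlam hmu hl1 hl2 hbdd
  set H := fun k => objR f θ lam mu (s.Ub k) (s.Vb k) with hH
  set Hs := objR f θ lam mu Us Vs with hHs
  have hx₀ : objectiveOn f θ lam mu (stack Us Vs) = (Hs : EReal) := by
    rw [objectiveOn_stack, hθ.objective_eq]
  obtain ⟨B, hB⟩ := hbdd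
  have hHlim : Tendsto H atTop (𝓝 Hs) := by
    have hbb : BddBelow (Set.range H) := by
      refine ⟨B, ?_⟩
      rintro _ ⟨k, rfl⟩
      have := objR_ge hθ hlam hmu (B := B) (fun X => hB ⟨X, rfl⟩) (s.Ub k) (s.Vb k)
      have h2 : 0 ≤ mu / 2 * (‖s.Ub k‖ ^ 2 + ‖s.Vb k‖ ^ 2) := by positivity
      simp only [hH]
      linarith
    have h1 := tendsto_atTop_ciInf hanti hbb
    have h2 := tendsto_nhds_unique (h1.comp hψ.tendsto_atTop) hsub
    rwa [h2] at h1
  have hHge : ∀ k, Hs ≤ H k := fun k => hanti.le_of_tendsto hHlim k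
  set d : ℕ → ℝ := fun k => ‖s.U (k + 1) - s.Ub k‖ + ‖s.V (k + 1) - s.Vh (k + 1)‖ with hd
  have hd0 : ∀ k, 0 ≤ d k := fun k => by positivity
  have hdlim : Tendsto d atTop (𝓝 0) := by simpa using ta.add tb
  have hdd : ∀ k, c₁ / 2 * d k ^ 2 ≤ H k - H (k + 1) := fun k => by
    have h1 := hdec k
    have h2 : d k ^ 2 ≤ 2 * (‖s.U (k + 1) - s.Ub k‖ ^ 2 + ‖s.V (k + 1) - s.Vh (k + 1)‖ ^ 2) :=
      add_sq_le
    have h3 := mul_le_mul_of_nonneg_left h2 (half_pos hc₁).le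
    simp only [hH]
    linarith
  -- Both matrix differences in the relative error are at most C d_k, and the factor steps
  -- contribute d_k itself.
  set c₂ := cs * (2 * C + 1) with hc₂
  have hc₂0 : 0 ≤ c₂ := by positivity
  set M := r * (1 / c + C * (2 / δ)) with hM
  have hM0 : 0 ≤ M := by positivity
  -- The first bound leaves room for X̂^{k+1} in the δ-ball. The second makes two products within ρ
  -- of the limit have sign-matched factors within ε/8.
  set ρ := min (δ / 2) (ε / (16 * (M + 1))) with hρ
  have hρ0 : 0 < ρ := by positivity
  have hρδ : ρ ≤ δ / 2 := min_le_left _ _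
  have hρM : M * (2 * ρ) ≤ ε / 8 := by
    have h1 : ρ ≤ ε / (16 * (M + 1)) := min_le_right _ _
    rw [le_div_iff₀ (by positivity)] at h1
    nlinarith
  -- As η may be infinite, a real number below it serves to place the tail values in the KL range.
  obtain ⟨e, he0, heη⟩ := EReal.lt_iff_exists_real_btwn.1 hη
  -- an iterate close to the accumulation point
  obtain ⟨j, ⟨hjU, hjV⟩, hjX, hjK⟩ := (((hU.eventually_lt_const (by positivity : 0 < ε / 4)).and
    (hV.eventually_lt_const (by positivity : 0 < ε / 4))).and
    ((hX.eventually_lt_const hρ0).and (hψ.tendsto_atTop.eventually_ge_atTop K))).exists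
  -- the tail on which all estimates hold
  obtain ⟨K', hK'⟩ := eventually_atTop.1 ((eventually_ge_atTop K).and
    ((hHlim.eventually_lt_const (by simpa using he0 : Hs < Hs + e)).and
    ((by simpa using ta.const_mul C :
      Tendsto (fun k => C * ‖s.U (k + 1) - s.Ub k‖) atTop (𝓝 0)).eventually_lt_const
        (half_pos hδ))))
  have hHη : ∀ k ≥ K', ((H k - Hs : ℝ) : EReal) < η := fun k hk =>
    (EReal.coe_lt_coe_iff.2 (by linarith [(hK' k hk).2.1])).trans heη
  have hstep : ∀ k ≥ K', ‖s.Xb (k + 1) - s.Xb k‖ ≤ C * d k := fun k hk => by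
    have h1 := hs.norm_Xh_sub_le hrn hnm hT (hK' k hk).1
    have h2 := hs.norm_Xb_sub_Xh_le hrn hnm hT (hK' k hk).1
    have h3 := norm_sub_le_norm_sub_add_norm_sub (s.Xb (k + 1)) (s.Xh (k + 1)) (s.Xb k)
    simp only [hd, mul_add]
    linarith
  have hφlim : Tendsto (fun k => φ (H k - Hs)) atTop (𝓝 0) := by
    have h1 := hφc 0 ⟨le_rfl, hη⟩
    rw [ContinuousWithinAt, hφz] at h1
    refine h1.comp (tendsto_nhdsWithin_iff.2 ⟨?_, ?_⟩)
    · simpa using hHlim.sub_const Hs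
    · filter_upwards [eventually_ge_atTop K'] with k hk
      exact ⟨sub_nonneg.2 (hHge k), hHη k hk⟩
  have hmain := eventually_mem_closedBall_of_step (Y := s.Xb) (y := Xs) (d := d)
    (ψ := fun k => c₂ / c₁ * φ (H k - Hs)) (A := C) (ρ := ρ) (K := K') hC hρ0 hd0
    (fun k hk => mul_nonneg (by positivity) (hφ0 _ (sub_nonneg.2 (hHge k)) (hHη k hk)))
    hdlim (by simpa using hφlim.const_mul (c₂ / c₁)) ?_ ?_ ?_
  · obtain ⟨l, hl⟩ := hmain
    exact ⟨l, fun k hk => (hl k hk).trans hρδ⟩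
  · refine hψ.tendsto_atTop.frequently (Eventually.frequently ?_)
    filter_upwards [hX.eventually_lt_const (half_pos hρ0)] with i hi
    rwa [dist_eq_norm]
  · intro k hk
    rw [dist_eq_norm]
    exact hstep k hk
  · intro k hk hk1 hk2
    have hkK := (hK' k hk).1
    refine step_le_of_concave hφ hφ1 hφ' hc₁ hc₂0 (hd0 k) (sub_nonneg.2 (hHge _))
      (sub_le_sub_right (hanti (Nat.le_succ (k + 1))) _) (hHη _ (by omega)) ?_ ?_
    · rw [sub_sub_sub_cancel_right]
      exact hdd (k + 1)
    intro hpos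
    rw [dist_eq_norm] at hk1 hk2
    have hXh := hs.norm_Xh_sub_le hrn hnm hT hkK
    have m0 : s.Xb k ∈ Metric.closedBall Xs δ := by
      rw [mem_closedBall_iff_norm]
      linarith
    have m1 : s.Xh (k + 1) ∈ Metric.closedBall Xs δ := by
      rw [mem_closedBall_iff_norm]
      have := norm_sub_le_norm_sub_add_norm_sub (s.Xh (k + 1)) (s.Xb k) Xs
      linarith [(hK' k hk).2.2]
    have m2 : s.Xb (k + 1) ∈ Metric.closedBall Xs δ := by
      rw [mem_closedBall_iff_norm]
      linarith
    have m3 : s.Xb (ψ j) ∈ Metric.closedBall Xs δ := by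
      rw [mem_closedBall_iff_norm]
      linarith
    have hgrad : ‖gradTop f θ lam mu (s.Ub (k + 1)) (s.Vb (k + 1))‖ +
        ‖gradBot f θ lam mu (s.Ub (k + 1)) (s.Vb (k + 1))‖ ≤ c₂ * d k := by
      refine (hrel k hkK m0 m1 m2).trans ?_
      have h1 := hstep k hk
      have h2 : ‖s.Xh (k + 1) - s.Xb k‖ ≤ C * d k :=
        hXh.trans (mul_le_mul_of_nonneg_left (le_add_of_nonneg_right (norm_nonneg _)) hC)
      calc _ ≤ cs * (C * d k + C * d k) + cs * d k := by gcongr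
        _ = c₂ * d k := by rw [hc₂]; ring
    -- The current iterate is aligned with one fixed iterate near the accumulation point. Each
    -- aligned factor is then within ε/8 + ε/4 of its limit, so the pair lies in the KL
    -- neighbourhood.
    obtain ⟨E, hE, hEU, hEV⟩ := (hs.balanced_bar hrn hnm (k + 1)).exists_sign_matrix hδ hgaps
      (hs.balanced_bar hrn hnm (ψ j)) m2 m3 (hT.rank_Xb _ (by omega)) (hT.rank_Xb _ hjK) hc
      (fun i hi => hT.sigma_Xb _ (by omega) i hi) (hT.norm_Ub _ (by omega))
    have hdistX : ‖s.Xb (ψ j) - s.Xb (k + 1)‖ ≤ 2 * ρ := by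
      have := norm_sub_le_norm_sub_add_norm_sub (s.Xb (ψ j)) Xs (s.Xb (k + 1))
      rw [norm_sub_rev Xs] at this
      linarith
    have hbound : (r : ℝ) * ((1 / c + C * (2 / δ)) * ‖s.Xb (ψ j) - s.Xb (k + 1)‖) ≤ ε / 8 := by
      rw [← mul_assoc]
      exact (mul_le_mul_of_nonneg_left hdistX hM0).trans hρM
    have hmem : stack (s.Ub (k + 1) * Matrix.diagonal E) (s.Vb (k + 1) * Matrix.diagonal E) ∈ N := by
      apply hεN
      rw [Metric.mem_ball, dist_eq_norm, stack_sub]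
      refine (norm_stack_le _ _).trans_lt ?_
      have h1 := norm_sub_le_norm_sub_add_norm_sub (s.Ub (k + 1) * Matrix.diagonal E)
        (s.Ub (ψ j)) Us
      have h2 := norm_sub_le_norm_sub_add_norm_sub (s.Vb (k + 1) * Matrix.diagonal E)
        (s.Vb (ψ j)) Vs
      linarith
    have hval : objR f θ lam mu (s.Ub (k + 1) * Matrix.diagonal E)
        (s.Vb (k + 1) * Matrix.diagonal E) = H (k + 1) := objR_mul_sign _ _ hE
    have hfin := hθ.one_le_deriv_mul hf hL hlam hmu (η := η) (φ := φ) hx₀ (hKLi _ hmem)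
      (by rw [hval]; exact hpos) (by rw [hval]; exact hHη _ (by omega))
      (by rw [hval]; exact hφ' _ hpos (hHη _ (by omega)))
      (G := c₂ * d k)
      (by rw [norm_gradTop_mul_sign _ _ hE, norm_gradBot_mul_sign _ _ hE]; exact hgrad)
    rwa [hval] at hfin

end Convergence

end

end PAMA

/-! ### The main theorem. -/

theorem mainTheorem7
    (n m r : ℕ) (hr : 1 ≤ r) (hrn : r ≤ n) (hnm : n ≤ m)
    -- the model
    (f : Matrix (Fin n) (Fin m) ℝ → ℝ) (Lf : ℝ≥0)
    (hf_bdd : BddBelow (Set.range f)) (hf_diff : Differentiable ℝ f)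
    (hf_lip : LipschitzWith Lf (PAMA.matGrad f))
    (θ : ℝ → EReal) (hθ : PAMA.IsPenalty θ)
    (lam mu : ℝ) (hlam : 0 < lam) (hmu : 0 < mu)
    -- the run of the algorithm
    (rho lgam1 lgam2 : ℝ) (hrho : rho ∈ Set.Ioo (0 : ℝ) 1)
    (hlgam1 : 0 < lgam1) (hlgam2 : 0 < lgam2)
    (s : PAMA.Sequences n m r) (hs : PAMA.IsRun f θ Lf lam mu rho lgam1 lgam2 s)
    -- the standing assumptions on `θ`
    (hA1 : PAMA.FactorizationOptimal n m r hrn (hrn.trans hnm) θ)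
    (β : ℝ) (hβ : PAMA.IsScalingBound Lf mu s β)
    (hA2 : PAMA.ProxGap θ (lam / β) (lam / (mu + min lgam1 lgam2)))
    (hθ' : LocallyLipschitzOn (Set.Ioi 0) (PAMA.penaltyDeriv θ))
    -- an accumulation point of the iterates
    (Uhs Ubs : Matrix (Fin n) (Fin r) ℝ) (Vhs Vbs : Matrix (Fin m) (Fin r) ℝ)
    (Xhs Xbs : Matrix (Fin n) (Fin m) ℝ)
    (hW : MapClusterPt (Uhs, Vhs, Ubs, Vbs, Xhs, Xbs) atTop
      fun k => (s.Uh k, s.Vh k, s.Ub k, s.Vb k, s.Xh k, s.Xb k))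
    -- distinct nonzero singular values, with gap `2 δ`
    (hdist : ∀ i j, i < Xbs.rank → j < Xbs.rank → i ≠ j → PAMA.sigma Xbs i ≠ PAMA.sigma Xbs j)
    (δ : ℝ) (hδ : IsLeast {d | ∃ i j : ℕ, i < j ∧ j ≤ Xbs.rank ∧
      d = PAMA.sigma Xbs i - PAMA.sigma Xbs j} (2 * δ)) :
    -- (i)
    (∀ X ∈ Metric.closedBall Xbs δ, X.rank = Xbs.rank →
      ∀ X' ∈ Metric.closedBall Xbs δ, X'.rank = Xbs.rank →
      ∀ U V, (U, V) ∈ PAMA.svdPairs X → ∀ U' V', (U', V') ∈ PAMA.svdPairs X' →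
      ∀ i : Fin n, (i : ℕ) < Xbs.rank → ∃ ε : ℝ, (ε = 1 ∨ ε = -1) ∧
        ‖WithLp.toLp 2 (fun a => U a i - ε * U' a i)‖ ≤ 2 / δ * ‖X - X'‖ ∧
        ‖WithLp.toLp 2 (fun b => V b (Fin.castLE hnm i) - ε * V' b (Fin.castLE hnm i))‖ ≤
          2 / δ * ‖X - X'‖) ∧
    -- (ii)
    (PAMA.HasKLProperty (PAMA.objectiveOn f θ lam mu) (PAMA.stack Ubs Vbs) →
      ∃ cs : ℝ, 0 < cs ∧ ∃ kbar : ℕ, ∀ k ≥ kbar,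
        s.Xb k ∈ Metric.ball Xbs δ ∧ (s.Xb k).rank = Xbs.rank ∧
        Metric.infEDist 0 (PAMA.subdifferential (PAMA.objectiveOn f θ lam mu)
            (PAMA.stack (s.Ub (k + 1)) (s.Vb (k + 1)))) ≤
          ENNReal.ofReal (cs * (‖s.Xb (k + 1) - s.Xb k‖ + ‖s.Xh (k + 1) - s.Xb k‖) +
            cs * (‖s.U (k + 1) - s.Ub k‖ + ‖s.V (k + 1) - s.Vh (k + 1)‖))) := by
  obtain ⟨hδ0, hgaps⟩ := PAMA.gap_of_isLeast hdist hδ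
  refine ⟨fun X hX _ X' hX' _ U V hUV U' V' hUV' i hi =>
    PAMA.svd_perturbation hnm hδ0 hgaps hX hX' hUV hUV' i hi, fun hKL => ?_⟩
  obtain ⟨ψ, hψ, hU, hV, hX⟩ := PAMA.exists_subseq_tendsto hW
  obtain ⟨c, C, R, K, hc, hT⟩ := hs.exists_tailBounds hθ hr hrn hnm hA1 hf_diff hf_lip hlam hmu
    hlgam1 hlgam2 hf_bdd hβ hA2
  have hclus : MapClusterPt Xbs atTop s.Xb :=
    (tendsto_iff_norm_sub_tendsto_zero.2 hX).mapClusterPt.of_comp hψ.tendsto_atTop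
  have hR : Xbs.rank = R := hT.rank_clusterPt hc hs hrn hnm hclus
  -- The rank at the accumulation point equals the eventual rank, so the spectral gap covers exactly
  -- the columns that stay nonzero.
  rw [hR] at hgaps ⊢
  obtain ⟨cs, hcs, hrel⟩ := hs.exists_relative_error hθ hrn hnm hf_lip hlam hmu hlgam1 hlgam2 hβ hθ'
    hc hT hδ0 hgaps
  obtain ⟨l, hl⟩ := hs.eventually_Xb_mem_closedBall hθ hrn hnm hA1 hf_bdd hf_diff hf_lip hlam hmu
    hlgam1 hlgam2 hc hT hψ hU hV hX hδ0 hgaps hcs hrel hKL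
  have ta := (hs.tendsto_steps hθ hrn hnm hA1 hf_diff hf_lip hlam hmu hlgam1 hlgam2 hf_bdd).1
  obtain ⟨l', hl'⟩ := eventually_atTop.1 ((by simpa using ta.const_mul C :
    Tendsto (fun k => C * ‖s.U (k + 1) - s.Ub k‖) atTop (𝓝 0)).eventually_lt_const (half_pos hδ0))
  -- Beyond this index the bar products stay within δ/2 and the hat step is shorter than δ/2, so all
  -- three matrices in the relative error bound lie in the δ-ball.
  refine ⟨cs, hcs, max K (max l l'), fun k hk => ?_⟩
  have hkK : K ≤ k := (le_max_left _ _).trans hk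
  have hkl : l ≤ k := ((le_max_left _ _).trans (le_max_right _ _)).trans hk
  have hkl' : l' ≤ k := ((le_max_right _ _).trans (le_max_right _ _)).trans hk
  have m0 := hl k hkl
  have m1 := hl (k + 1) (by omega)
  have m2 : s.Xh (k + 1) ∈ Metric.closedBall Xbs δ := by
    rw [mem_closedBall_iff_norm] at m0 ⊢
    have h1 := norm_sub_le_norm_sub_add_norm_sub (s.Xh (k + 1)) (s.Xb k) Xbs
    have h2 := hs.norm_Xh_sub_le hrn hnm hT hkK
    linarith [hl' k hkl']
  have hball : Metric.closedBall Xbs (δ / 2) ⊆ Metric.closedBall Xbs δ :=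
    Metric.closedBall_subset_closedBall (by linarith)
  exact ⟨Metric.closedBall_subset_ball (by linarith) m0, hT.rank_Xb k hkK,
    hθ.infEDist_subdifferential_le hf_diff hf_lip hlam hmu _ _
      (hrel k hkK (hball m0) m2 (hball m1))⟩
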